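/- **Setting.** Let $d\ge 1$, let $|\cdot|$ be the Euclidean norm on $\mathbb R^d$ and $\|\cdot\|$ the associated operator norm on matrices. Write $f\preceq g$ if $f\le Cg$ for some constant $C>0$ that does not depend on the argument $h$. Let $H<GL(d,\mathbb R)$ be a closed matrix group with a left Haar measure $dh$ and modular function $\Delta_H$. $H$ is *irreducibly admissible* if the quasi-regular representation $[\pi(x,h)f](y)=|\det h|^{-1/2}f(h^{-1}(y-x))$ of $\mathbb R^d\rtimes H$ on $L^2(\mathbb R^d)$ is irreducible and square-integrable, i.e. for some $\psi\ne 0$ the function $(x,h)\mapsto\langle\psi,\pi(x,h)\psi\rangle$ is square-integrable with respect to left Haar measure $|\det h|^{-1}dx\,dh$. $H$ is a *generalized shearlet dilation group* if it is irreducibly admissible and has closed subgroups $S,D$ such that: $S$ is connected, abelian and consists of upper triangular matrices with ones on the diagonal; $D=\{\exp(rY):r\in\mathbb R\}$ with a diagonal matrix $Y$; every $h\in H$ can be written uniquely as $h=\pm\delta s$ with $\delta\in D$, $s\in S$. Let $\mathfrak s=\{X:\exp(\mathbb RX)\subset S\}$ be the Lie algebra of $S$, and let $n$ be its nilpotency class,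 the least $n$ with $\mathfrak s^n=\{0\}$, where $\mathfrak s^n$ is the span of all matrix products of $n$ elements of $\mathfrak s$. For the open orbit $\mathcal O\subset\mathbb R^d$ of the dual action $(\xi,h)\mapsto h^T\xi$ put $$A(\xi)=\min\left(\frac{\mathrm{dist}(\xi,\mathcal O^c)}{1+\sqrt{|\xi|^2-\mathrm{dist}(\xi,\mathcal O^c)^2}},\ \frac1{1+|\xi|}\right),\qquad A_H(h)=A(h^T\xi_0)\quad(\xi_0\in\mathcal O),\qquad \Phi_\ell(h)=\int_{\mathcal O}A(\xi)^\ell A(h^T\xi)^\ell\,d\xi .$$ A *weight* is a continuous submultiplicative function $w:H\to(0,\infty)$; it is *polynomially bounded* if $w(h)\preceq(1+\|h\|)^k(1+\|h^{-1}\|)^k$ for some $k$. For $s\ge0$, $1\le q<\infty$, $\ell\in\mathbb N$: * $\mathcal O$ is *$(s,q,w)$-temperately embedded with index $\ell$* if $h\mapsto|\det h|^{1/2-1/q}(1+\|h\|)^{s+d+1}w(h)A(h^T\xi_0)^\ell$ is in $L^q(H)$ and $h\mapsto|\det h|^{-1/2-1/q}(1+\|h\|)^{s+d+1}w(h)A(h^{-T}\xi_0)^\ell$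 is in $L^1(H)$ (for all $\xi_0\in\mathcal O$; this does not depend on $\xi_0$). * $\mathcal O$ is *strongly $(s,w)$-temperately embedded with index $\ell$* if $\Phi_\ell$ is finite and continuous, and, with $m(h)=w(h)|\det h|^{-1/2}(1+\|h\|)^{2(s+d+1)}$, for every compact neighbourhood $U$ of the identity in $H$ one has $\int_H\sup_{y\in U}\Phi_\ell(hy)\,m(h)\,dh<\infty$. **Theorem.** Let $H$ be a generalized shearlet dilation group with $S$, $D$, $Y$, $n$ as above, where $Y$ is normalized to have first diagonal entry $y_1=1$. Then the dual action of $H$ has exactly one open orbit $\mathcal O$, and for every $\xi_0\in\mathcal O$ $$\|h^{\pm1}\|\,A_H(h)^{e_2}\preceq1,\qquad|\det(h^{\pm1})|\,A_H(h)^{e_3}\preceq1,\qquad\Delta_H(h^{\pm1})\,A_H(h)^{e_4}\preceq1\qquad(h\in H)$$ with $$e_2=n-1+2\|Y\|,\qquad e_3=|\mathrm{trace}(Y)|,\qquad e_4=|d-\mathrm{trace}(Y)| .$$ In particular, for every polynomially bounded weight $w_0$ on $H$, every $q\in[1,\infty)$ and every $s\ge0$, there are indices $\ell_1,\ell_2\in\mathbb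 N$ such that $\mathcal O$ is $(s,q,w_0)$-temperately embedded with index $\ell_1$ and strongly $(s,w_0)$-temperately embedded with index $\ell_2$. -/

import Mathlib

open MeasureTheory Topology
open scoped ENNReal NNReal Matrix

noncomputable section

namespace Shearlet

/-- `ℝ^d` with the Euclidean norm. -/
abbrev Eucl (d : ℕ) : Type := EuclideanSpace ℝ (Fin d)

/-- The operator norm of a matrix acting on `ℝ^d` with the Euclidean norm. -/
def opNorm {d : ℕ} (M : Matrix (Fin d) (Fin d) ℝ) : ℝ :=
  ‖Matrix.toEuclideanCLM (n := Fin d) (𝕜 := ℝ) M‖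

/-- The action of a matrix on `ℝ^d`. -/
def act {d : ℕ} (M : Matrix (Fin d) (Fin d) ℝ) (v : Eucl d) : Eucl d :=
  Matrix.toEuclideanCLM (n := Fin d) (𝕜 := ℝ) M v

/-- A dilation group: a closed subgroup of `GL(d, ℝ)`. -/
abbrev DilationGroup (d : ℕ) : Type := ClosedSubgroup (GL (Fin d) ℝ)

section Group

variable {d : ℕ}

instance instLocallyCompactGL : LocallyCompactSpace (GL (Fin d) ℝ) := by
  have : LocallyCompactSpace (Matrix (Fin d) (Fin d) ℝ) :=
    inferInstanceAs (LocallyCompactSpace (Fin d → Fin d → ℝ))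
  infer_instance

instance instLocallyCompactDilationGroup (H : DilationGroup d) : LocallyCompactSpace H :=
  H.isClosed'.isClosedEmbedding_subtypeVal.locallyCompactSpace

instance instIsTopologicalGroupDilationGroup (H : DilationGroup d) : IsTopologicalGroup H :=
  inferInstanceAs (IsTopologicalGroup H.toSubgroup)

instance instMeasurableSpaceDilationGroup (H : DilationGroup d) : MeasurableSpace H := borel H

instance instBorelSpaceDilationGroup (H : DilationGroup d) : BorelSpace H := ⟨rfl⟩

/-- The matrix of an element of a dilation group. -/
abbrev mat {H : DilationGroup d} (h : H) : Matrix (Fin d) (Fin d) ℝ :=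
  ((h : GL (Fin d) ℝ) : Matrix (Fin d) (Fin d) ℝ)

/-- Left Haar measure on `H`. -/
abbrev haarH (H : DilationGroup d) : Measure H := Measure.haar

/-- The modular function `Δ_H` of `H`, with `μ(E h) = Δ_H(h) μ(E)` for left Haar measure `μ`
(Mathlib's modular character is `h ↦ μ(E h⁻¹) / μ(E)`, its inverse). -/
def modular (H : DilationGroup d) (h : H) : ℝ :=
  ((Measure.modularCharacterFun h : ℝ≥0) : ℝ)⁻¹

end Group

section Admissible

variable {d : ℕ}

/-- The function `y ↦ |det h|^{-1/2} f(h⁻¹ (y - x))`. -/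
def quasiRegularFun (x : Eucl d) (h : GL (Fin d) ℝ) (f : Eucl d → ℂ) : Eucl d → ℂ :=
  fun y => (((|(h : Matrix (Fin d) (Fin d) ℝ).det| ^ (-(1 / 2) : ℝ) : ℝ)) : ℂ) *
    f (act ((h⁻¹ : GL (Fin d) ℝ) : Matrix (Fin d) (Fin d) ℝ) (y - x))

theorem memLp_quasiRegularFun (x : Eucl d) (h : GL (Fin d) ℝ) {f : Eucl d → ℂ}
    (hf : MemLp f 2 volume) : MemLp (quasiRegularFun x h f) 2 volume := by
  set M : Matrix (Fin d) (Fin d) ℝ := ((h⁻¹ : GL (Fin d) ℝ) : Matrix (Fin d) (Fin d) ℝ)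
  set L : Eucl d →L[ℝ] Eucl d := Matrix.toEuclideanCLM (n := Fin d) (𝕜 := ℝ) M with hL
  have hdet : LinearMap.det (L : Eucl d →ₗ[ℝ] Eucl d) ≠ 0 := by
    have hu : IsUnit L := (Units.isUnit h⁻¹).map (Matrix.toEuclideanCLM (n := Fin d) (𝕜 := ℝ))
    have hu' : IsUnit (L : Eucl d →ₗ[ℝ] Eucl d) := by
      obtain ⟨u, hu⟩ := hu
      refine ⟨⟨(u.1 : Eucl d →ₗ[ℝ] Eucl d), (u.2 : Eucl d →ₗ[ℝ] Eucl d), ?_, ?_⟩, by simp [hu]⟩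
      · ext1 v; exact congrArg (fun T : Eucl d →L[ℝ] Eucl d => T v) u.3
      · ext1 v; exact congrArg (fun T : Eucl d →L[ℝ] Eucl d => T v) u.4
    exact (hu'.map LinearMap.det).ne_zero
  have hmap := Measure.map_linearMap_addHaar_eq_smul_addHaar (μ := (volume : Measure (Eucl d))) hdet
  have h1 : MemLp (fun y => f (L y)) 2 (volume : Measure (Eucl d)) := by
    have h2 : MemLp f 2 (Measure.map (L : Eucl d → Eucl d) volume) := by
      have : Measure.map (L : Eucl d → Eucl d) volume = _ := hmap
      rw [this]
      exact hf.smul_measure ENNReal.ofReal_ne_top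
    exact h2.comp_of_map L.continuous.aemeasurable
  exact (h1.comp_measurePreserving (measurePreserving_sub_right volume x)).const_mul _

/-- The operator `π(x, h)` of the quasi-regular representation of `ℝ^d ⋊ H` on `L²(ℝ^d)`:
`(π(x, h) f)(y) = |det h|^{-1/2} f(h⁻¹ (y - x))`. -/
def quasiRegular (x : Eucl d) (h : GL (Fin d) ℝ) (f : Lp ℂ 2 (volume : Measure (Eucl d))) :
    Lp ℂ 2 (volume : Measure (Eucl d)) :=
  (memLp_quasiRegularFun x h (Lp.memLp f)).toLp _

/-- The quasi-regular representation of `ℝ^d ⋊ H` is irreducible: the only closed invariant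
subspaces of `L²(ℝ^d)` are the trivial ones. -/
def IsIrreducibleRep (H : DilationGroup d) : Prop :=
  ∀ V : Submodule ℂ (Lp ℂ 2 (volume : Measure (Eucl d))),
    IsClosed (V : Set (Lp ℂ 2 (volume : Measure (Eucl d)))) →
    (∀ (x : Eucl d) (h : H), ∀ f ∈ V, quasiRegular x (h : GL (Fin d) ℝ) f ∈ V) →
    V = ⊥ ∨ V = ⊤

/-- Some nonzero `ψ` has a matrix coefficient `(x, h) ↦ ⟨ψ, π(x, h) ψ⟩` that is square-integrable
for the left Haar measure `|det h|⁻¹ dx dh` of `ℝ^d ⋊ H`. -/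
def IsSquareIntegrableRep (H : DilationGroup d) : Prop :=
  ∃ ψ : Lp ℂ 2 (volume : Measure (Eucl d)), ψ ≠ 0 ∧
    ∫⁻ h : H, ∫⁻ x : Eucl d,
      ENNReal.ofReal (‖inner ℂ ψ (quasiRegular x (h : GL (Fin d) ℝ) ψ)‖ ^ 2 * |(mat h).det|⁻¹)
        ∂volume ∂(haarH H) < ∞

/-- `H` is irreducibly admissible: the quasi-regular representation is irreducible and
square-integrable. -/
def IsIrreduciblyAdmissible (H : DilationGroup d) : Prop :=
  IsIrreducibleRep H ∧ IsSquareIntegrableRep H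

end Admissible

section ShearletGroups

variable {d : ℕ}

/-- `T(d, ℝ)`: upper triangular matrices with ones on the diagonal. -/
def IsUnipotentUpper (M : Matrix (Fin d) (Fin d) ℝ) : Prop :=
  (∀ i, M i i = 1) ∧ ∀ i j, j < i → M i j = 0

/-- `H` is a generalized shearlet dilation group with shearing subgroup `S` and diagonal complement
`D = {exp(r Y) : r ∈ ℝ}`. -/
structure IsGeneralizedShearlet (H S D : DilationGroup d) (Y : Matrix (Fin d) (Fin d) ℝ) :
    Prop where
  admissible : IsIrreduciblyAdmissible H
  shear_le : S ≤ H
  diag_le : D ≤ H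
  shear_connected : IsConnected (S : Set (GL (Fin d) ℝ))
  shear_comm : ∀ a ∈ S, ∀ b ∈ S, a * b = b * a
  shear_unipotent : ∀ a ∈ S, IsUnipotentUpper (a : Matrix (Fin d) (Fin d) ℝ)
  generator_isDiag : Y.IsDiag
  mem_diag_iff : ∀ g : GL (Fin d) ℝ,
    g ∈ D ↔ ∃ r : ℝ, (g : Matrix (Fin d) (Fin d) ℝ) = NormedSpace.exp (r • Y)
  /-- Every `h ∈ H` can be written uniquely as `h = ± δ s` with `δ ∈ D` and `s ∈ S`. -/
  factor : ∀ h ∈ H, ∃! p : ℤˣ × D × S,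
    (h : Matrix (Fin d) (Fin d) ℝ) = ((p.1 : ℤ) : ℝ) • (mat p.2.1 * mat p.2.2)

/-- The Lie algebra of a closed matrix group: all `X` with `exp(ℝ X)` contained in the group. -/
def lieAlg (S : DilationGroup d) : Set (Matrix (Fin d) (Fin d) ℝ) :=
  {X | ∀ r : ℝ, ∃ g ∈ S, (g : Matrix (Fin d) (Fin d) ℝ) = NormedSpace.exp (r • X)}

/-- The nilpotency class of a nilpotent algebra `N` of matrices: the minimal `n` with `N ^ n = 0`,
where `N ^ n` is spanned by the products of `n` elements of `N`. -/
def nilpotencyClass (N : Set (Matrix (Fin d) (Fin d) ℝ)) : ℕ :=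
  sInf {n : ℕ | Submodule.span ℝ N ^ n = ⊥}

end ShearletGroups

section Orbit

variable {d : ℕ} (H : DilationGroup d)

/-- The orbit `{h^T ξ : h ∈ H}` of `ξ` under the dual action. -/
def dualOrbit (ξ : Eucl d) : Set (Eucl d) :=
  Set.range fun h : H => act (mat h)ᵀ ξ

/-- The open dual orbit `𝒪` of `H` (the union of all open dual orbits; for irreducibly admissible
`H` there is exactly one). -/
def openDualOrbit : Set (Eucl d) :=
  {ξ | IsOpen (dualOrbit H ξ)}

/-- The distance of `ξ` to the complement of the open dual orbit. -/
def distCompl (ξ : Eucl d) : ℝ := Metric.infDist ξ (openDualOrbit H)ᶜ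

/-- The auxiliary function
`A(ξ) = min (dist(ξ, 𝒪ᶜ) / (1 + √(|ξ|² - dist(ξ, 𝒪ᶜ)²))) (1 / (1 + |ξ|))`. -/
def auxA (ξ : Eucl d) : ℝ :=
  min (distCompl H ξ / (1 + Real.sqrt (‖ξ‖ ^ 2 - distCompl H ξ ^ 2))) (1 / (1 + ‖ξ‖))

/-- The pull-back `A_H(h) = A(h^T ξ₀)`. -/
def auxAH (ξ₀ : Eucl d) (h : H) : ℝ := auxA H (act (mat h)ᵀ ξ₀)

/-- `f ≼ 1` for a function `f` on `H`. -/
def BoundedByConst (f : H → ℝ) : Prop := ∃ C : ℝ, 0 < C ∧ ∀ h : H, f h ≤ C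

/-- `‖h^{±1}‖ A_H(h)^e ≼ 1`. -/
def NormEstimate (ξ₀ : Eucl d) (e : ℝ) : Prop :=
  BoundedByConst H (fun h => opNorm (mat h) * auxAH H ξ₀ h ^ e) ∧
  BoundedByConst H (fun h => opNorm (mat h⁻¹) * auxAH H ξ₀ h ^ e)

/-- `|det(h^{±1})| A_H(h)^e ≼ 1`. -/
def DetEstimate (ξ₀ : Eucl d) (e : ℝ) : Prop :=
  BoundedByConst H (fun h => |(mat h).det| * auxAH H ξ₀ h ^ e) ∧
  BoundedByConst H (fun h => |(mat h⁻¹).det| * auxAH H ξ₀ h ^ e)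

/-- `Δ_H(h^{±1}) A_H(h)^e ≼ 1`. -/
def ModularEstimate (ξ₀ : Eucl d) (e : ℝ) : Prop :=
  BoundedByConst H (fun h => modular H h * auxAH H ξ₀ h ^ e) ∧
  BoundedByConst H (fun h => modular H h⁻¹ * auxAH H ξ₀ h ^ e)

/-- A weight on `H`: a continuous, strictly positive, submultiplicative function. -/
structure IsWeight (w : H → ℝ) : Prop where
  continuous : Continuous w
  pos : ∀ h, 0 < w h
  submul : ∀ g h, w (g * h) ≤ w g * w h

/-- `w` is polynomially bounded: `w(h) ≼ (1 + ‖h‖)^k (1 + ‖h⁻¹‖)^k` for some `k`. -/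
def PolynomiallyBounded (w : H → ℝ) : Prop :=
  ∃ k : ℕ, ∃ C : ℝ, 0 < C ∧
    ∀ h : H, w h ≤ C * ((1 + opNorm (mat h)) ^ k * (1 + opNorm (mat h⁻¹)) ^ k)

/-- `𝒪` is `(s, q, w)`-temperately embedded with index `ℓ`. The condition does not depend on the
choice of `ξ₀ ∈ 𝒪`; it is required for every such choice. -/
def IsTemperatelyEmbedded (s q : ℝ) (w : H → ℝ) (ℓ : ℕ) : Prop :=
  ∀ ξ₀ ∈ openDualOrbit H,
    MemLp (fun h : H => |(mat h).det| ^ (1 / 2 - 1 / q) *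
        (1 + opNorm (mat h)) ^ (s + d + 1) * w h * auxA H (act (mat h)ᵀ ξ₀) ^ ℓ)
      (ENNReal.ofReal q) (haarH H) ∧
    MemLp (fun h : H => |(mat h).det| ^ (-(1 / 2) - 1 / q) *
        (1 + opNorm (mat h)) ^ (s + d + 1) * w h * auxA H (act (mat h⁻¹)ᵀ ξ₀) ^ ℓ)
      1 (haarH H)

/-- `Φ_ℓ(h) = ∫ A(ξ)^ℓ A(h^T ξ)^ℓ dξ`, with values in `[0, ∞]`; `A` lives on `𝒪`, which has full
measure. -/
def auxPhi (ℓ : ℕ) (h : H) : ℝ≥0∞ :=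
  ∫⁻ ξ in openDualOrbit H, ENNReal.ofReal (auxA H ξ ^ ℓ * auxA H (act (mat h)ᵀ ξ) ^ ℓ)

/-- Membership of a nonnegative function in the Wiener amalgam space `W(C⁰, L¹_m)` on `H`: `F` is
finite and continuous, and its local maximum function `x ↦ sup_{y ∈ U} F(x y)` is in `L¹_m`, for
every compact neighbourhood `U` of the identity. -/
def MemWienerAmalgam (m : H → ℝ) (F : H → ℝ≥0∞) : Prop :=
  (∀ h, F h ≠ ∞) ∧ Continuous F ∧
    ∀ U : Set H, IsCompact U → U ∈ 𝓝 (1 : H) →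
      ∫⁻ x : H, (⨆ y ∈ U, F (x * y)) * ENNReal.ofReal (m x) ∂(haarH H) < ∞

/-- `𝒪` is strongly `(s, w)`-temperately embedded with index `ℓ`. -/
def IsStronglyTemperatelyEmbedded (s : ℝ) (w : H → ℝ) (ℓ : ℕ) : Prop :=
  MemWienerAmalgam H
    (fun h => w h * |(mat h).det| ^ (-(1 / 2) : ℝ) * (1 + opNorm (mat h)) ^ (2 * (s + d + 1)))
    (auxPhi H ℓ)

end Orbit

end Shearlet

end

/-! Irreducibility forces the dual action to be ergodic for Lebesgue measure: if `U` is measurable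
and invariant under all `h^T`, the functions whose Fourier transform vanishes off `U` form a closed
invariant subspace, so `U` is null or conull (`IsIrreducibleRep.volume_eq_zero_or`). Three uses of
ergodicity determine the structure of `H`. The half-space `{ξ₀ > 0}` shows that `-1 ∈ H`. A linear
functional invariant under all `s^T` shows that the vectors `s^T ξ - ξ` span `{ξ₀ = 0}`. The
saturation under `S` of a small neighbourhood of `e₀` shows that `S` fills the whole of `1 + 𝔞`,
where `𝔞 = shearSpan S`.

The space `𝔞` is a commutative nilpotent algebra and coincides with the Lie algebra of `S`. By a
Nakayama-type induction `X ↦ X^T e₀` maps it onto `{ξ₀ = 0}`, and commutativity makes this map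
injective; `IsShearSection` records the linear inverse `Λ`. Consequently `h ↦ h^T e₀` is a
homeomorphism from `H` onto `{ξ₀ ≠ 0}`, which is the open orbit, and `dist(ξ, 𝒪ᶜ) = |ξ₀|`.

In these coordinates everything is explicit. For `h = ± exp(rY) s` put `t = s^T e₀ - e₀` and `a =
A(h^T e₀)`. Then `a ≤ exp(-|r|)` and `a (1 + |t|) ≤ 2`. The factor `exp(±rY)` has norm at most
`exp(|r| ‖Y‖)`, and `s`, `s⁻¹` are polynomials of degree at most `n - 1` in the nilpotent matrix `Λ
t`; this gives the norm estimate (`exists_norm_bound`). The determinant is a power of `|ξ₀|` by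
inspection. The measure `|ξ₀|^{-trace Y} dξ` pulls back to a right Haar measure, and its behaviour
under left translations gives `Δ_H = |ξ₀|^{trace Y - d}`.

For the embeddings let `size h = (1 + ‖h‖)(1 + ‖h⁻¹‖)`. It is submultiplicative, is bounded by a
power of `1/A`, and satisfies `1/A ≤ 2 size²`. Hence weights, determinants and norms grow at most
like powers of `size`, large negative powers of `size` are integrable, and a large power of `A`
beats any power of `size`. -/

noncomputable section

namespace Shearlet

/-! ### Matrices acting on `ℝ^d` and the change of variables formula. -/

section Action

variable {d : ℕ}

theorem act_mul (M N : Matrix (Fin d) (Fin d) ℝ) (v : Eucl d) :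
    act (M * N) v = act M (act N v) := by
  simp [act, map_mul]

@[simp] theorem act_one (v : Eucl d) : act (1 : Matrix (Fin d) (Fin d) ℝ) v = v := by
  simp [act]

theorem act_add (M : Matrix (Fin d) (Fin d) ℝ) (v w : Eucl d) :
    act M (v + w) = act M v + act M w := by
  simp [act]

theorem act_sub (M : Matrix (Fin d) (Fin d) ℝ) (v w : Eucl d) :
    act M (v - w) = act M v - act M w := by
  simp [act]

theorem act_smul (M : Matrix (Fin d) (Fin d) ℝ) (c : ℝ) (v : Eucl d) :
    act M (c • v) = c • act M v := by
  simp [act]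

theorem smul_act (M : Matrix (Fin d) (Fin d) ℝ) (c : ℝ) (v : Eucl d) :
    act (c • M) v = c • act M v := by
  simp [act]

theorem add_act (M N : Matrix (Fin d) (Fin d) ℝ) (v : Eucl d) :
    act (M + N) v = act M v + act N v := by
  simp [act]

theorem sub_act (M N : Matrix (Fin d) (Fin d) ℝ) (v : Eucl d) :
    act (M - N) v = act M v - act N v := by
  simp [act]

theorem act_apply (M : Matrix (Fin d) (Fin d) ℝ) (v : Eucl d) (i : Fin d) :
    act M v i = ∑ j, M i j * v j := by
  simp [act, Matrix.ofLp_toEuclideanCLM, Matrix.mulVec, dotProduct]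

theorem continuous_act (M : Matrix (Fin d) (Fin d) ℝ) : Continuous (act M) :=
  (Matrix.toEuclideanCLM (n := Fin d) (𝕜 := ℝ) M).continuous

theorem continuous_act_of_continuous {X : Type*} [TopologicalSpace X]
    {f : X → Matrix (Fin d) (Fin d) ℝ} {g : X → Eucl d} (hf : Continuous f) (hg : Continuous g) :
    Continuous fun x => act (f x) (g x) := by
  have h : Continuous fun x => f x *ᵥ (g x).ofLp :=
    hf.matrix_mulVec ((PiLp.continuous_ofLp 2 _).comp hg)
  exact (PiLp.continuous_toLp 2 _).comp h

theorem norm_act_le (M : Matrix (Fin d) (Fin d) ℝ) (v : Eucl d) :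
    ‖act M v‖ ≤ opNorm M * ‖v‖ :=
  (Matrix.toEuclideanCLM (n := Fin d) (𝕜 := ℝ) M).le_opNorm v

theorem inner_act (M : Matrix (Fin d) (Fin d) ℝ) (v w : Eucl d) :
    inner ℝ (act M v) w = inner ℝ v (act Mᵀ w) := by
  simp only [PiLp.inner_apply, act_apply, RCLike.inner_apply, conj_trivial, Finset.mul_sum,
    Finset.sum_mul, Matrix.transpose_apply]
  rw [Finset.sum_comm]
  exact Finset.sum_congr rfl fun i _ => Finset.sum_congr rfl fun j _ => by ring

/-- The linear automorphism of `ℝ^d` given by an invertible matrix. -/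
def actEquiv (g : GL (Fin d) ℝ) : Eucl d ≃L[ℝ] Eucl d :=
  ContinuousLinearEquiv.equivOfInverse
    (Matrix.toEuclideanCLM (n := Fin d) (𝕜 := ℝ) (g : Matrix (Fin d) (Fin d) ℝ))
    (Matrix.toEuclideanCLM (n := Fin d) (𝕜 := ℝ) ((g⁻¹ : GL (Fin d) ℝ) : Matrix (Fin d) (Fin d) ℝ))
    (fun v => by
      change act _ (act _ v) = v
      rw [← act_mul, ← Units.val_mul, inv_mul_cancel, Units.val_one, act_one])
    (fun v => by
      change act _ (act _ v) = v
      rw [← act_mul, ← Units.val_mul, mul_inv_cancel, Units.val_one, act_one])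

@[simp] theorem actEquiv_apply (g : GL (Fin d) ℝ) (v : Eucl d) :
    actEquiv g v = act (g : Matrix (Fin d) (Fin d) ℝ) v := rfl

theorem det_toEuclideanCLM (M : Matrix (Fin d) (Fin d) ℝ) :
    LinearMap.det ((Matrix.toEuclideanCLM (n := Fin d) (𝕜 := ℝ) M : Eucl d →L[ℝ] Eucl d) :
      Eucl d →ₗ[ℝ] Eucl d) = M.det := by
  rw [Matrix.coe_toEuclideanCLM_eq_toEuclideanLin, Matrix.toEuclideanLin_eq_toLin_orthonormal,
    LinearMap.det_toLin]

theorem map_act_volume {M : Matrix (Fin d) (Fin d) ℝ} (hM : M.det ≠ 0) :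
    Measure.map (act M) (volume : Measure (Eucl d)) = ENNReal.ofReal |M.det|⁻¹ • volume := by
  have h := Measure.map_linearMap_addHaar_eq_smul_addHaar (μ := (volume : Measure (Eucl d)))
    (f := ((Matrix.toEuclideanCLM (n := Fin d) (𝕜 := ℝ) M : Eucl d →L[ℝ] Eucl d) :
      Eucl d →ₗ[ℝ] Eucl d)) (by rwa [det_toEuclideanCLM])
  rw [det_toEuclideanCLM, abs_inv] at h
  exact h

theorem det_ne_zero (g : GL (Fin d) ℝ) : (g : Matrix (Fin d) (Fin d) ℝ).det ≠ 0 :=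
  ((Matrix.isUnit_iff_isUnit_det _).mp (Units.isUnit g)).ne_zero

theorem det_inv_eq (g : GL (Fin d) ℝ) :
    ((g⁻¹ : GL (Fin d) ℝ) : Matrix (Fin d) (Fin d) ℝ).det
      = ((g : Matrix (Fin d) (Fin d) ℝ).det)⁻¹ := by
  refine eq_inv_of_mul_eq_one_left ?_
  rw [← Matrix.det_mul, ← Units.val_mul, inv_mul_cancel, Units.val_one, Matrix.det_one]

/-- The transpose of an invertible matrix. -/
def transposeGL (g : GL (Fin d) ℝ) : GL (Fin d) ℝ where
  val := (g : Matrix (Fin d) (Fin d) ℝ)ᵀ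
  inv := ((g⁻¹ : GL (Fin d) ℝ) : Matrix (Fin d) (Fin d) ℝ)ᵀ
  val_inv := by
    rw [← Matrix.transpose_mul, ← Units.val_mul, inv_mul_cancel, Units.val_one,
      Matrix.transpose_one]
  inv_val := by
    rw [← Matrix.transpose_mul, ← Units.val_mul, mul_inv_cancel, Units.val_one,
      Matrix.transpose_one]

theorem lintegral_comp_act (g : GL (Fin d) ℝ) (f : Eucl d → ℝ≥0∞) (B : Set (Eucl d)) :
    ∫⁻ x in act (g : Matrix (Fin d) (Fin d) ℝ) ⁻¹' B, f (act (g : Matrix (Fin d) (Fin d) ℝ) x)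
      = ENNReal.ofReal |(g : Matrix (Fin d) (Fin d) ℝ).det|⁻¹ * ∫⁻ x in B, f x := by
  have he : MeasurableEmbedding (act (g : Matrix (Fin d) (Fin d) ℝ)) :=
    (actEquiv g).toHomeomorph.measurableEmbedding
  rw [← smul_eq_mul, ← lintegral_smul_measure, ← Measure.restrict_smul, ← map_act_volume (det_ne_zero g),
    he.restrict_map, he.lintegral_map]

end Action

/-! ### Ergodicity of the dual action, from irreducibility through the Fourier transform. -/

section Fourier

variable {d : ℕ}

open FourierTransform SchwartzMap

theorem quasiRegularFun_congr (x : Eucl d) (h : GL (Fin d) ℝ) {f g : Eucl d → ℂ}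
    (hfg : f =ᵐ[volume] g) : quasiRegularFun x h f =ᵐ[volume] quasiRegularFun x h g := by
  have h1 : Measure.QuasiMeasurePreserving
      (act ((h⁻¹ : GL (Fin d) ℝ) : Matrix (Fin d) (Fin d) ℝ)) volume volume := by
    refine ⟨(continuous_act _).measurable, ?_⟩
    rw [map_act_volume (det_ne_zero _)]
    exact Measure.smul_absolutelyContinuous
  have h2 : Measure.QuasiMeasurePreserving
      (fun y : Eucl d => act ((h⁻¹ : GL (Fin d) ℝ) : Matrix (Fin d) (Fin d) ℝ) (y - x))
      volume volume :=
    h1.comp (measurePreserving_sub_right volume x).quasiMeasurePreserving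
  filter_upwards [h2.ae_eq_comp hfg] with y hy
  simp only [quasiRegularFun]
  exact congrArg _ hy

theorem enorm_rpow_two_quasiRegularFun (x : Eucl d) (h : GL (Fin d) ℝ) (f : Eucl d → ℂ)
    (y : Eucl d) :
    ‖quasiRegularFun x h f y‖ₑ ^ (2 : ℝ) =
      ENNReal.ofReal |(h : Matrix (Fin d) (Fin d) ℝ).det|⁻¹ *
      ‖f (act ((h⁻¹ : GL (Fin d) ℝ) : Matrix (Fin d) (Fin d) ℝ) (y - x))‖ₑ ^ (2 : ℝ) := by
  have hpos : 0 < |(h : Matrix (Fin d) (Fin d) ℝ).det| := abs_pos.mpr (det_ne_zero h)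
  rw [quasiRegularFun, enorm_mul, ENNReal.mul_rpow_of_nonneg _ _ (by norm_num)]
  congr 1
  rw [← ofReal_norm, Complex.norm_real, Real.norm_of_nonneg (by positivity),
    ENNReal.ofReal_rpow_of_nonneg (by positivity) (by norm_num), ← Real.rpow_mul hpos.le]
  norm_num [Real.rpow_neg_one]

theorem eLpNorm_quasiRegularFun (x : Eucl d) (h : GL (Fin d) ℝ) (f : Eucl d → ℂ) :
    eLpNorm (quasiRegularFun x h f) 2 volume = eLpNorm f 2 volume := by
  rw [eLpNorm_eq_lintegral_rpow_enorm_toReal (by norm_num) (by norm_num),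
    eLpNorm_eq_lintegral_rpow_enorm_toReal (by norm_num) (by norm_num)]
  congr 1
  simp only [ENNReal.toReal_ofNat, enorm_rpow_two_quasiRegularFun]
  have hpos : 0 < |(h : Matrix (Fin d) (Fin d) ℝ).det| := abs_pos.mpr (det_ne_zero h)
  rw [lintegral_const_mul' _ _ ENNReal.ofReal_ne_top,
    lintegral_sub_right_eq_self (fun y => ‖f (act ((h⁻¹ : GL (Fin d) ℝ) :
      Matrix (Fin d) (Fin d) ℝ) y)‖ₑ ^ (2 : ℝ)) x]
  have h1 := lintegral_comp_act h⁻¹ (fun y => ‖f y‖ₑ ^ (2 : ℝ)) Set.univ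
  simp only [Set.preimage_univ, Measure.restrict_univ] at h1
  rw [h1, det_inv_eq, abs_inv, inv_inv, ← mul_assoc, ← ENNReal.ofReal_mul (by positivity),
    inv_mul_cancel₀ hpos.ne', ENNReal.ofReal_one, one_mul]

theorem continuous_quasiRegular (x : Eucl d) (h : GL (Fin d) ℝ) :
    Continuous (quasiRegular x h) := by
  refine Isometry.continuous (Isometry.of_dist_eq fun f g => ?_)
  rw [dist_eq_norm, dist_eq_norm, Lp.norm_def, Lp.norm_def]
  rw [← eLpNorm_quasiRegularFun x h (f - g : Lp ℂ 2 (volume : Measure (Eucl d)))]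
  congr 1
  refine eLpNorm_congr_ae ?_
  have h0 := quasiRegularFun_congr x h (Lp.coeFn_sub f g)
  have h1 := (memLp_quasiRegularFun x h (Lp.memLp f)).coeFn_toLp
  have h2 := (memLp_quasiRegularFun x h (Lp.memLp g)).coeFn_toLp
  filter_upwards [h0, h1, h2, Lp.coeFn_sub (quasiRegular x h f) (quasiRegular x h g)]
    with y e0 e1 e2 e3
  rw [e0, e3, Pi.sub_apply]
  simp only [quasiRegular]
  rw [e1, e2]
  simp [quasiRegularFun, mul_sub]

/-- The quasi-regular representation on Schwartz functions. -/
def quasiRegularSchwartz (x : Eucl d) (h : GL (Fin d) ℝ) (f : 𝓢(Eucl d, ℂ)) : 𝓢(Eucl d, ℂ) :=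
  (((|(h : Matrix (Fin d) (Fin d) ℝ).det| ^ (-(1 / 2) : ℝ) : ℝ)) : ℂ) •
    compSubConstCLM ℂ x (compCLMOfContinuousLinearEquiv ℂ (actEquiv h⁻¹) f)

theorem quasiRegularSchwartz_apply (x : Eucl d) (h : GL (Fin d) ℝ) (f : 𝓢(Eucl d, ℂ))
    (y : Eucl d) : quasiRegularSchwartz x h f y = quasiRegularFun x h f y := by
  simp [quasiRegularSchwartz, quasiRegularFun]

theorem quasiRegular_toLp (x : Eucl d) (h : GL (Fin d) ℝ) (f : 𝓢(Eucl d, ℂ)) :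
    quasiRegular x h (f.toLp 2) = (quasiRegularSchwartz x h f).toLp 2 := by
  apply Lp.ext
  filter_upwards [(quasiRegularSchwartz x h f).coeFn_toLp 2,
    (memLp_quasiRegularFun x h (Lp.memLp (f.toLp 2))).coeFn_toLp,
    quasiRegularFun_congr x h (f.coeFn_toLp 2)] with y h1 h2 h3
  rw [h1, quasiRegularSchwartz_apply, quasiRegular, h2, h3]

/-- Under the Fourier transform translation becomes a unimodular factor and dilation by `h` becomes
composition with `h^T`. Taking absolute values removes the phase, and the modulus is all that is
needed to detect where the transform vanishes. -/
theorem norm_fourier_quasiRegularSchwartz (x : Eucl d) (h : GL (Fin d) ℝ) (f : 𝓢(Eucl d, ℂ))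
    (w : Eucl d) :
    ‖𝓕 (quasiRegularSchwartz x h f) w‖ =
      |(h : Matrix (Fin d) (Fin d) ℝ).det| ^ (1 / 2 : ℝ) *
        ‖𝓕 f (act (h : Matrix (Fin d) (Fin d) ℝ)ᵀ w)‖ := by
  have hpos : 0 < |(h : Matrix (Fin d) (Fin d) ℝ).det| := abs_pos.mpr (det_ne_zero h)
  set G : Eucl d → ℂ := fun u =>
    Real.fourierChar (-inner ℝ u (act (h : Matrix (Fin d) (Fin d) ℝ)ᵀ w)) • f u with hG
  have hcov : ∫ u, G (act ((h⁻¹ : GL (Fin d) ℝ) : Matrix (Fin d) (Fin d) ℝ) u)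
      = |(h : Matrix (Fin d) (Fin d) ℝ).det| • ∫ u, G u := by
    have he : MeasurableEmbedding
        (act ((h⁻¹ : GL (Fin d) ℝ) : Matrix (Fin d) (Fin d) ℝ)) :=
      (actEquiv h⁻¹).toHomeomorph.measurableEmbedding
    rw [← he.integral_map, map_act_volume (det_ne_zero _), integral_smul_measure, det_inv_eq,
      abs_inv, inv_inv, ENNReal.toReal_ofReal hpos.le]
  have hF : 𝓕 (quasiRegularSchwartz x h f) w =
      Real.fourierChar (-inner ℝ x w) •
        ((|(h : Matrix (Fin d) (Fin d) ℝ).det| ^ (-(1 / 2) : ℝ) : ℝ) : ℂ) *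
          (|(h : Matrix (Fin d) (Fin d) ℝ).det| • 𝓕 f (act (h : Matrix (Fin d) (Fin d) ℝ)ᵀ w)) := by
    rw [fourier_coe, fourier_coe, Real.fourier_eq, Real.fourier_eq, ← hcov,
      ← integral_sub_right_eq_self (fun u => G (act _ u)) x, ← integral_const_mul]
    congr 1
    ext v
    rw [quasiRegularSchwartz_apply, quasiRegularFun, hG]
    simp only
    rw [← inner_act, ← act_mul, ← Units.val_mul, mul_inv_cancel, Units.val_one, act_one,
      inner_sub_left]
    simp only [Circle.smul_def, smul_eq_mul]
    have : Real.fourierChar (-inner ℝ v w)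
        = Real.fourierChar (-inner ℝ x w) * Real.fourierChar (-(inner ℝ v w - inner ℝ x w)) := by
      rw [← AddChar.map_add_eq_mul]; congr 1; ring
    rw [this]
    push_cast
    ring
  rw [hF, norm_mul, Circle.norm_smul, Complex.norm_real, norm_smul, Real.norm_of_nonneg hpos.le,
    Real.norm_of_nonneg (by positivity), ← mul_assoc]
  congr 1
  nth_rewrite 2 [← Real.rpow_one |(h : Matrix (Fin d) (Fin d) ℝ).det|]
  rw [← Real.rpow_add hpos]
  norm_num

theorem eLpNorm_restrict_fourier_quasiRegularSchwartz (x : Eucl d) (h : GL (Fin d) ℝ)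
    (f : 𝓢(Eucl d, ℂ)) {B : Set (Eucl d)}
    (hinv : act (h : Matrix (Fin d) (Fin d) ℝ)ᵀ ⁻¹' B = B) :
    eLpNorm (𝓕 (quasiRegularSchwartz x h f) : 𝓢(Eucl d, ℂ)) 2 (volume.restrict B)
      = eLpNorm (𝓕 f : 𝓢(Eucl d, ℂ)) 2 (volume.restrict B) := by
  have hpos : 0 < |(h : Matrix (Fin d) (Fin d) ℝ).det| := abs_pos.mpr (det_ne_zero h)
  rw [eLpNorm_eq_lintegral_rpow_enorm_toReal (by norm_num) (by norm_num),
    eLpNorm_eq_lintegral_rpow_enorm_toReal (by norm_num) (by norm_num)]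
  congr 1
  simp only [ENNReal.toReal_ofNat]
  have hpt : ∀ w, ‖𝓕 (quasiRegularSchwartz x h f) w‖ₑ ^ (2 : ℝ) =
      ENNReal.ofReal |(h : Matrix (Fin d) (Fin d) ℝ).det| *
        ‖𝓕 f (act (h : Matrix (Fin d) (Fin d) ℝ)ᵀ w)‖ₑ ^ (2 : ℝ) := by
    intro w
    rw [← ofReal_norm, norm_fourier_quasiRegularSchwartz,
      ENNReal.ofReal_mul (by positivity), ofReal_norm,
      ENNReal.mul_rpow_of_nonneg _ _ (by norm_num),
      ENNReal.ofReal_rpow_of_nonneg (by positivity) (by norm_num), ← Real.rpow_mul hpos.le]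
    norm_num
  simp only [hpt]
  rw [lintegral_const_mul' _ _ ENNReal.ofReal_ne_top]
  have h1 := lintegral_comp_act (transposeGL h) (fun y => ‖𝓕 f y‖ₑ ^ (2 : ℝ)) B
  have h2 : ((transposeGL h : GL (Fin d) ℝ) : Matrix (Fin d) (Fin d) ℝ)
      = (h : Matrix (Fin d) (Fin d) ℝ)ᵀ := rfl
  rw [h2, hinv, Matrix.det_transpose] at h1
  rw [h1, ← mul_assoc, ← ENNReal.ofReal_mul hpos.le, mul_inv_cancel₀ hpos.ne', ENNReal.ofReal_one,
    one_mul]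

/-- The Fourier transform on `L²` followed by restriction to `B`. -/
def fourierRestrict (B : Set (Eucl d)) :
    Lp ℂ 2 (volume : Measure (Eucl d)) →L[ℂ] Lp ℂ 2 ((volume : Measure (Eucl d)).restrict B) :=
  (LpToLpRestrictCLM (Eucl d) ℂ ℂ volume 2 B).comp
    ((Lp.fourierTransformₗᵢ (Eucl d) ℂ).toContinuousLinearEquiv : _ →L[ℂ] _)

theorem norm_fourierRestrict (B : Set (Eucl d)) (f : Lp ℂ 2 (volume : Measure (Eucl d))) :
    ‖fourierRestrict B f‖ = (eLpNorm (𝓕 f : Lp ℂ 2 (volume : Measure (Eucl d))) 2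
      (volume.restrict B)).toReal := by
  rw [Lp.norm_def]
  congr 1
  exact eLpNorm_congr_ae (LpToLpRestrictCLM_coeFn ℂ B _)

/-- Both sides are continuous in `f`, so it suffices to compare them on the dense subspace of
Schwartz functions, where the Fourier transform is an explicit integral. -/
theorem norm_fourierRestrict_quasiRegular (x : Eucl d) (h : GL (Fin d) ℝ) {B : Set (Eucl d)}
    (hinv : act (h : Matrix (Fin d) (Fin d) ℝ)ᵀ ⁻¹' B = B)
    (f : Lp ℂ 2 (volume : Measure (Eucl d))) :
    ‖fourierRestrict B (quasiRegular x h f)‖ = ‖fourierRestrict B f‖ := by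
  refine congrFun (DenseRange.equalizer (denseRange_toLpCLM (E := Eucl d) (F := ℂ) 
    (p := 2) (μ := volume) (by norm_num)) (g := fun f => ‖fourierRestrict B (quasiRegular x h f)‖)
    (h := fun f => ‖fourierRestrict B f‖) ?_ ?_ ?_) f
  · exact ((fourierRestrict B).continuous.comp (continuous_quasiRegular x h)).norm
  · exact (fourierRestrict B).continuous.norm
  · ext φ
    simp only [Function.comp_apply, toLpCLM_apply, norm_fourierRestrict, quasiRegular_toLp,
      toLp_fourier_eq]
    congr 1
    rw [eLpNorm_congr_ae (ae_restrict_of_ae (coeFn_toLp (𝓕 φ) 2 volume)),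
      eLpNorm_congr_ae (ae_restrict_of_ae (coeFn_toLp (𝓕 (quasiRegularSchwartz x h φ)) 2 volume)),
      eLpNorm_restrict_fourier_quasiRegularSchwartz x h φ hinv]

theorem fourierRestrict_eq_zero_iff (B : Set (Eucl d))
    (f : Lp ℂ 2 (volume : Measure (Eucl d))) :
    fourierRestrict B f = 0 ↔
      ((𝓕 f : Lp ℂ 2 (volume : Measure (Eucl d))) : Eucl d → ℂ) =ᵐ[volume.restrict B] 0 := by
  have h : (fourierRestrict B f : Eucl d → ℂ) =ᵐ[volume.restrict B]
    (𝓕 f : Lp ℂ 2 (volume : Measure (Eucl d))) := LpToLpRestrictCLM_coeFn ℂ B _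
  rw [Lp.eq_zero_iff_ae_eq_zero]
  exact ⟨fun h' => h.symm.trans h', fun h' => h.trans h'⟩

/-- A set of positive measure carries the Fourier transform of a nonzero `L²` function. -/
theorem exists_fourier_supported {U : Set (Eucl d)} (hU : MeasurableSet U) (hpos : volume U ≠ 0) :
    ∃ f : Lp ℂ 2 (volume : Measure (Eucl d)), f ≠ 0 ∧ fourierRestrict Uᶜ f = 0 ∧
      fourierRestrict U f ≠ 0 := by
  -- Cutting `U` down to a ball of positive measure keeps the indicator function in `L²`.
  obtain ⟨n, hn⟩ : ∃ n : ℕ, volume (U ∩ Metric.ball 0 n) ≠ 0 := by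
    by_contra! hcon
    apply hpos
    have : U = ⋃ n : ℕ, U ∩ Metric.ball 0 n := by
      rw [← Set.inter_iUnion, Metric.iUnion_ball_nat, Set.inter_univ]
    rw [this]
    exact measure_iUnion_null hcon
  have hm : MeasurableSet (U ∩ Metric.ball (0 : Eucl d) n) := hU.inter measurableSet_ball
  have hfin : volume (U ∩ Metric.ball (0 : Eucl d) n) ≠ ∞ :=
    ((measure_mono Set.inter_subset_right).trans_lt measure_ball_lt_top).ne
  set g : Lp ℂ 2 (volume : Measure (Eucl d)) := indicatorConstLp 2 hm hfin (1 : ℂ) with hg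
  have hgae : ∀ s : Set (Eucl d), (g : Eucl d → ℂ) =ᵐ[volume.restrict s]
      (U ∩ Metric.ball (0 : Eucl d) n).indicator fun _ => 1 :=
    fun s => ae_restrict_of_ae indicatorConstLp_coeFn
  have hF : (𝓕 (𝓕⁻ g) : Lp ℂ 2 (volume : Measure (Eucl d))) = g := fourier_fourierInv_eq g
  have hne : fourierRestrict U (𝓕⁻ g) ≠ 0 := by
    rw [Ne, fourierRestrict_eq_zero_iff, hF]
    intro h0
    apply hn
    have h1 := (hgae U).symm.trans h0
    rw [Filter.EventuallyEq, ae_restrict_iff' hU] at h1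
    refine measure_mono_null ?_ (ae_iff.mp h1)
    intro y hy
    rw [Set.mem_ofPred_eq, Set.indicator_of_mem hy]
    simp [hy.1]
  refine ⟨𝓕⁻ g, ?_, ?_, hne⟩
  · rintro h0
    rw [h0, map_zero] at hne
    exact hne rfl
  · rw [fourierRestrict_eq_zero_iff, hF]
    refine (hgae Uᶜ).trans ?_
    rw [Filter.EventuallyEq, ae_restrict_iff' hU.compl]
    refine Filter.Eventually.of_forall fun y hy => ?_
    rw [Set.indicator_of_notMem (fun h => hy h.1)]
    rfl

/-- If `U` and its complement both had positive measure, the functions with Fourier transform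
supported in `U` would form a proper nonzero closed invariant subspace. -/
theorem IsIrreducibleRep.volume_eq_zero_or {H : DilationGroup d} (hH : IsIrreducibleRep H)
    {U : Set (Eucl d)} (hU : MeasurableSet U)
    (hinv : ∀ h ∈ H, ∀ ξ ∈ U, act (h : Matrix (Fin d) (Fin d) ℝ)ᵀ ξ ∈ U) :
    volume U = 0 ∨ volume Uᶜ = 0 := by
  have hpre : ∀ h : H, act (mat h)ᵀ ⁻¹' Uᶜ = Uᶜ := by
    intro h
    ext ξ
    refine ⟨fun hξ hU' => hξ (hinv h h.2 ξ hU'), fun hξ hU' => hξ ?_⟩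
    have := hinv _ (H.toSubgroup.inv_mem h.2) _ hU'
    rwa [← act_mul, ← Matrix.transpose_mul, ← Units.val_mul, mul_inv_cancel, Units.val_one,
      Matrix.transpose_one, act_one] at this
  by_contra! hcon
  obtain ⟨f, hf0, hfU, -⟩ := exists_fourier_supported hU hcon.1
  obtain ⟨g, -, -, hg⟩ := exists_fourier_supported hU.compl hcon.2
  have hV := hH (fourierRestrict Uᶜ).ker ((fourierRestrict Uᶜ).isClosed_ker) fun x h f hf => by
    have h1 := norm_fourierRestrict_quasiRegular x (h : GL (Fin d) ℝ) (hpre h) f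
    have hf' : fourierRestrict Uᶜ f = 0 := hf
    rw [hf', norm_zero, norm_eq_zero] at h1
    exact h1
  rcases hV with h | h
  · have : f ∈ (⊥ : Submodule ℂ (Lp ℂ 2 (volume : Measure (Eucl d)))) := h ▸ hfU
    exact hf0 (by simpa using this)
  · have : g ∈ (fourierRestrict Uᶜ).ker := h ▸ Submodule.mem_top
    exact hg this

end Fourier

end Shearlet

end
noncomputable section

namespace Shearlet

/-! ### The factorization `h = ± δ s`, normalization to `{ξ₀ = 1}`, and `-1 ∈ H`. -/

section Structure

variable {d : ℕ}

/-- The matrix `exp(r Y)` for a diagonal matrix `Y`. -/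
def dil (Y : Matrix (Fin d) (Fin d) ℝ) (r : ℝ) : Matrix (Fin d) (Fin d) ℝ :=
  Matrix.diagonal fun i => Real.exp (r * Y i i)

theorem exp_smul_eq_dil {Y : Matrix (Fin d) (Fin d) ℝ} (hY : Y.IsDiag) (r : ℝ) :
    NormedSpace.exp (r • Y) = dil Y r := by
  conv_lhs => rw [← hY.diagonal_diag, ← Matrix.diagonal_smul, Matrix.exp_diagonal]
  rw [dil]
  congr 1
  ext i
  rw [Pi.coe_exp]
  simp [Real.exp_eq_exp_ℝ]

theorem dil_add (Y : Matrix (Fin d) (Fin d) ℝ) (r t : ℝ) : dil Y (r + t) = dil Y r * dil Y t := by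
  simp [dil, Matrix.diagonal_mul_diagonal, add_mul, Real.exp_add]

@[simp] theorem dil_zero (Y : Matrix (Fin d) (Fin d) ℝ) : dil Y 0 = 1 := by
  simp [dil]

@[simp] theorem transpose_dil (Y : Matrix (Fin d) (Fin d) ℝ) (r : ℝ) : (dil Y r)ᵀ = dil Y r := by
  simp [dil]

theorem act_dil_apply (Y : Matrix (Fin d) (Fin d) ℝ) (r : ℝ) (ξ : Eucl d) (i : Fin d) :
    act (dil Y r) ξ i = Real.exp (r * Y i i) * ξ i := by
  simp [act_apply, dil, Matrix.diagonal_apply]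

theorem det_dil (Y : Matrix (Fin d) (Fin d) ℝ) (r : ℝ) :
    (dil Y r).det = Real.exp (r * Y.trace) := by
  rw [dil, Matrix.det_diagonal, ← Real.exp_sum, ← Finset.mul_sum]
  rfl

/-- `exp(r Y)` as an invertible matrix. -/
def dilGL (Y : Matrix (Fin d) (Fin d) ℝ) (r : ℝ) : GL (Fin d) ℝ where
  val := dil Y r
  inv := dil Y (-r)
  val_inv := by rw [← dil_add, add_neg_cancel, dil_zero]
  inv_val := by rw [← dil_add, neg_add_cancel, dil_zero]

theorem IsUnipotentUpper.det_eq_one {M : Matrix (Fin d) (Fin d) ℝ} (hM : IsUnipotentUpper M) :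
    M.det = 1 := by
  rw [Matrix.det_of_isUpperTriangular fun i j hij => hM.2 i j hij]
  simp [hM.1]

theorem continuous_coord (i : Fin d) : Continuous fun ξ : Eucl d => ξ i :=
  (continuous_apply i).comp (PiLp.continuous_ofLp 2 _)

variable {H S D : DilationGroup d} {Y : Matrix (Fin d) (Fin d) ℝ}

theorem IsGeneralizedShearlet.dilGL_mem (hH : IsGeneralizedShearlet H S D Y) (r : ℝ) :
    dilGL Y r ∈ H :=
  hH.diag_le ((hH.mem_diag_iff _).mpr ⟨r, (exp_smul_eq_dil hH.generator_isDiag r).symm⟩)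

theorem IsGeneralizedShearlet.exists_factor (hH : IsGeneralizedShearlet H S D Y)
    {h : GL (Fin d) ℝ} (hh : h ∈ H) :
    ∃ ε : ℝ, (ε = 1 ∨ ε = -1) ∧ ∃ r : ℝ, ∃ s ∈ S,
      (h : Matrix (Fin d) (Fin d) ℝ) = ε • (dil Y r * (s : Matrix (Fin d) (Fin d) ℝ)) := by
  obtain ⟨⟨u, δ, s⟩, hp, -⟩ := hH.factor h hh
  obtain ⟨r, hr⟩ := (hH.mem_diag_iff δ).mp δ.2
  refine ⟨((u : ℤ) : ℝ), ?_, r, s, s.2, ?_⟩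
  · rcases Int.units_eq_one_or u with rfl | rfl <;> simp
  · rw [hp, ← exp_smul_eq_dil hH.generator_isDiag, ← hr]

variable [NeZero d]

/-- The first standard basis vector. -/
def e₀ : Eucl d := EuclideanSpace.single 0 1

@[simp] theorem e₀_apply_zero : (e₀ : Eucl d) 0 = 1 := by simp [e₀]

theorem e₀_apply_ne {i : Fin d} (hi : i ≠ 0) : (e₀ : Eucl d) i = 0 := by simp [e₀, hi]

theorem act_transpose_e₀ (M : Matrix (Fin d) (Fin d) ℝ) (i : Fin d) :
    act Mᵀ e₀ i = M 0 i := by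
  rw [act_apply, Finset.sum_eq_single 0] <;> simp +contextual [e₀_apply_ne]

theorem IsUnipotentUpper.act_transpose_zero {M : Matrix (Fin d) (Fin d) ℝ}
    (hM : IsUnipotentUpper M) (ξ : Eucl d) : act Mᵀ ξ 0 = ξ 0 := by
  rw [act_apply, Finset.sum_eq_single 0]
  · simp [hM.1]
  · intro j _ hj
    rw [Matrix.transpose_apply, hM.2 j 0 (Fin.pos_iff_ne_zero.mpr hj), zero_mul]
  · simp

/-- The upper left entry of `± exp(rY) s` is `± exp r`, because `y₁ = 1`; so this entry alone
determines the sign and `r`. -/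
theorem IsGeneralizedShearlet.mem_shear_of_unipotent (hH : IsGeneralizedShearlet H S D Y)
    (hY : Y 0 0 = 1) {h : GL (Fin d) ℝ} (hh : h ∈ H)
    (h1 : (h : Matrix (Fin d) (Fin d) ℝ) 0 0 = 1) : h ∈ S := by
  obtain ⟨ε, hε, r, s, hs, heq⟩ := hH.exists_factor hh
  have h00 : (1 : ℝ) = ε * Real.exp r := by
    rw [← h1, heq]
    simp [dil, (hH.shear_unipotent s hs).1, hY]
  have hε1 : ε = 1 := by
    rcases hε with h | h
    · exact h
    · rw [h] at h00
      linarith [Real.exp_pos r]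
  have hr : r = 0 := by
    rw [hε1, one_mul] at h00
    exact Real.exp_eq_one_iff r |>.mp h00.symm
  rw [hε1, hr, dil_zero, one_mul, one_smul] at heq
  rwa [Units.ext heq]

/-- `D` normalizes `S`: conjugation by a diagonal matrix leaves the upper left entry equal to one.
-/
theorem IsGeneralizedShearlet.conj_mem (hH : IsGeneralizedShearlet H S D Y)
    (hY : Y 0 0 = 1) {s : GL (Fin d) ℝ} (hs : s ∈ S) (r : ℝ) :
    dilGL Y r * s * dilGL Y (-r) ∈ S := by
  refine hH.mem_shear_of_unipotent hY (H.mul_mem (H.mul_mem (hH.dilGL_mem r) (hH.shear_le hs))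
    (hH.dilGL_mem (-r))) ?_
  change (dil Y r * (s : Matrix (Fin d) (Fin d) ℝ) * dil Y (-r)) 0 0 = 1
  rw [dil, dil, Matrix.mul_diagonal, Matrix.diagonal_mul, (hH.shear_unipotent s hs).1, mul_one,
    ← Real.exp_add]
  simp

/-- The point of the hyperplane `{ξ₀ = 1}` to which `± exp(r Y)` moves `ξ`. -/
def normalize (Y : Matrix (Fin d) (Fin d) ℝ) (ξ : Eucl d) : Eucl d :=
  (ξ 0 / |ξ 0|) • act (dil Y (-Real.log (ξ 0))) ξ

theorem normalize_apply (Y : Matrix (Fin d) (Fin d) ℝ) (ξ : Eucl d) (i : Fin d) :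
    normalize Y ξ i = (ξ 0 / |ξ 0|) * (Real.exp (-Real.log (ξ 0) * Y i i) * ξ i) := by
  simp [normalize, act_dil_apply]

theorem normalize_of_eq_one (Y : Matrix (Fin d) (Fin d) ℝ) {ξ : Eucl d} (hξ : ξ 0 = 1) :
    normalize Y ξ = ξ := by
  simp [normalize, hξ]

theorem measurable_normalize (Y : Matrix (Fin d) (Fin d) ℝ) : Measurable (normalize Y) := by
  have hc : ∀ i : Fin d, Measurable fun ξ : Eucl d => ξ i := fun i => (continuous_coord i).measurable
  have : Measurable fun (ξ : Eucl d) (i : Fin d) =>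
      (ξ 0 / |ξ 0|) * (Real.exp (-Real.log (ξ 0) * Y i i) * ξ i) := by
    refine measurable_pi_lambda _ fun i => ?_
    exact ((hc 0).div (hc 0).abs).mul
      ((Real.measurable_exp.comp ((hc 0).log.neg.mul_const _)).mul (hc i))
  have h2 : normalize Y = WithLp.toLp 2 ∘ fun (ξ : Eucl d) (i : Fin d) =>
      (ξ 0 / |ξ 0|) * (Real.exp (-Real.log (ξ 0) * Y i i) * ξ i) := by
    ext ξ i
    simp [normalize_apply]
  exact h2 ▸ (WithLp.measurable_toLp 2 _).comp this

theorem continuousAt_normalize (Y : Matrix (Fin d) (Fin d) ℝ) {ξ : Eucl d} (hξ : ξ 0 ≠ 0) :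
    ContinuousAt (normalize Y) ξ := by
  have hc : ∀ i : Fin d, ContinuousAt (fun ξ : Eucl d => ξ i) ξ :=
    fun i => (continuous_coord i).continuousAt
  have h1 : ContinuousAt (fun (ξ : Eucl d) (i : Fin d) =>
      (ξ 0 / |ξ 0|) * (Real.exp (-Real.log (ξ 0) * Y i i) * ξ i)) ξ := by
    refine continuousAt_pi.mpr fun i => ?_
    exact ((hc 0).div (hc 0).abs (abs_ne_zero.mpr hξ)).mul
      ((Real.continuous_exp.continuousAt.comp (((hc 0).log hξ).neg.mul_const _)).mul (hc i))
  have h2 := (PiLp.continuous_toLp 2 _).continuousAt.comp h1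
  refine h2.congr (Filter.Eventually.of_forall fun η => ?_)
  ext i
  simp [normalize_apply]

/-- Modulo `± D` the action of `H` on `{ξ₀ ≠ 0}` becomes the action of `S` on `{ξ₀ = 1}`. This
reduces `H`-invariant sets to `S`-invariant sets on the hyperplane. -/
theorem IsGeneralizedShearlet.normalize_act (hH : IsGeneralizedShearlet H S D Y)
    (hY : Y 0 0 = 1) {h : GL (Fin d) ℝ} (hh : h ∈ H) {ξ : Eucl d} (hξ : ξ 0 ≠ 0) :
    act (h : Matrix (Fin d) (Fin d) ℝ)ᵀ ξ 0 ≠ 0 ∧ ∃ s ∈ S,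
      normalize Y (act (h : Matrix (Fin d) (Fin d) ℝ)ᵀ ξ) =
        act (s : Matrix (Fin d) (Fin d) ℝ)ᵀ (normalize Y ξ) := by
  obtain ⟨ε, hε, r, s, hs, heq⟩ := hH.exists_factor hh
  have hε0 : ε ≠ 0 := by rcases hε with h | h <;> simp [h]
  have hεa : |ε| = 1 := by rcases hε with h | h <;> simp [h]
  have hεε : ε * ε = 1 := by rcases hε with h | h <;> simp [h]
  have hact : act (h : Matrix (Fin d) (Fin d) ℝ)ᵀ ξ
      = ε • act (s : Matrix (Fin d) (Fin d) ℝ)ᵀ (act (dil Y r) ξ) := by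
    rw [heq, Matrix.transpose_smul, smul_act, Matrix.transpose_mul, transpose_dil, act_mul]
  have h0 : act (h : Matrix (Fin d) (Fin d) ℝ)ᵀ ξ 0 = ε * (Real.exp r * ξ 0) := by
    rw [hact, PiLp.smul_apply, (hH.shear_unipotent s hs).act_transpose_zero, act_dil_apply, hY,
      mul_one, smul_eq_mul]
  have hne : ε * (Real.exp r * ξ 0) ≠ 0 := by positivity
  -- With `ρ = r + log |ξ₀|`, the identity `exp(-ρY) s^T exp(rY) = (exp(ρY) s exp(-ρY))^T exp(-log
  -- |ξ₀| Y)` produces the conjugated shear.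
  refine ⟨h0 ▸ hne, _, hH.conj_mem hY hs (r + Real.log (ξ 0)), ?_⟩
  -- `Real.log` depends only on the absolute value of its argument, so the sign `ε` drops out.
  have hlog : Real.log (ε * (Real.exp r * ξ 0)) = r + Real.log (ξ 0) := by
    rw [Real.log_mul hε0 (by positivity), Real.log_mul (by positivity) hξ, Real.log_exp,
      ← Real.log_abs, hεa, Real.log_one, zero_add]
  have hsgn : ε * (Real.exp r * ξ 0) / |ε * (Real.exp r * ξ 0)| = ε * (ξ 0 / |ξ 0|) := by
    rw [abs_mul, abs_mul, hεa, abs_of_pos (Real.exp_pos r), one_mul, mul_div_assoc,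
      mul_div_mul_left _ _ (Real.exp_pos r).ne']
  rw [normalize, normalize, h0, hlog, hsgn, hact]
  change _ = act (dil Y (r + Real.log (ξ 0)) * (s : Matrix (Fin d) (Fin d) ℝ) *
    dil Y (-(r + Real.log (ξ 0))))ᵀ _
  rw [Matrix.transpose_mul, Matrix.transpose_mul, transpose_dil, transpose_dil, act_smul, act_smul,
    act_mul, act_mul, ← act_mul (dil Y (r + _)), ← dil_add, smul_smul,
    show ε * (ξ 0 / |ξ 0|) * ε = ξ 0 / |ξ 0| by rw [mul_right_comm, hεε, one_mul],
    show r + Real.log (ξ 0) + -Real.log (ξ 0) = r by ring]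

/-- A shear-invariant subset of the hyperplane `{ξ₀ = 1}` and its complement cannot both have
interior points. -/
theorem IsGeneralizedShearlet.not_invariant_splitting (hH : IsGeneralizedShearlet H S D Y)
    (hY : Y 0 0 = 1) {E : Set (Eucl d)} (hE : MeasurableSet E)
    (hinv : ∀ s ∈ S, ∀ ξ ∈ E, act (s : Matrix (Fin d) (Fin d) ℝ)ᵀ ξ ∈ E)
    {η η' : Eucl d} (hη : η 0 = 1) (hη' : η' 0 = 1) (h1 : E ∈ 𝓝 η) (h2 : Eᶜ ∈ 𝓝 η') : False := by
  -- The union of the orbits under `± D` of the points of `E` on the hyperplane; it is invariant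
  -- under all of `H`.
  set U : Set (Eucl d) := {ξ | ξ 0 ≠ 0} ∩ normalize Y ⁻¹' E with hU
  have hUm : MeasurableSet U :=
    ((isOpen_ne (x := (0 : ℝ))).preimage (continuous_coord 0)).measurableSet.inter
      (measurable_normalize Y hE)
  have hn : ∀ {ξ : Eucl d} {B : Set (Eucl d)}, ξ 0 = 1 → B ∈ 𝓝 ξ → normalize Y ⁻¹' B ∈ 𝓝 ξ := by
    intro ξ B hξ hB
    have := continuousAt_normalize Y (ξ := ξ) (by simp [hξ])
    rw [ContinuousAt, normalize_of_eq_one Y hξ] at this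
    exact this hB
  have hUinv : ∀ h ∈ H, ∀ ξ ∈ U, act (h : Matrix (Fin d) (Fin d) ℝ)ᵀ ξ ∈ U := by
    rintro h hh ξ ⟨hξ, hξE⟩
    obtain ⟨h0, s, hs, heq⟩ := hH.normalize_act hY hh hξ
    refine ⟨h0, ?_⟩
    rw [Set.mem_preimage, heq]
    exact hinv s hs _ hξE
  rcases hH.admissible.1.volume_eq_zero_or hUm hUinv with h | h
  · refine (Measure.measure_pos_of_mem_nhds volume (x := η) (s := U) ?_).ne' h
    refine Filter.inter_mem ?_ (hn hη h1)
    exact (continuous_coord 0).continuousAt.eventually_ne (by simp [hη])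
  · refine (Measure.measure_pos_of_mem_nhds volume (x := η') (s := Uᶜ) ?_).ne' h
    exact Filter.mem_of_superset (hn hη' h2) fun ξ hξ hξU => hξ hξU.2

/-- If no element of `H` carried the minus sign, the half-space `{ξ₀ > 0}` would be invariant,
although neither it nor its complement is null. -/
theorem IsGeneralizedShearlet.neg_one_mem (hH : IsGeneralizedShearlet H S D Y) : (-1 : GL (Fin d) ℝ) ∈ H := by
  by_contra hcon
  have hc : Continuous fun ξ : Eucl d => ξ 0 := continuous_coord 0
  have hmeas : MeasurableSet {ξ : Eucl d | 0 < ξ 0} := (isOpen_lt continuous_const hc).measurableSet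
  have hinv : ∀ h ∈ H, ∀ ξ ∈ {ξ : Eucl d | 0 < ξ 0},
      act (h : Matrix (Fin d) (Fin d) ℝ)ᵀ ξ ∈ {ξ : Eucl d | 0 < ξ 0} := by
    intro h hh ξ hξ
    obtain ⟨ε, hε, r, s, hs, heq⟩ := hH.exists_factor hh
    rcases hε with rfl | rfl
    · rw [Set.mem_ofPred_eq, heq, one_smul, Matrix.transpose_mul, transpose_dil, act_mul,
        (hH.shear_unipotent s hs).act_transpose_zero, act_dil_apply]
      exact mul_pos (Real.exp_pos _) hξ
    · exfalso
      apply hcon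
      have h1 : h = -1 * (dilGL Y r * s) := by
        apply Units.ext
        rw [heq]
        simp [dilGL]
      have h2 : (-1 : GL (Fin d) ℝ) = h * (dilGL Y r * s)⁻¹ := by rw [h1, mul_inv_cancel_right]
      rw [h2]
      exact H.mul_mem hh (H.inv_mem (H.mul_mem (hH.dilGL_mem r) (hH.shear_le hs)))
  rcases hH.admissible.1.volume_eq_zero_or hmeas hinv with h | h
  · refine (Measure.measure_pos_of_mem_nhds volume (x := (e₀ : Eucl d)) ?_).ne' h
    exact hc.continuousAt.eventually (lt_mem_nhds (by simp))
  · refine (Measure.measure_pos_of_mem_nhds volume (x := -(e₀ : Eucl d)) ?_).ne' h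
    have : {ξ : Eucl d | ξ 0 < 0} ∈ 𝓝 (-(e₀ : Eucl d)) :=
      hc.continuousAt.eventually (gt_mem_nhds (by simp))
    exact Filter.mem_of_superset this fun ξ hξ hξ' => lt_asymm (a := ξ 0) hξ hξ'

end Structure

end Shearlet

end
noncomputable section

namespace Shearlet

/-! ### The algebra spanned by `S - 1`, and the identification of `S` with `{ξ₀ = 1}`. -/

section ShearAlgebra

variable {d : ℕ}

/-- Matrices whose entries `(i, j)` vanish for `j < i + k`. -/
def strictUpper (d k : ℕ) : Submodule ℝ (Matrix (Fin d) (Fin d) ℝ) where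
  carrier := {M | ∀ i j : Fin d, (j : ℕ) < i + k → M i j = 0}
  add_mem' := fun ha hb i j hij => by simp [ha i j hij, hb i j hij]
  zero_mem' := fun i j _ => rfl
  smul_mem' := fun c M hM i j hij => by simp [hM i j hij]

theorem mul_mem_strictUpper {k l : ℕ} {M N : Matrix (Fin d) (Fin d) ℝ}
    (hM : M ∈ strictUpper d k) (hN : N ∈ strictUpper d l) : M * N ∈ strictUpper d (k + l) := by
  intro i j hij
  rw [Matrix.mul_apply]
  refine Finset.sum_eq_zero fun x _ => ?_
  by_cases hx : (x : ℕ) < i + k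
  · rw [hM i x hx, zero_mul]
  · rw [hN x j (by omega), mul_zero]

theorem strictUpper_eq_bot : strictUpper d d = ⊥ := by
  rw [eq_bot_iff]
  intro M hM
  ext i j
  exact hM i j (by omega)

theorem pow_le_strictUpper {N : Submodule ℝ (Matrix (Fin d) (Fin d) ℝ)} (hN : N ≤ strictUpper d 1)
    (k : ℕ) : N ^ k ≤ strictUpper d k := by
  induction k with
  | zero =>
    rw [pow_zero, Submodule.one_le]
    intro i j hij
    exact Matrix.one_apply_ne (by rintro rfl; omega)
  | succ k ih =>
    rw [pow_succ, Submodule.mul_le]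
    exact fun m hm n hn => mul_mem_strictUpper (ih hm) (hN hn)

/-- The span of the matrices `s - 1`, `s ∈ S`. -/
def shearSpan (S : DilationGroup d) : Submodule ℝ (Matrix (Fin d) (Fin d) ℝ) :=
  Submodule.span ℝ {X | ∃ s ∈ S, X = (s : Matrix (Fin d) (Fin d) ℝ) - 1}

variable {H S D : DilationGroup d} {Y : Matrix (Fin d) (Fin d) ℝ}

theorem sub_one_mem_shearSpan {s : GL (Fin d) ℝ} (hs : s ∈ S) :
    (s : Matrix (Fin d) (Fin d) ℝ) - 1 ∈ shearSpan S :=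
  Submodule.subset_span ⟨s, hs, rfl⟩

/-- On generators `(s - 1)(t - 1) = (st - 1) - (s - 1) - (t - 1)`, so the span is an algebra. -/
theorem mul_mem_shearSpan {X Z : Matrix (Fin d) (Fin d) ℝ} (hX : X ∈ shearSpan S)
    (hZ : Z ∈ shearSpan S) : X * Z ∈ shearSpan S := by
  suffices h : shearSpan S * shearSpan S ≤ shearSpan S from h (Submodule.mul_mem_mul hX hZ)
  nth_rewrite 1 2 [shearSpan]
  rw [Submodule.span_mul_span, Submodule.span_le]
  rintro _ ⟨_, ⟨s, hs, rfl⟩, _, ⟨t, ht, rfl⟩, rfl⟩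
  have h : ((s : Matrix (Fin d) (Fin d) ℝ) - 1) * ((t : Matrix (Fin d) (Fin d) ℝ) - 1) =
      (((s * t : GL (Fin d) ℝ) : Matrix (Fin d) (Fin d) ℝ) - 1) -
        ((s : Matrix (Fin d) (Fin d) ℝ) - 1) - ((t : Matrix (Fin d) (Fin d) ℝ) - 1) := by
    rw [Units.val_mul]; noncomm_ring
  simp only [h]
  exact Submodule.sub_mem _ (Submodule.sub_mem _ (sub_one_mem_shearSpan (S.mul_mem hs ht))
    (sub_one_mem_shearSpan hs)) (sub_one_mem_shearSpan ht)

theorem IsGeneralizedShearlet.shearSpan_commute (hH : IsGeneralizedShearlet H S D Y)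
    {X Z : Matrix (Fin d) (Fin d) ℝ} (hX : X ∈ shearSpan S) (hZ : Z ∈ shearSpan S) :
    Commute X Z := by
  have h1 : ∀ s ∈ S, ∀ Z ∈ shearSpan S, Commute ((s : Matrix (Fin d) (Fin d) ℝ) - 1) Z := by
    intro s hs Z hZ
    induction hZ using Submodule.span_induction with
    | mem x hx =>
      obtain ⟨t, ht, rfl⟩ := hx
      have h : Commute (s : Matrix (Fin d) (Fin d) ℝ) (t : Matrix (Fin d) (Fin d) ℝ) := by
        rw [Commute, SemiconjBy, ← Units.val_mul, hH.shear_comm s hs t ht, Units.val_mul]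
      exact (h.sub_left (Commute.one_left _)).sub_right (Commute.one_right _)
    | zero => exact Commute.zero_right _
    | add x y _ _ hx hy => exact hx.add_right hy
    | smul a x _ hx => exact hx.smul_right a
  induction hX using Submodule.span_induction with
  | mem x hx => obtain ⟨s, hs, rfl⟩ := hx; exact h1 s hs Z hZ
  | zero => exact Commute.zero_left _
  | add x y _ _ hx hy => exact hx.add_left hy
  | smul a x _ hx => exact hx.smul_left a

theorem IsGeneralizedShearlet.shearSpan_le (hH : IsGeneralizedShearlet H S D Y) :
    shearSpan S ≤ strictUpper d 1 := by
  rw [shearSpan, Submodule.span_le]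
  rintro _ ⟨s, hs, rfl⟩ i j hij
  have hu := hH.shear_unipotent s hs
  rcases eq_or_ne i j with rfl | hne
  · simp [hu.1]
  · have : j < i := by
      rw [Fin.lt_def]
      have := Fin.val_ne_of_ne hne
      omega
    simp [hu.2 i j this, Matrix.one_apply_ne hne]

variable [NeZero d]

theorem act_transpose_zero_of_strictUpper {X : Matrix (Fin d) (Fin d) ℝ}
    (hX : X ∈ strictUpper d 1) (ξ : Eucl d) : act Xᵀ ξ 0 = 0 := by
  rw [act_apply]
  refine Finset.sum_eq_zero fun j _ => ?_
  rw [Matrix.transpose_apply, hX j 0 (by simp), zero_mul]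

/-- `{ξ₀ = 0}` is spanned by the vectors `s^T ξ - ξ`. -/
theorem IsGeneralizedShearlet.mem_span_of_zero (hH : IsGeneralizedShearlet H S D Y)
    (hY : Y 0 0 = 1) {w : Eucl d} (hw : w 0 = 0) :
    w ∈ Submodule.span ℝ {v : Eucl d | ∃ s ∈ S, ∃ ξ : Eucl d,
      v = act ((s : Matrix (Fin d) (Fin d) ℝ) - 1)ᵀ ξ} := by
  by_contra hcon
  obtain ⟨f, hfw, hf⟩ := Submodule.exists_le_ker_of_notMem hcon
  have hfc : Continuous f := f.continuous_of_finiteDimensional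
  have hfs : ∀ s ∈ S, ∀ ξ, f (act (s : Matrix (Fin d) (Fin d) ℝ)ᵀ ξ) = f ξ := by
    intro s hs ξ
    have : f (act ((s : Matrix (Fin d) (Fin d) ℝ) - 1)ᵀ ξ) = 0 :=
      hf (Submodule.subset_span ⟨s, hs, ξ, rfl⟩)
    rwa [Matrix.transpose_sub, Matrix.transpose_one, sub_act, act_one, map_sub, sub_eq_zero] at this
  -- Moving along `w` stays inside `{ξ₀ = 1}` and lets `f` take every value; so both signs of `f`
  -- occur on that hyperplane.
  have hη : ∀ c : ℝ, f ((e₀ : Eucl d) + ((c - f e₀) / f w) • w) = c := by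
    intro c
    rw [map_add, map_smul, smul_eq_mul, div_mul_cancel₀ _ hfw]
    ring
  have hclosed : IsClosed {ξ | 0 ≤ f ξ} := isClosed_le continuous_const hfc
  refine hH.not_invariant_splitting hY (E := {ξ | 0 ≤ f ξ}) hclosed.measurableSet
    (fun s hs ξ hξ => by rw [Set.mem_ofPred_eq, hfs s hs]; exact hξ)
    (η := e₀ + ((1 - f e₀) / f w) • w) (η' := e₀ + ((-1 - f e₀) / f w) • w)
    (by simp [hw]) (by simp [hw]) ?_ ?_
  · refine Filter.mem_of_superset (hfc.continuousAt.eventually (lt_mem_nhds (a := 0) ?_))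
      fun ξ hξ => le_of_lt (a := 0) (b := f ξ) hξ
    rw [hη]; norm_num
  · refine hclosed.isOpen_compl.mem_nhds ?_
    rw [Set.mem_compl_iff, Set.mem_ofPred_eq, hη]
    norm_num

/-- A Nakayama argument. Vectors `T^T ξ` span `{ξ₀ = 0}`; modulo `ξ₀ e₀` the vector `ξ` is itself of
the form `Z^T e₀` up to an error, and the strictly lower triangular matrix `T^T` pushes the error
further down. -/
theorem IsGeneralizedShearlet.exists_shearSpan_act_eq (hH : IsGeneralizedShearlet H S D Y)
    (hY : Y 0 0 = 1) {w : Eucl d} (hw : w 0 = 0) :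
    ∃ X ∈ shearSpan S, act Xᵀ e₀ = w := by
  -- Induction on the number `k` of leading coordinates that already agree.
  have key : ∀ k : ℕ, ∀ w : Eucl d, w 0 = 0 →
      ∃ X ∈ shearSpan S, ∀ i : Fin d, (i : ℕ) < k → (w - act Xᵀ e₀) i = 0 := by
    intro k
    induction k with
    | zero => exact fun w _ => ⟨0, Submodule.zero_mem _, fun i hi => absurd hi (by omega)⟩
    | succ k ih =>
      intro w hw
      have hspan := hH.mem_span_of_zero hY hw
      clear hw
      induction hspan using Submodule.span_induction with
      | mem v hv =>
        obtain ⟨s, hs, ξ, rfl⟩ := hv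
        set T : Matrix (Fin d) (Fin d) ℝ := (s : Matrix (Fin d) (Fin d) ℝ) - 1 with hT
        have hTm : T ∈ shearSpan S := sub_one_mem_shearSpan hs
        obtain ⟨Z, hZ, hZk⟩ := ih (ξ - ξ 0 • e₀) (by simp)
        -- Replacing `ξ` by `ξ₀ e₀ + Z^T e₀` in `T^T ξ` gives `(ξ₀ T + Z T)^T e₀`. The remaining
        -- error is `T^T` applied to a vector with `k` leading zeros, so it has `k + 1` of them.
        refine ⟨ξ 0 • T + Z * T, Submodule.add_mem _ (Submodule.smul_mem _ _ hTm)
          (mul_mem_shearSpan hZ hTm), fun i hi => ?_⟩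
        have h1 : act Tᵀ ξ - act (ξ 0 • T + Z * T)ᵀ e₀ =
            act Tᵀ (ξ - ξ 0 • e₀ - act Zᵀ e₀) := by
          rw [Matrix.transpose_add, Matrix.transpose_smul, Matrix.transpose_mul, add_act, smul_act,
            act_mul, act_sub, act_sub, act_smul]
          abel
        rw [h1, act_apply]
        refine Finset.sum_eq_zero fun j _ => ?_
        by_cases hj : (j : ℕ) < k
        · rw [hZk j hj, mul_zero]
        · rw [Matrix.transpose_apply, hH.shearSpan_le hTm j i (by omega), zero_mul]
      | zero => exact ⟨0, Submodule.zero_mem _, fun i _ => by simp [act_apply]⟩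
      | add x y _ _ hx hy =>
        obtain ⟨X, hX, hXk⟩ := hx
        obtain ⟨Z, hZ, hZk⟩ := hy
        refine ⟨X + Z, Submodule.add_mem _ hX hZ, fun i hi => ?_⟩
        rw [Matrix.transpose_add, add_act, add_sub_add_comm, PiLp.add_apply, hXk i hi, hZk i hi,
          add_zero]
      | smul a x _ hx =>
        obtain ⟨X, hX, hXk⟩ := hx
        refine ⟨a • X, Submodule.smul_mem _ _ hX, fun i hi => ?_⟩
        rw [Matrix.transpose_smul, smul_act, ← smul_sub, PiLp.smul_apply, hXk i hi, smul_zero]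
  obtain ⟨X, hX, hXd⟩ := key d w hw
  refine ⟨X, hX, ?_⟩
  ext i
  have := hXd i i.2
  rw [PiLp.sub_apply, sub_eq_zero] at this
  exact this.symm

/-- Every vector is `ξ₀ e₀ + Z^T e₀` with `Z` in the algebra, and `X^T` commutes with `Z^T`; so
`X^T` vanishes everywhere once it kills `e₀`. -/
theorem IsGeneralizedShearlet.eq_zero_of_act_eq_zero (hH : IsGeneralizedShearlet H S D Y)
    (hY : Y 0 0 = 1) {X : Matrix (Fin d) (Fin d) ℝ} (hX : X ∈ shearSpan S)
    (h0 : act Xᵀ e₀ = 0) : X = 0 := by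
  have hall : ∀ ξ : Eucl d, act Xᵀ ξ = 0 := by
    intro ξ
    obtain ⟨Z, hZ, hZe⟩ := hH.exists_shearSpan_act_eq hY (w := ξ - ξ 0 • e₀) (by simp)
    have : ξ = ξ 0 • e₀ + act Zᵀ e₀ := by rw [hZe]; abel
    rw [this, act_add, act_smul, h0, ← act_mul, ← Matrix.transpose_mul,
      (hH.shearSpan_commute hZ hX).eq, Matrix.transpose_mul, act_mul, h0]
    simp [act]
  rw [← Matrix.transpose_eq_zero]
  exact (Matrix.toEuclideanCLM (n := Fin d) (𝕜 := ℝ)).injective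
    (by ext1 v; rw [map_zero]; exact hall v)

/-- `Λ : ℝ^d → ℝ^{d×d}` inverts `Z ↦ Z^T e₀` on the algebra spanned by `S`, and maps `{ξ₀ = 1}`
onto `S`. -/
structure IsShearSection (S : DilationGroup d) (Λ : Eucl d →ₗ[ℝ] Matrix (Fin d) (Fin d) ℝ) :
    Prop where
  act_e₀ : ∀ ξ, act (Λ ξ)ᵀ e₀ = ξ
  exists_mem : ∀ ξ, ξ 0 = 1 → ∃ s ∈ S, (s : Matrix (Fin d) (Fin d) ℝ) = Λ ξ
  eq_of_sub_mem : ∀ (c : ℝ) (M : Matrix (Fin d) (Fin d) ℝ), M - c • 1 ∈ shearSpan S →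
    Λ (act Mᵀ e₀) = M

theorem IsShearSection.eq_of_mem {Λ : Eucl d →ₗ[ℝ] Matrix (Fin d) (Fin d) ℝ}
    (hΛ : IsShearSection S Λ) {s : GL (Fin d) ℝ} (hs : s ∈ S) :
    Λ (act (s : Matrix (Fin d) (Fin d) ℝ)ᵀ e₀) = s :=
  hΛ.eq_of_sub_mem 1 _ (by rw [one_smul]; exact sub_one_mem_shearSpan hs)

open scoped Matrix.Norms.L2Operator in
-- Surjectivity of `X ↦ X^T e₀` defines `Λ` on a basis and injectivity makes it unique, hence
-- equivariant under `S`. That `Λ` sends all of `{ξ₀ = 1}` into `S` needs ergodicity: since `S` is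
-- closed, a point missed by the orbit of `e₀` could be separated from that orbit by an open
-- `S`-invariant set.
theorem IsGeneralizedShearlet.exists_isShearSection (hH : IsGeneralizedShearlet H S D Y)
    (hY : Y 0 0 = 1) : ∃ Λ, IsShearSection S Λ := by
  have hbasis : ∀ i : Fin d, ∃ Z : Matrix (Fin d) (Fin d) ℝ,
      act Zᵀ e₀ = EuclideanSpace.single i 1 ∧ Z - (if i = 0 then (1 : ℝ) else 0) • 1 ∈ shearSpan S := by
    intro i
    rcases eq_or_ne i 0 with rfl | hi
    · exact ⟨1, by simp [e₀], by simp⟩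
    · obtain ⟨X, hX, hXe⟩ := hH.exists_shearSpan_act_eq hY (w := EuclideanSpace.single i 1)
        (by simp [hi.symm])
      exact ⟨X, hXe, by simpa [hi] using hX⟩
  choose Z hZe hZs using hbasis
  let Λ : Eucl d →ₗ[ℝ] Matrix (Fin d) (Fin d) ℝ :=
    { toFun := fun ξ => ∑ i, ξ i • Z i
      map_add' := fun ξ η => by simp [add_smul, Finset.sum_add_distrib]
      map_smul' := fun c ξ => by simp [mul_smul, Finset.smul_sum] }
  have hΛ : ∀ ξ, Λ ξ = ∑ i, ξ i • Z i := fun ξ => rfl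
  have hact : ∀ ξ, act (Λ ξ)ᵀ e₀ = ξ := by
    intro ξ
    ext j
    rw [act_transpose_e₀, hΛ, Matrix.sum_apply, Finset.sum_eq_single j]
    · have := act_transpose_e₀ (Z j) j
      rw [hZe] at this
      simp [← this]
    · intro i _ hi
      have := act_transpose_e₀ (Z i) j
      rw [hZe] at this
      simp [← this, hi.symm]
    · simp
  have hmem : ∀ ξ, Λ ξ - ξ 0 • 1 ∈ shearSpan S := by
    intro ξ
    have h1 : Λ ξ - ξ 0 • 1 =
        ∑ i, ξ i • (Z i - (if i = 0 then (1 : ℝ) else 0) • (1 : Matrix (Fin d) (Fin d) ℝ)) := by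
      rw [hΛ]
      simp only [smul_sub, Finset.sum_sub_distrib, smul_smul, mul_ite, mul_one, mul_zero]
      rw [← Finset.sum_smul]
      simp
    rw [h1]
    exact Submodule.sum_mem _ fun i _ => Submodule.smul_mem _ _ (hZs i)
  have huniq : ∀ (c : ℝ) (M : Matrix (Fin d) (Fin d) ℝ), M - c • 1 ∈ shearSpan S →
      Λ (act Mᵀ e₀) = M := by
    intro c M hM
    have hc : act Mᵀ e₀ 0 = c := by
      have := act_transpose_zero_of_strictUpper (hH.shearSpan_le hM) e₀
      rw [Matrix.transpose_sub, sub_act, Matrix.transpose_smul, smul_act, Matrix.transpose_one,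
        act_one] at this
      simpa [sub_eq_zero] using this
    have h1 := Submodule.sub_mem _ hM (hmem (act Mᵀ e₀))
    rw [hc, sub_sub_sub_cancel_right] at h1
    have h2 := hH.eq_zero_of_act_eq_zero hY h1
      (by rw [Matrix.transpose_sub, sub_act, hact, sub_self])
    exact (sub_eq_zero.mp h2).symm
  -- Equivariance follows from uniqueness: `Λ ξ * s` also differs from `ξ₀ • 1` by an element of the
  -- algebra and sends `e₀` to `s^T ξ`.
  have hmul : ∀ s ∈ S, ∀ ξ, Λ (act (s : Matrix (Fin d) (Fin d) ℝ)ᵀ ξ) =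
      Λ ξ * (s : Matrix (Fin d) (Fin d) ℝ) := by
    intro s hs ξ
    have h1 : Λ ξ * (s : Matrix (Fin d) (Fin d) ℝ) - ξ 0 • 1 ∈ shearSpan S := by
      have : Λ ξ * (s : Matrix (Fin d) (Fin d) ℝ) - ξ 0 • 1 =
          (Λ ξ - ξ 0 • 1) * ((s : Matrix (Fin d) (Fin d) ℝ) - 1) + (Λ ξ - ξ 0 • 1) +
            ξ 0 • ((s : Matrix (Fin d) (Fin d) ℝ) - 1) := by
        rw [smul_sub, mul_sub, sub_mul, smul_mul_assoc, one_mul, mul_one]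
        abel
      rw [this]
      exact Submodule.add_mem _ (Submodule.add_mem _ (mul_mem_shearSpan (hmem ξ)
        (sub_one_mem_shearSpan hs)) (hmem ξ)) (Submodule.smul_mem _ _ (sub_one_mem_shearSpan hs))
    rw [← huniq _ _ h1, Matrix.transpose_mul, act_mul, hact]
  have hΛc : Continuous Λ := Λ.continuous_of_finiteDimensional
  have hdet : ∀ ξ, ξ 0 = 1 → (Λ ξ).det ≠ 0 := by
    intro ξ hξ
    have h1 := hmem ξ
    rw [hξ, one_smul] at h1
    have h2 : IsUnipotentUpper (Λ ξ) := by
      refine ⟨fun i => ?_, fun i j hij => ?_⟩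
      · have := hH.shearSpan_le h1 i i (by omega)
        simpa [sub_eq_zero] using this
      · have := hH.shearSpan_le h1 i j (by rw [Fin.lt_def] at hij; omega)
        simpa [Matrix.one_apply_ne hij.ne'] using this
    simp [h2.det_eq_one]
  refine ⟨Λ, hact, fun ξ hξ => ?_, huniq⟩
  set u : GL (Fin d) ℝ := Matrix.GeneralLinearGroup.mkOfDetNeZero (Λ ξ) (hdet ξ hξ) with hu
  have huval : (u : Matrix (Fin d) (Fin d) ℝ) = Λ ξ := rfl
  by_contra hcon
  have huS : u⁻¹ ∉ S := fun h => hcon ⟨u, inv_inv u ▸ S.inv_mem h, huval⟩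
  set O : Set (Matrix (Fin d) (Fin d) ℝ) := Units.val '' {g : GL (Fin d) ℝ | g ∉ S} with hO
  have hOopen : IsOpen O :=
    Units.isOpenEmbedding_val.isOpenMap _ S.isClosed'.isOpen_compl
  -- At `(ξ, e₀)` this function takes the value `u⁻¹`, which lies outside the closed group `S`; by
  -- continuity its values on a product `B ×ˢ B'` of neighbourhoods stay in `O`.
  have hcont : ContinuousAt (fun p : Eucl d × Eucl d => (Λ p.1)⁻¹ * Λ p.2) (ξ, e₀) := by
    have hinv : ContinuousAt (fun M : Matrix (Fin d) (Fin d) ℝ => M⁻¹) (Λ ξ) := by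
      have := NormedRing.inverse_continuousAt u
      simpa [Matrix.nonsing_inv_eq_ringInverse, huval] using this
    exact (ContinuousAt.comp (x := (ξ, e₀)) (f := fun p : Eucl d × Eucl d => Λ p.1) hinv
      (hΛc.comp continuous_fst).continuousAt).mul (hΛc.comp continuous_snd).continuousAt
  have hΛe : Λ e₀ = 1 := by
    have := huniq 1 1 (by simp)
    simpa using this
  have hval : (Λ ξ)⁻¹ * Λ e₀ ∈ O :=
    ⟨u⁻¹, huS, by rw [hΛe, mul_one, ← huval, Matrix.coe_units_inv]⟩
  obtain ⟨B, hB, B', hB', hBB⟩ := mem_nhds_prod_iff.mp (hcont (hOopen.mem_nhds hval))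
  have hdetnhds : {ζ : Eucl d | (Λ ζ).det ≠ 0} ∈ 𝓝 ξ :=
    (hΛc.matrix_det.continuousAt).eventually_ne (hdet ξ hξ)
  -- The saturation under `S` of a neighbourhood of `e₀`; it will turn out to miss a neighbourhood
  -- of `ξ`.
  set E : Set (Eucl d) := ⋃ s ∈ S, act ((s : GL (Fin d) ℝ) : Matrix (Fin d) (Fin d) ℝ)ᵀ ⁻¹'
    interior B' with hE
  have hEopen : IsOpen E :=
    isOpen_biUnion fun s _ => isOpen_interior.preimage (continuous_act _)
  refine hH.not_invariant_splitting hY hEopen.measurableSet ?_ (η := e₀) (η' := ξ)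
    (by simp) hξ (hEopen.mem_nhds ?_) (Filter.mem_of_superset (Filter.inter_mem hB hdetnhds) ?_)
  · intro s hs ζ hζ
    rw [hE, Set.mem_iUnion₂] at hζ ⊢
    obtain ⟨t, ht, hζt⟩ := hζ
    refine ⟨s⁻¹ * t, S.mul_mem (S.inv_mem hs) ht, ?_⟩
    rw [Set.mem_preimage, ← act_mul, ← Matrix.transpose_mul, ← Units.val_mul, mul_inv_cancel_left]
    exact hζt
  · rw [hE, Set.mem_iUnion₂]
    exact ⟨1, S.one_mem, by simpa using mem_interior_iff_mem_nhds.mpr hB'⟩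
  -- If `s^T ζ ∈ B'` with `ζ ∈ B`, then `(Λ ζ)⁻¹ Λ(s^T ζ) = s` belongs to `S`, contrary to the
  -- choice of `B` and `B'`.
  · rintro ζ ⟨hζB, hζd⟩ hζE
    rw [hE, Set.mem_iUnion₂] at hζE
    obtain ⟨s, hs, hζs⟩ := hζE
    have h0 : (ζ, act (s : Matrix (Fin d) (Fin d) ℝ)ᵀ ζ) ∈ B ×ˢ B' :=
      ⟨hζB, interior_subset hζs⟩
    have h1 := Set.mem_preimage.mp (hBB h0)
    rw [hmul s hs, Matrix.nonsing_inv_mul_cancel_left _ _ (Ne.isUnit hζd)] at h1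
    obtain ⟨g, hg, hgs⟩ := h1
    exact hg (by rwa [Units.ext hgs])

end ShearAlgebra

end Shearlet

end
noncomputable section

namespace Shearlet

/-! ### The Lie algebra of `S` and its nilpotency class. -/

section LieAlgebra

variable {d : ℕ} {S : DilationGroup d}

open scoped Matrix.Norms.L2Operator in
theorem exp_sub_one_mem_shearSpan {X : Matrix (Fin d) (Fin d) ℝ} (hX : X ∈ shearSpan S) :
    NormedSpace.exp X - 1 ∈ shearSpan S := by
  have hclosed : IsClosed (shearSpan S : Set (Matrix (Fin d) (Fin d) ℝ)) :=
    Submodule.closed_of_finiteDimensional _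
  have hsum := (NormedSpace.exp_series_hasSum_exp' (𝕂 := ℝ) X).tendsto_sum_nat
  have h1 := ((Filter.tendsto_add_atTop_iff_nat 1).mpr hsum).sub_const 1
  refine hclosed.mem_of_tendsto h1 (Filter.Eventually.of_forall fun n => ?_)
  have hpow : ∀ k : ℕ, X ^ (k + 1) ∈ shearSpan S := by
    intro k
    induction k with
    | zero => simpa using hX
    | succ k ih => rw [pow_succ]; exact mul_mem_shearSpan ih hX
  rw [Finset.sum_range_succ']
  simp only [Nat.factorial_zero, Nat.cast_one, inv_one, pow_zero, one_smul, add_sub_cancel_right]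
  exact Submodule.sum_mem _ fun k _ => Submodule.smul_mem _ _ (hpow k)

open scoped Matrix.Norms.L2Operator in
-- `X` is the limit of the difference quotients `(exp(rX) - 1)/r`, and a finite-dimensional subspace
-- is closed.
theorem lieAlg_subset_shearSpan {X : Matrix (Fin d) (Fin d) ℝ} (hX : X ∈ lieAlg S) :
    X ∈ shearSpan S := by
  have hclosed : IsClosed (shearSpan S : Set (Matrix (Fin d) (Fin d) ℝ)) :=
    Submodule.closed_of_finiteDimensional _
  have hd := (hasDerivAt_exp_smul_const (𝕂 := ℝ) X 0).tendsto_slope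
  rw [zero_smul, NormedSpace.exp_zero, one_mul] at hd
  refine hclosed.mem_of_tendsto hd (Filter.Eventually.of_forall fun r => ?_)
  obtain ⟨s, hs, hsr⟩ := hX r
  rw [slope_def_module, zero_smul, NormedSpace.exp_zero, ← hsr]
  exact Submodule.smul_mem _ _ (sub_one_mem_shearSpan hs)

variable [NeZero d] {H D : DilationGroup d} {Y : Matrix (Fin d) (Fin d) ℝ}
  {Λ : Eucl d →ₗ[ℝ] Matrix (Fin d) (Fin d) ℝ}

/-- `exp(rX) - 1` stays in the algebra, so `exp(rX)` is the value of `Λ` at a point of `{ξ₀ = 1}`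
and therefore an element of `S`. -/
theorem IsShearSection.shearSpan_subset_lieAlg (hΛ : IsShearSection S Λ)
    (hH : IsGeneralizedShearlet H S D Y) {X : Matrix (Fin d) (Fin d) ℝ} (hX : X ∈ shearSpan S) :
    X ∈ lieAlg S := by
  intro r
  have h1 := exp_sub_one_mem_shearSpan (Submodule.smul_mem _ r hX)
  have h2 : Λ (act (NormedSpace.exp (r • X))ᵀ e₀) = NormedSpace.exp (r • X) :=
    hΛ.eq_of_sub_mem 1 _ (by rwa [one_smul])
  rw [← h2]
  refine hΛ.exists_mem _ ?_
  have h3 := act_transpose_zero_of_strictUpper (hH.shearSpan_le h1) e₀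
  rw [Matrix.transpose_sub, sub_act, Matrix.transpose_one, act_one] at h3
  simpa [sub_eq_zero] using h3

theorem IsShearSection.span_lieAlg (hΛ : IsShearSection S Λ)
    (hH : IsGeneralizedShearlet H S D Y) : Submodule.span ℝ (lieAlg S) = shearSpan S :=
  le_antisymm (Submodule.span_le.mpr fun _ hX => lieAlg_subset_shearSpan hX)
    fun _ hX => Submodule.subset_span (hΛ.shearSpan_subset_lieAlg hH hX)

theorem IsShearSection.shearSpan_pow_nilpotencyClass (hΛ : IsShearSection S Λ)
    (hH : IsGeneralizedShearlet H S D Y) :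
    shearSpan S ^ nilpotencyClass (lieAlg S) = ⊥ := by
  rw [← hΛ.span_lieAlg hH]
  refine Nat.sInf_mem (s := {n : ℕ | Submodule.span ℝ (lieAlg S) ^ n = ⊥}) ⟨d, ?_⟩
  rw [Set.mem_ofPred_eq, hΛ.span_lieAlg hH, eq_bot_iff, ← strictUpper_eq_bot]
  exact pow_le_strictUpper hH.shearSpan_le d

/-- The zeroth power of the span contains the identity matrix. The bound ensures that the natural
number subtraction `n - 1` in the estimates is not truncated. -/
theorem IsShearSection.one_le_nilpotencyClass (hΛ : IsShearSection S Λ)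
    (hH : IsGeneralizedShearlet H S D Y) : 1 ≤ nilpotencyClass (lieAlg S) := by
  by_contra hcon
  have h0 : nilpotencyClass (lieAlg S) = 0 := by omega
  have h := hΛ.shearSpan_pow_nilpotencyClass hH
  rw [h0, pow_zero] at h
  have h1 : (1 : Matrix (Fin d) (Fin d) ℝ) ∈ (⊥ : Submodule ℝ (Matrix (Fin d) (Fin d) ℝ)) :=
    h ▸ Submodule.one_le.mp le_rfl
  exact one_ne_zero h1

end LieAlgebra

/-! ### The open orbit and the orbit map as global coordinates on `H`. -/

section OrbitMap

variable {d : ℕ} {H S D : DilationGroup d} {Y : Matrix (Fin d) (Fin d) ℝ}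
  {Λ : Eucl d →ₗ[ℝ] Matrix (Fin d) (Fin d) ℝ}

theorem continuous_mat : Continuous fun h : H => mat h :=
  Units.continuous_val.comp continuous_subtype_val

theorem continuous_mat_inv : Continuous fun h : H => mat h⁻¹ :=
  continuous_mat.comp continuous_inv

theorem continuous_act_mat (ξ : Eucl d) : Continuous fun h : H => act (mat h)ᵀ ξ :=
  continuous_act_of_continuous continuous_mat.matrix_transpose continuous_const

open scoped Matrix.Norms.L2Operator in
theorem isEmbedding_mat : IsEmbedding fun h : H => mat h :=
  Units.isOpenEmbedding_val.isEmbedding.comp IsEmbedding.subtypeVal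

variable [NeZero d]

/-- The orbit map `h ↦ h^T e₀`. -/
def orbitMap (H : DilationGroup d) (h : H) : Eucl d := act (mat h)ᵀ e₀

theorem orbitMap_mul (g h : H) : orbitMap H (g * h) = act (mat h)ᵀ (orbitMap H g) := by
  rw [orbitMap, orbitMap, ← act_mul, ← Matrix.transpose_mul]
  rfl

theorem act_dil_e₀ (hY : Y 0 0 = 1) (r : ℝ) : act (dil Y r) (e₀ : Eucl d) = Real.exp r • e₀ := by
  ext i
  rw [act_dil_apply, PiLp.smul_apply, smul_eq_mul]
  rcases eq_or_ne i 0 with rfl | hi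
  · rw [hY, mul_one]
  · rw [e₀_apply_ne hi, mul_zero, mul_zero]

/-- The first coordinate is an eigenfunctional of the whole dual action; its eigenvalue `h ↦ (h^T
e₀)₀ = ± exp r` is the character through which determinant and modular function are expressed. -/
theorem IsGeneralizedShearlet.act_transpose_zero (hH : IsGeneralizedShearlet H S D Y)
    (hY : Y 0 0 = 1) (h : H) (ξ : Eucl d) : act (mat h)ᵀ ξ 0 = orbitMap H h 0 * ξ 0 := by
  obtain ⟨ε, -, r, s, hs, heq⟩ := hH.exists_factor h.2
  have key : ∀ ξ : Eucl d, act (mat h)ᵀ ξ 0 = ε * (Real.exp r * ξ 0) := by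
    intro ξ
    rw [mat, heq, Matrix.transpose_smul, smul_act, Matrix.transpose_mul, transpose_dil, act_mul,
      PiLp.smul_apply, (hH.shear_unipotent s hs).act_transpose_zero, act_dil_apply, hY, mul_one,
      smul_eq_mul]
  rw [orbitMap, key, key, e₀_apply_zero]
  ring

theorem orbitMap_of_factor (hY : Y 0 0 = 1) {h : H} {ε r : ℝ} {s : GL (Fin d) ℝ}
    (heq : mat h = ε • (dil Y r * (s : Matrix (Fin d) (Fin d) ℝ))) :
    orbitMap H h = (ε * Real.exp r) • act (s : Matrix (Fin d) (Fin d) ℝ)ᵀ e₀ := by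
  rw [orbitMap, heq, Matrix.transpose_smul, smul_act, Matrix.transpose_mul, transpose_dil, act_mul,
    act_dil_e₀ hY, act_smul, smul_smul]

theorem IsGeneralizedShearlet.orbitMap_zero_of_factor (hH : IsGeneralizedShearlet H S D Y)
    (hY : Y 0 0 = 1) {h : H} {ε r : ℝ} {s : GL (Fin d) ℝ} (hs : s ∈ S)
    (heq : mat h = ε • (dil Y r * (s : Matrix (Fin d) (Fin d) ℝ))) :
    orbitMap H h 0 = ε * Real.exp r := by
  rw [orbitMap_of_factor hY heq, PiLp.smul_apply, (hH.shear_unipotent s hs).act_transpose_zero,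
    e₀_apply_zero, smul_eq_mul, mul_one]

theorem IsGeneralizedShearlet.orbitMap_zero_ne_zero (hH : IsGeneralizedShearlet H S D Y)
    (hY : Y 0 0 = 1) (h : H) : orbitMap H h 0 ≠ 0 := by
  obtain ⟨ε, hε, r, s, hs, heq⟩ := hH.exists_factor h.2
  rw [hH.orbitMap_zero_of_factor hY hs heq]
  have : ε ≠ 0 := by rcases hε with h | h <;> simp [h]
  positivity

/-- The matrix of the group element that maps `e₀` to `ξ`. -/
def orbitSection (Y : Matrix (Fin d) (Fin d) ℝ) (Λ : Eucl d →ₗ[ℝ] Matrix (Fin d) (Fin d) ℝ)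
    (ξ : Eucl d) : Matrix (Fin d) (Fin d) ℝ :=
  (ξ 0 / |ξ 0|) • (dil Y (Real.log (ξ 0)) * Λ ((ξ 0)⁻¹ • ξ))

theorem IsShearSection.orbitSection_orbitMap (hΛ : IsShearSection S Λ)
    (hH : IsGeneralizedShearlet H S D Y) (hY : Y 0 0 = 1) (h : H) :
    orbitSection Y Λ (orbitMap H h) = mat h := by
  obtain ⟨ε, hε, r, s, hs, heq⟩ := hH.exists_factor h.2
  have h0 := hH.orbitMap_zero_of_factor hY hs heq
  have hε0 : ε ≠ 0 := by rcases hε with h | h <;> simp [h]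
  have hεa : |ε| = 1 := by rcases hε with h | h <;> simp [h]
  rw [orbitSection, h0, orbitMap_of_factor hY heq, smul_smul,
    inv_mul_cancel₀ (by positivity : ε * Real.exp r ≠ 0), one_smul, hΛ.eq_of_mem hs,
    Real.log_mul hε0 (by positivity), ← Real.log_abs, hεa, Real.log_one, zero_add, Real.log_exp,
    abs_mul, hεa, one_mul, abs_of_pos (Real.exp_pos r), mul_div_cancel_right₀ _ (Real.exp_pos r).ne',
    ← heq]

theorem IsShearSection.exists_orbitMap_eq (hΛ : IsShearSection S Λ)
    (hH : IsGeneralizedShearlet H S D Y) (hY : Y 0 0 = 1) {ξ : Eucl d} (hξ : ξ 0 ≠ 0) :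
    ∃ h : H, orbitMap H h = ξ := by
  obtain ⟨s, hs, hsΛ⟩ := hΛ.exists_mem ((ξ 0)⁻¹ • ξ) (by simp [hξ])
  have hact : act (s : Matrix (Fin d) (Fin d) ℝ)ᵀ e₀ = (ξ 0)⁻¹ • ξ := by rw [hsΛ, hΛ.act_e₀]
  have hmem : dilGL Y (Real.log |ξ 0|) * s ∈ H :=
    H.mul_mem (hH.dilGL_mem _) (hH.shear_le hs)
  have hexp : Real.exp (Real.log |ξ 0|) = |ξ 0| := Real.exp_log (abs_pos.mpr hξ)
  rcases lt_or_gt_of_ne hξ with hlt | hgt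
  · refine ⟨⟨-1 * (dilGL Y (Real.log |ξ 0|) * s), H.mul_mem hH.neg_one_mem hmem⟩, ?_⟩
    rw [orbitMap_of_factor (ε := -1) (r := Real.log |ξ 0|) (s := s) hY (by simp [mat, dilGL]), hact,
      hexp, abs_of_neg hlt, smul_smul, neg_mul_neg, one_mul, mul_inv_cancel₀ hξ, one_smul]
  · refine ⟨⟨dilGL Y (Real.log |ξ 0|) * s, hmem⟩, ?_⟩
    rw [orbitMap_of_factor (ε := 1) (r := Real.log |ξ 0|) (s := s) hY (by simp [mat, dilGL]), hact,
      hexp, abs_of_pos hgt, smul_smul, one_mul, mul_inv_cancel₀ hξ, one_smul]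

theorem IsShearSection.range_orbitMap (hΛ : IsShearSection S Λ)
    (hH : IsGeneralizedShearlet H S D Y) (hY : Y 0 0 = 1) :
    Set.range (orbitMap H) = {ξ : Eucl d | ξ 0 ≠ 0} := by
  ext ξ
  refine ⟨?_, fun hξ => hΛ.exists_orbitMap_eq hH hY hξ⟩
  rintro ⟨h, rfl⟩
  exact hH.orbitMap_zero_ne_zero hY h

theorem isOpen_coord_ne_zero : IsOpen {ξ : Eucl d | ξ 0 ≠ 0} :=
  (isOpen_ne (x := (0 : ℝ))).preimage (continuous_coord 0)

theorem IsShearSection.dualOrbit_eq (hΛ : IsShearSection S Λ)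
    (hH : IsGeneralizedShearlet H S D Y) (hY : Y 0 0 = 1) {ξ : Eucl d} (hξ : ξ 0 ≠ 0) :
    dualOrbit H ξ = {ξ : Eucl d | ξ 0 ≠ 0} := by
  obtain ⟨g, rfl⟩ := hΛ.exists_orbitMap_eq hH hY hξ
  rw [← hΛ.range_orbitMap hH hY]
  ext η
  constructor
  · rintro ⟨h, rfl⟩
    exact ⟨g * h, orbitMap_mul g h⟩
  · rintro ⟨h, rfl⟩
    refine ⟨g⁻¹ * h, ?_⟩
    simp only
    rw [← orbitMap_mul, mul_inv_cancel_left]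

theorem IsShearSection.openDualOrbit_eq (hΛ : IsShearSection S Λ)
    (hH : IsGeneralizedShearlet H S D Y) (hY : Y 0 0 = 1) :
    openDualOrbit H = {ξ : Eucl d | ξ 0 ≠ 0} := by
  ext ξ
  constructor
  · intro hξ h0
    have hmem : ξ ∈ dualOrbit H ξ := ⟨1, by simp [mat]⟩
    have hsub : dualOrbit H ξ ⊆ {η | η 0 = 0} := by
      rintro _ ⟨h, rfl⟩
      simp only [Set.mem_ofPred_eq]
      rw [hH.act_transpose_zero hY, h0, mul_zero]
    -- An orbit inside `{ξ₀ = 0}` is not open, since one leaves it by moving slightly in the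
    -- direction `e₀`.
    have hcont : Filter.Tendsto (fun t : ℝ => ξ + t • (e₀ : Eucl d)) (𝓝[≠] 0) (𝓝 ξ) := by
      have : Continuous fun t : ℝ => ξ + t • (e₀ : Eucl d) := by fun_prop
      simpa using (this.tendsto 0).mono_left nhdsWithin_le_nhds
    obtain ⟨t, ht, ht0⟩ := ((hcont.eventually (IsOpen.mem_nhds hξ hmem)).and
      self_mem_nhdsWithin).exists
    have := hsub ht
    simp [h0] at this
    exact ht0 this
  · intro hξ
    rw [openDualOrbit, Set.mem_ofPred_eq, hΛ.dualOrbit_eq hH hY hξ]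
    exact isOpen_coord_ne_zero

theorem continuousOn_orbitSection :
    ContinuousOn (orbitSection Y Λ) {ξ : Eucl d | ξ 0 ≠ 0} := by
  intro ξ hξ
  have hξ' : ξ 0 ≠ 0 := hξ
  refine ContinuousAt.continuousWithinAt ?_
  have hc : ContinuousAt (fun ξ : Eucl d => ξ 0) ξ := (continuous_coord 0).continuousAt
  have hΛc : Continuous Λ := Λ.continuous_of_finiteDimensional
  have hdil : Continuous (dil Y) :=
    Continuous.matrix_diagonal (continuous_pi fun i => by fun_prop)
  refine (hc.div hc.abs (abs_ne_zero.mpr hξ')).smul (ContinuousAt.mul ?_ ?_)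
  · exact hdil.continuousAt.comp (hc.log hξ')
  · exact hΛc.continuousAt.comp ((hc.inv₀ hξ').smul continuousAt_id)

/-- Following the orbit map by the continuous `orbitSection` gives `mat`, which is an embedding; so
the orbit map is one too, and its range `{ξ₀ ≠ 0}` is open. -/
theorem IsShearSection.isOpenEmbedding_orbitMap (hΛ : IsShearSection S Λ)
    (hH : IsGeneralizedShearlet H S D Y) (hY : Y 0 0 = 1) : IsOpenEmbedding (orbitMap H) := by
  have h1 : Continuous (fun h : H => (⟨orbitMap H h, hH.orbitMap_zero_ne_zero hY h⟩ :
      {ξ : Eucl d // ξ 0 ≠ 0})) := (continuous_act_mat e₀).subtype_mk _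
  have h2 : Continuous fun ξ : {ξ : Eucl d // ξ 0 ≠ 0} => orbitSection Y Λ ξ :=
    continuousOn_iff_continuous_domRestrict.mp continuousOn_orbitSection
  have h3 : IsEmbedding (fun h : H => (⟨orbitMap H h, hH.orbitMap_zero_ne_zero hY h⟩ :
      {ξ : Eucl d // ξ 0 ≠ 0})) := by
    refine IsEmbedding.of_comp h1 h2 ?_
    have : (fun ξ : {ξ : Eucl d // ξ 0 ≠ 0} => orbitSection Y Λ ξ) ∘ (fun h : H =>
        (⟨orbitMap H h, hH.orbitMap_zero_ne_zero hY h⟩ : {ξ : Eucl d // ξ 0 ≠ 0})) =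
        fun h : H => mat h := funext fun h => hΛ.orbitSection_orbitMap hH hY h
    rw [this]
    exact isEmbedding_mat
  exact ⟨IsEmbedding.subtypeVal.comp h3, by
    rw [hΛ.range_orbitMap hH hY]; exact isOpen_coord_ne_zero⟩

end OrbitMap

end Shearlet

end
noncomputable section

namespace Shearlet

/-! ### Operator norm bounds for dilations and unipotent matrices. -/

section OpNorm

variable {d : ℕ}

open scoped Matrix.Norms.L2Operator

theorem opNorm_eq_norm (M : Matrix (Fin d) (Fin d) ℝ) : opNorm M = ‖M‖ := rfl

theorem opNorm_nonneg (M : Matrix (Fin d) (Fin d) ℝ) : 0 ≤ opNorm M := norm_nonneg _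

theorem opNorm_mul_le (M N : Matrix (Fin d) (Fin d) ℝ) :
    opNorm (M * N) ≤ opNorm M * opNorm N := norm_mul_le M N

theorem opNorm_one_le : opNorm (1 : Matrix (Fin d) (Fin d) ℝ) ≤ 1 := by
  rw [opNorm, map_one]
  exact ContinuousLinearMap.norm_id_le

theorem opNorm_transpose (M : Matrix (Fin d) (Fin d) ℝ) : opNorm Mᵀ = opNorm M := by
  rw [opNorm_eq_norm, opNorm_eq_norm, ← Matrix.conjTranspose_eq_transpose_of_trivial,
    Matrix.l2_opNorm_conjTranspose]

theorem continuous_opNorm : Continuous (opNorm : Matrix (Fin d) (Fin d) ℝ → ℝ) :=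
  continuous_norm

theorem opNorm_smul_of_abs_eq_one {ε : ℝ} (hε : |ε| = 1) (M : Matrix (Fin d) (Fin d) ℝ) :
    opNorm (ε • M) = opNorm M := by
  rw [opNorm_eq_norm, norm_smul, Real.norm_eq_abs, hε, one_mul, opNorm_eq_norm]

theorem opNorm_dil_le {Y : Matrix (Fin d) (Fin d) ℝ} (hY : Y.IsDiag) (r : ℝ) :
    opNorm (dil Y r) ≤ Real.exp (|r| * opNorm Y) := by
  rw [opNorm_eq_norm, dil, Matrix.l2_opNorm_diagonal, pi_norm_le_iff_of_nonneg (Real.exp_pos _).le]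
  intro i
  rw [Real.norm_eq_abs, abs_of_pos (Real.exp_pos _), Real.exp_le_exp]
  refine (le_abs_self _).trans ?_
  rw [abs_mul]
  gcongr
  rw [opNorm_eq_norm, ← hY.diagonal_diag, Matrix.l2_opNorm_diagonal]
  simpa using norm_le_pi_norm (Matrix.diag Y) i

/-- If `(-X)^n = 0`, then `1 + X` and its inverse are bounded by a polynomial of degree `n - 1`. -/
theorem norm_unipotent_le {n : ℕ} (hn : 1 ≤ n) {X : Matrix (Fin d) (Fin d) ℝ} (hX : X ^ n = 0)
    {g : GL (Fin d) ℝ} (hg : (g : Matrix (Fin d) (Fin d) ℝ) = 1 + X) {B : ℝ} (hB : 1 + ‖X‖ ≤ B) :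
    opNorm (g : Matrix (Fin d) (Fin d) ℝ) ≤ n * B ^ (n - 1) ∧
      opNorm ((g⁻¹ : GL (Fin d) ℝ) : Matrix (Fin d) (Fin d) ℝ) ≤ n * B ^ (n - 1) := by
  have hB1 : 1 ≤ B := le_trans (by linarith [norm_nonneg X]) hB
  have h1 : ‖(1 : Matrix (Fin d) (Fin d) ℝ)‖ ≤ 1 := opNorm_one_le
  have hn1 : (1 : ℝ) ≤ n := by exact_mod_cast hn
  constructor
  · rw [hg, opNorm_eq_norm]
    -- For `n = 1` the bound is the constant `1`, which does not dominate `B`; but then `X = 0`.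
    rcases hn.eq_or_lt with rfl | hn2
    · rw [pow_one] at hX
      simpa [hX] using h1
    · calc ‖1 + X‖ ≤ 1 + ‖X‖ := (norm_add_le _ _).trans (by gcongr)
        _ ≤ B := hB
        _ ≤ B ^ (n - 1) := le_self_pow₀ hB1 (by omega)
        _ ≤ n * B ^ (n - 1) := le_mul_of_one_le_left (by positivity) hn1
  -- The Neumann series of `(1 + X)⁻¹` stops after `n` terms.
  · have hinv : ((g⁻¹ : GL (Fin d) ℝ) : Matrix (Fin d) (Fin d) ℝ) =
        ∑ i ∈ Finset.range n, (-X) ^ i := by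
      refine left_inv_eq_right_inv (a := (g : Matrix (Fin d) (Fin d) ℝ)) ?_ ?_
      · rw [← Units.val_mul, inv_mul_cancel, Units.val_one]
      · have h2 := mul_neg_geom_sum (-X) n
        rw [sub_neg_eq_add, neg_pow, hX, mul_zero, sub_zero] at h2
        rw [hg, h2]
    rw [hinv, opNorm_eq_norm]
    have hpow : ∀ i ∈ Finset.range n, ‖(-X) ^ i‖ ≤ B ^ (n - 1) := by
      intro i hi
      have hi' : i ≤ n - 1 := by have := Finset.mem_range.mp hi; omega
      refine le_trans ?_ (pow_le_pow_right₀ hB1 hi')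
      rcases Nat.eq_zero_or_pos i with rfl | hpos
      · simpa using h1
      · refine (norm_pow_le' _ hpos).trans ?_
        rw [norm_neg]
        gcongr
        linarith
    refine (norm_sum_le_of_le _ hpow).trans ?_
    rw [Finset.sum_const, Finset.card_range, nsmul_eq_mul]

end OpNorm

/-! ### The function `A` when `𝒪 = {ξ₀ ≠ 0}`. -/

section AuxiliaryFunction

variable {d : ℕ} {H : DilationGroup d}

theorem continuous_auxA : Continuous (auxA H) := by
  have h1 : Continuous (distCompl H) := Metric.continuous_infDist_pt _
  refine Continuous.min ?_ ?_
  · refine h1.div (continuous_const.add ((continuous_norm.pow 2).sub (h1.pow 2)).sqrt) fun ξ => ?_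
    positivity
  · exact continuous_const.div (continuous_const.add continuous_norm) fun ξ => by positivity

theorem auxA_nonneg (ξ : Eucl d) : 0 ≤ auxA H ξ :=
  le_min (div_nonneg Metric.infDist_nonneg (by positivity)) (by positivity)

theorem auxA_mul_one_add_norm_le (ξ : Eucl d) : auxA H ξ * (1 + ‖ξ‖) ≤ 1 := by
  rw [← le_div_iff₀ (by positivity)]
  exact min_le_right _ _

theorem auxA_le_one (ξ : Eucl d) : auxA H ξ ≤ 1 := by
  nlinarith [auxA_nonneg (H := H) ξ, auxA_mul_one_add_norm_le (H := H) ξ, norm_nonneg ξ]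

theorem abs_coord_le (ξ : Eucl d) (i : Fin d) : |ξ i| ≤ ‖ξ‖ := by
  simpa using PiLp.norm_apply_le ξ i

variable [NeZero d]

@[simp] theorem norm_e₀ : ‖(e₀ : Eucl d)‖ = 1 := by simp [e₀]

theorem distCompl_eq (hO : openDualOrbit H = {ξ : Eucl d | ξ 0 ≠ 0}) (ξ : Eucl d) :
    distCompl H ξ = |ξ 0| := by
  have hc : (openDualOrbit H)ᶜ = {ξ : Eucl d | ξ 0 = 0} := by
    rw [hO]; ext η; simp
  rw [distCompl, hc]
  apply le_antisymm
  · have hmem : ξ - ξ 0 • e₀ ∈ {ξ : Eucl d | ξ 0 = 0} := by simp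
    refine (Metric.infDist_le_dist_of_mem hmem).trans ?_
    rw [dist_eq_norm, sub_sub_cancel, norm_smul, norm_e₀, mul_one, Real.norm_eq_abs]
  · refine (Metric.le_infDist ⟨0, by simp⟩).mpr fun η hη => ?_
    have hη' : η 0 = 0 := hη
    have := abs_coord_le (ξ - η) 0
    rwa [PiLp.sub_apply, hη', sub_zero, ← dist_eq_norm] at this

theorem norm_sub_coord (ξ : Eucl d) : ‖ξ‖ ^ 2 - |ξ 0| ^ 2 = ‖ξ - ξ 0 • e₀‖ ^ 2 := by
  have h1 : inner ℝ ξ (ξ 0 • (e₀ : Eucl d)) = ξ 0 ^ 2 := by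
    rw [inner_smul_right, e₀, EuclideanSpace.inner_single_right]
    simp [sq]
  rw [norm_sub_sq_real, h1, norm_smul, norm_e₀, mul_one, Real.norm_eq_abs, sq_abs]
  ring

theorem auxA_eq (hO : openDualOrbit H = {ξ : Eucl d | ξ 0 ≠ 0}) (ξ : Eucl d) :
    auxA H ξ = min (|ξ 0| / (1 + ‖ξ - ξ 0 • e₀‖)) (1 / (1 + ‖ξ‖)) := by
  rw [auxA, distCompl_eq hO, norm_sub_coord, Real.sqrt_sq (norm_nonneg _)]

theorem auxA_mul_le (hO : openDualOrbit H = {ξ : Eucl d | ξ 0 ≠ 0}) (ξ : Eucl d) :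
    auxA H ξ * (1 + ‖ξ - ξ 0 • e₀‖) ≤ |ξ 0| := by
  rw [auxA_eq hO, ← le_div_iff₀ (by positivity)]
  exact min_le_left _ _

theorem auxA_le_abs (hO : openDualOrbit H = {ξ : Eucl d | ξ 0 ≠ 0}) (ξ : Eucl d) :
    auxA H ξ ≤ |ξ 0| := by
  nlinarith [auxA_mul_le hO ξ, auxA_nonneg (H := H) ξ, norm_nonneg (ξ - ξ 0 • e₀)]

theorem auxA_mul_abs_le (ξ : Eucl d) : auxA H ξ * |ξ 0| ≤ 1 := by
  nlinarith [auxA_mul_one_add_norm_le (H := H) ξ, auxA_nonneg (H := H) ξ, abs_coord_le ξ 0]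

theorem auxA_pos (hO : openDualOrbit H = {ξ : Eucl d | ξ 0 ≠ 0}) {ξ : Eucl d} (hξ : ξ 0 ≠ 0) :
    0 < auxA H ξ := by
  rw [auxA_eq hO]
  exact lt_min (div_pos (abs_pos.mpr hξ) (by positivity)) (by positivity)

/-- Both terms of the minimum are at least `1/(2c²)`: the hypotheses give `|ξ₀| ≥ 1/c`, and the
denominators are at most `1 + c ≤ 2c`. -/
theorem le_auxA (hO : openDualOrbit H = {ξ : Eucl d | ξ 0 ≠ 0}) {ξ : Eucl d} {c : ℝ} (hc : 1 ≤ c)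
    (h0 : 1 ≤ |ξ 0| * c) (hn : ‖ξ‖ ≤ c) : 1 ≤ 2 * c ^ 2 * auxA H ξ := by
  have hsub : ‖ξ - ξ 0 • e₀‖ ≤ c := by
    refine le_trans ?_ hn
    rw [← sq_le_sq₀ (norm_nonneg _) (norm_nonneg _), ← norm_sub_coord]
    linarith [sq_nonneg |ξ 0|]
  have hc0 : 0 < c := by linarith
  rw [auxA_eq hO, ← div_le_iff₀' (by positivity)]
  refine le_min ?_ ?_
  · rw [div_le_div_iff₀ (by positivity) (by positivity), one_mul]
    have h1 : c ≤ |ξ 0| * c * c := by nlinarith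
    nlinarith [norm_nonneg (ξ - ξ 0 • e₀)]
  · rw [div_le_div_iff₀ (by positivity) (by positivity), one_mul, one_mul]
    nlinarith

/-- Powers of `|ξ₀|` are controlled by negative powers of `A(ξ)`. -/
theorem abs_rpow_mul_auxA_rpow_le (hO : openDualOrbit H = {ξ : Eucl d | ξ 0 ≠ 0}) {ξ : Eucl d}
    (hξ : ξ 0 ≠ 0) (b : ℝ) : |ξ 0| ^ b * auxA H ξ ^ |b| ≤ 1 := by
  have hp := abs_pos.mpr hξ
  have ha := auxA_pos hO hξ
  rcases le_total 0 b with hb | hb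
  · rw [abs_of_nonneg hb, ← Real.mul_rpow hp.le ha.le]
    exact Real.rpow_le_one (by positivity) (by rw [mul_comm]; exact auxA_mul_abs_le ξ) hb
  · rw [abs_of_nonpos hb]
    calc |ξ 0| ^ b * auxA H ξ ^ (-b) ≤ |ξ 0| ^ b * |ξ 0| ^ (-b) := by
          gcongr
          · linarith
          · exact auxA_le_abs hO ξ
      _ = 1 := by rw [← Real.rpow_add hp, add_neg_cancel, Real.rpow_zero]

end AuxiliaryFunction

/-! ### The norm estimate at the base point `e₀`. -/

section Estimates

variable {d : ℕ} [NeZero d] {H S D : DilationGroup d} {Y : Matrix (Fin d) (Fin d) ℝ}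
  {Λ : Eucl d →ₗ[ℝ] Matrix (Fin d) (Fin d) ℝ}

open scoped Matrix.Norms.L2Operator in
-- With `t = s^T e₀ - e₀` one has `s = 1 + Λ t`, where `Λ t` is linear in `t` and its `n`-th power
-- is zero.
theorem IsShearSection.exists_shear_bound (hΛ : IsShearSection S Λ)
    (hH : IsGeneralizedShearlet H S D Y) :
    ∃ C : ℝ, 0 < C ∧ ∀ s ∈ S,
      opNorm (s : Matrix (Fin d) (Fin d) ℝ) ≤
        C * (1 + ‖act (s : Matrix (Fin d) (Fin d) ℝ)ᵀ e₀ - e₀‖) ^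
          (nilpotencyClass (lieAlg S) - 1) ∧
      opNorm ((s⁻¹ : GL (Fin d) ℝ) : Matrix (Fin d) (Fin d) ℝ) ≤
        C * (1 + ‖act (s : Matrix (Fin d) (Fin d) ℝ)ᵀ e₀ - e₀‖) ^
          (nilpotencyClass (lieAlg S) - 1) := by
  set n := nilpotencyClass (lieAlg S) with hn
  have hn1 : 1 ≤ n := hΛ.one_le_nilpotencyClass hH
  have hn0 : (0 : ℝ) < n := by exact_mod_cast hn1
  set K : ℝ := ‖Λ.toContinuousLinearMap‖ with hK
  have hK0 : 0 ≤ K := norm_nonneg Λ.toContinuousLinearMap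
  refine ⟨n * (1 + K) ^ (n - 1), by positivity, fun s hs => ?_⟩
  set t : Eucl d := act (s : Matrix (Fin d) (Fin d) ℝ)ᵀ e₀ - e₀ with ht
  have hX : (s : Matrix (Fin d) (Fin d) ℝ) = 1 + Λ t := by
    have h1 : Λ e₀ = 1 := by
      have := hΛ.eq_of_mem S.one_mem
      simpa using this
    rw [ht, map_sub, hΛ.eq_of_mem hs, h1]
    abel
  have hXn : Λ t ^ n = 0 := by
    have h1 : Λ t ∈ shearSpan S := by
      have := sub_one_mem_shearSpan hs
      rwa [hX, add_sub_cancel_left] at this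
    have h2 := Submodule.pow_mem_pow _ h1 n
    rwa [hΛ.shearSpan_pow_nilpotencyClass hH, Submodule.mem_bot] at h2
  have hB : 1 + ‖Λ t‖ ≤ (1 + K) * (1 + ‖t‖) := by
    have h1 : ‖Λ t‖ ≤ K * ‖t‖ := Λ.toContinuousLinearMap.le_opNorm t
    nlinarith [norm_nonneg t]
  have := norm_unipotent_le hn1 hXn hX hB
  rwa [mul_pow, ← mul_assoc] at this

theorem IsGeneralizedShearlet.exists_norm_bound (hH : IsGeneralizedShearlet H S D Y)
    (hY : Y 0 0 = 1) (hΛ : IsShearSection S Λ) :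
    ∃ C : ℝ, 0 < C ∧ ∀ h : H,
      opNorm (mat h) * auxA H (orbitMap H h) ^
        ((nilpotencyClass (lieAlg S) : ℝ) - 1 + 2 * opNorm Y) ≤ C ∧
      opNorm (mat h⁻¹) * auxA H (orbitMap H h) ^
        ((nilpotencyClass (lieAlg S) : ℝ) - 1 + 2 * opNorm Y) ≤ C := by
  have hO := hΛ.openDualOrbit_eq hH hY
  obtain ⟨C, hC, hCs⟩ := hΛ.exists_shear_bound hH
  have hn1 := hΛ.one_le_nilpotencyClass hH
  set n := nilpotencyClass (lieAlg S) with hn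
  refine ⟨C * 2 ^ (n - 1), by positivity, fun h => ?_⟩
  obtain ⟨ε, hε, r, s, hs, heq⟩ := hH.exists_factor h.2
  change mat h = _ at heq
  have hεa : |ε| = 1 := by rcases hε with h | h <;> simp [h]
  have hεε : ε * ε = 1 := by rcases hε with h | h <;> simp [h]
  have h0 := hH.orbitMap_zero_of_factor hY hs heq
  have habs : |orbitMap H h 0| = Real.exp r := by
    rw [h0, abs_mul, hεa, one_mul, abs_of_pos (Real.exp_pos r)]
  set a := auxA H (orbitMap H h) with ha
  set t : Eucl d := act (s : Matrix (Fin d) (Fin d) ℝ)ᵀ e₀ - e₀ with ht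
  have ha0 : 0 < a := auxA_pos hO (hH.orbitMap_zero_ne_zero hY h)
  -- Both terms of the minimum contribute: `a ≤ |ξ₀|` handles `r < 0`, and `a |ξ₀| ≤ 1` handles `r ≥
  -- 0`.
  have har : a ≤ Real.exp (-|r|) := by
    rcases abs_cases r with ⟨h1, -⟩ | ⟨h1, -⟩
    · rw [h1, Real.exp_neg, ← habs, ← one_div, le_div_iff₀ (by rw [habs]; positivity)]
      exact auxA_mul_abs_le _
    · rw [h1, neg_neg, ← habs]
      exact auxA_le_abs hO _
  -- The component of `h^T e₀` orthogonal to `e₀` has length `exp r · ‖t‖` and is compared with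
  -- `|ξ₀| = exp r`, so `a ‖t‖ ≤ 1`; adding `a ≤ 1` gives the constant `2`.
  have hat : a * (1 + ‖t‖) ≤ 2 := by
    have h1 := auxA_mul_le hO (orbitMap H h)
    have hsub : orbitMap H h - orbitMap H h 0 • e₀ = (ε * Real.exp r) • t := by
      rw [h0, orbitMap_of_factor hY heq, ← smul_sub]
    rw [hsub, norm_smul, Real.norm_eq_abs, ← h0, habs, ← ha] at h1
    have h2 : a * ‖t‖ ≤ 1 := by
      have h3 : Real.exp r * (a * ‖t‖) ≤ Real.exp r * 1 := by nlinarith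
      exact le_of_mul_le_mul_left h3 (Real.exp_pos r)
    linarith [auxA_le_one (H := H) (orbitMap H h)]
  have hmain : Real.exp (|r| * opNorm Y) * (C * (1 + ‖t‖) ^ (n - 1)) *
      a ^ ((n : ℝ) - 1 + 2 * opNorm Y) ≤ C * 2 ^ (n - 1) := by
    have hy := opNorm_nonneg Y
    -- The factor `a ^ (n - 1)` absorbs the shear and one factor `a ^ ‖Y‖` absorbs the dilation; the
    -- second factor `a ^ ‖Y‖` is only bounded by one.
    have e1 : a ^ ((n : ℝ) - 1 + 2 * opNorm Y) = a ^ (n - 1) * (a ^ opNorm Y * a ^ opNorm Y) := by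
      rw [← Real.rpow_add ha0, ← Real.rpow_natCast, ← Real.rpow_add ha0, Nat.cast_sub hn1]
      congr 1
      push_cast
      ring
    have e2 : a ^ opNorm Y ≤ 1 := Real.rpow_le_one ha0.le (auxA_le_one _) hy
    have e3 : Real.exp (|r| * opNorm Y) * a ^ opNorm Y ≤ 1 := by
      calc Real.exp (|r| * opNorm Y) * a ^ opNorm Y
          ≤ Real.exp (|r| * opNorm Y) * Real.exp (-|r|) ^ opNorm Y := by gcongr
        _ = 1 := by rw [← Real.exp_mul, ← Real.exp_add]; simp
    have e4 : (a * (1 + ‖t‖)) ^ (n - 1) ≤ 2 ^ (n - 1) := by gcongr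
    rw [e1]
    calc Real.exp (|r| * opNorm Y) * (C * (1 + ‖t‖) ^ (n - 1)) *
          (a ^ (n - 1) * (a ^ opNorm Y * a ^ opNorm Y))
        = C * (a * (1 + ‖t‖)) ^ (n - 1) * (Real.exp (|r| * opNorm Y) * a ^ opNorm Y) *
          a ^ opNorm Y := by rw [mul_pow]; ring
      _ ≤ C * 2 ^ (n - 1) * 1 * 1 := by gcongr
      _ = C * 2 ^ (n - 1) := by ring
  have hinv : mat h⁻¹ = ε • (((s⁻¹ : GL (Fin d) ℝ) : Matrix (Fin d) (Fin d) ℝ) * dil Y (-r)) := by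
    refine left_inv_eq_right_inv (a := mat h) ?_ ?_
    · rw [mat, mat, ← Units.val_mul, ← Subgroup.coe_mul, inv_mul_cancel, Subgroup.coe_one,
        Units.val_one]
    · rw [heq, smul_mul_smul_comm, hεε, one_smul, mul_assoc, ← mul_assoc _ _ (dil Y (-r)),
        ← Units.val_mul, mul_inv_cancel, Units.val_one, one_mul, ← dil_add, add_neg_cancel,
        dil_zero]
  have hapos : 0 ≤ a ^ ((n : ℝ) - 1 + 2 * opNorm Y) := by positivity
  constructor
  · refine le_trans (mul_le_mul_of_nonneg_right ?_ hapos) hmain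
    rw [heq, opNorm_smul_of_abs_eq_one hεa]
    refine (opNorm_mul_le _ _).trans ?_
    exact mul_le_mul (opNorm_dil_le hH.generator_isDiag r) (hCs s hs).1 (opNorm_nonneg _)
      (Real.exp_pos _).le
  · refine le_trans (mul_le_mul_of_nonneg_right ?_ hapos) hmain
    rw [hinv, opNorm_smul_of_abs_eq_one hεa, mul_comm (Real.exp _)]
    refine (opNorm_mul_le _ _).trans ?_
    have := opNorm_dil_le hH.generator_isDiag (-r)
    rw [abs_neg] at this
    exact mul_le_mul (hCs s hs).2 this (opNorm_nonneg _) (by positivity)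

end Estimates

end Shearlet

end
noncomputable section

namespace Shearlet

/-! ### Polynomial growth of powers of unipotent matrices. -/

section Growth

variable {d : ℕ}

open scoped Matrix.Norms.L2Operator in
/-- The powers of a unipotent matrix grow polynomially. -/
theorem exists_opNorm_pow_le {X : Matrix (Fin d) (Fin d) ℝ} {n : ℕ} (hX : X ^ n = 0) :
    ∃ C : ℝ, 0 < C ∧ ∀ k : ℕ, opNorm ((1 + X) ^ k) ≤ C * ((k : ℝ) + 1) ^ (n + 1) := by
  refine ⟨(1 + ‖X‖) ^ n, by positivity, fun k => ?_⟩
  have hterm : ∀ j ∈ Finset.range (k + 1),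
      ‖(1 : Matrix (Fin d) (Fin d) ℝ) ^ j * X ^ (k - j) * (k.choose j : Matrix (Fin d) (Fin d) ℝ)‖
        ≤ ((k : ℝ) + 1) ^ n * (1 + ‖X‖) ^ n := by
    intro j hj
    have hjk : j ≤ k := by have := Finset.mem_range.mp hj; omega
    rw [one_pow, one_mul, ← nsmul_eq_mul', ← Nat.cast_smul_eq_nsmul ℝ, norm_smul,
      Real.norm_of_nonneg (Nat.cast_nonneg _)]
    -- In the binomial expansion only the powers of `X` below `n` survive, and their binomial
    -- coefficients are at most `(k + 1) ^ n`.
    by_cases hn : n ≤ k - j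
    · rw [← Nat.sub_add_cancel hn, pow_add, hX, mul_zero, norm_zero, mul_zero]
      positivity
    · push Not at hn
      refine mul_le_mul ?_ ?_ (norm_nonneg _) (by positivity)
      · rw [← Nat.choose_symm hjk]
        calc ((k.choose (k - j) : ℕ) : ℝ) ≤ ((k ^ (k - j) : ℕ) : ℝ) := by
              exact_mod_cast Nat.choose_le_pow k (k - j)
          _ ≤ ((k : ℝ) + 1) ^ (k - j) := by push_cast; gcongr; linarith
          _ ≤ ((k : ℝ) + 1) ^ n := pow_le_pow_right₀ (by linarith [Nat.cast_nonneg (α := ℝ) k]) hn.le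
      · refine le_trans ?_ (pow_le_pow_right₀ (by linarith [norm_nonneg X]) hn.le)
        rcases Nat.eq_zero_or_pos (k - j) with h0 | hpos
        · rw [h0, pow_zero, pow_zero]; exact opNorm_one_le
        · exact (norm_pow_le' _ hpos).trans (by gcongr; linarith)
  rw [opNorm_eq_norm, (Commute.one_left X).add_pow]
  refine (norm_sum_le_of_le _ hterm).trans (le_of_eq ?_)
  rw [Finset.sum_const, Finset.card_range, nsmul_eq_mul]
  push_cast
  ring

theorem le_one_of_pow_le_polynomial {x C : ℝ} {N : ℕ}
    (h : ∀ k : ℕ, x ^ k ≤ C * ((k : ℝ) + 1) ^ N) : x ≤ 1 := by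
  by_contra! hx
  have hx0 : 0 < x := by linarith
  have h1 := ((tendsto_pow_const_div_const_pow_of_one_lt N hx).comp
    (Filter.tendsto_add_atTop_nat 1)).const_mul C
  rw [mul_zero] at h1
  have h2 : x⁻¹ ≤ 0 := by
    refine ge_of_tendsto h1 (Filter.Eventually.of_forall fun k => ?_)
    have := h k
    simp only [Function.comp_apply]
    push_cast
    rw [← mul_div_assoc, le_div_iff₀ (by positivity), pow_succ', ← mul_assoc,
      inv_mul_cancel₀ hx0.ne', one_mul]
    exact this
  exact absurd h2 (not_le.mpr (inv_pos.mpr hx0))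

end Growth

/-! ### Haar measure and the modular function in orbit coordinates. -/

section Haar

variable {d : ℕ} {H S D : DilationGroup d} {Y : Matrix (Fin d) (Fin d) ℝ}
  {Λ : Eucl d →ₗ[ℝ] Matrix (Fin d) (Fin d) ℝ}

instance secondCountableTopology : SecondCountableTopology H :=
  haveI : SecondCountableTopology (Matrix (Fin d) (Fin d) ℝ) :=
    inferInstanceAs (SecondCountableTopology (Fin d → Fin d → ℝ))
  isEmbedding_mat.secondCountableTopology

variable [NeZero d]

/-- The measure `|ξ₀|^{-τ} dξ`. -/
def orbitMeasure (d : ℕ) [NeZero d] (τ : ℝ) : Measure (Eucl d) :=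
  (volume : Measure (Eucl d)).withDensity fun ξ => ENNReal.ofReal (|ξ 0| ^ (-τ))

theorem measurable_orbitDensity (τ : ℝ) :
    Measurable fun ξ : Eucl d => ENNReal.ofReal (|ξ 0| ^ (-τ)) := by
  have h : Measurable fun ξ : Eucl d => |ξ 0| := (continuous_coord 0).abs.measurable
  exact (h.pow_const _).ennreal_ofReal

theorem map_orbitMeasure {g : GL (Fin d) ℝ} {c : ℝ} (hc : c ≠ 0)
    (hg : ∀ ξ : Eucl d, act (g : Matrix (Fin d) (Fin d) ℝ) ξ 0 = c * ξ 0) (τ : ℝ) :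
    Measure.map (act (g : Matrix (Fin d) (Fin d) ℝ)) (orbitMeasure d τ) =
      ENNReal.ofReal (|c| ^ τ * |(g : Matrix (Fin d) (Fin d) ℝ).det|⁻¹) • orbitMeasure d τ := by
  have hc' : 0 < |c| := abs_pos.mpr hc
  have hm : Measurable (act (g : Matrix (Fin d) (Fin d) ℝ)) := (continuous_act _).measurable
  refine Measure.ext_of_lintegral _ fun f hf => ?_
  rw [lintegral_map hf hm, lintegral_smul_measure, orbitMeasure,
    lintegral_withDensity_eq_lintegral_mul _ (measurable_orbitDensity τ)
      (show Measurable fun ξ => f (act _ ξ) from hf.comp hm),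
    lintegral_withDensity_eq_lintegral_mul _ (measurable_orbitDensity τ) hf]
  have h1 : ∀ ξ : Eucl d, ((fun ξ : Eucl d => ENNReal.ofReal (|ξ 0| ^ (-τ))) *
      fun ξ => f (act (g : Matrix (Fin d) (Fin d) ℝ) ξ)) ξ =
      ENNReal.ofReal (|c| ^ τ) * ((fun ξ : Eucl d => ENNReal.ofReal (|ξ 0| ^ (-τ))) * f)
        (act (g : Matrix (Fin d) (Fin d) ℝ) ξ) := by
    intro ξ
    simp only [Pi.mul_apply]
    rw [hg, abs_mul, Real.mul_rpow hc'.le (abs_nonneg _), ← mul_assoc, ← ENNReal.ofReal_mul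
      (by positivity), ← mul_assoc, ← Real.rpow_add hc', add_neg_cancel, Real.rpow_zero, one_mul]
  have h2 := lintegral_comp_act g ((fun ξ : Eucl d => ENNReal.ofReal (|ξ 0| ^ (-τ))) * f) Set.univ
  simp only [Set.preimage_univ, Measure.restrict_univ] at h2
  simp only [h1]
  rw [lintegral_const_mul' _ _ ENNReal.ofReal_ne_top, h2, ← mul_assoc,
    ← ENNReal.ofReal_mul (by positivity), smul_eq_mul]

/-- The pull-back of `|ξ₀|^{-τ} dξ` under the orbit map. -/
def pullbackMeasure (H : DilationGroup d) (τ : ℝ) : Measure H :=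
  (orbitMeasure d τ).comap (orbitMap H)

theorem continuous_orbitMap : Continuous (orbitMap H) := continuous_act_mat e₀

theorem pullbackMeasure_apply (hp : IsOpenEmbedding (orbitMap H)) (τ : ℝ) (E : Set H) :
    pullbackMeasure H τ E = ∫⁻ ξ in orbitMap H '' E, ENNReal.ofReal (|ξ 0| ^ (-τ)) := by
  rw [pullbackMeasure, hp.measurableEmbedding.comap_apply, orbitMeasure, withDensity_apply']

theorem lintegral_pullbackMeasure (hp : IsOpenEmbedding (orbitMap H)) (τ : ℝ)
    {f : Eucl d → ℝ≥0∞} (hf : Measurable f) :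
    ∫⁻ h, f (orbitMap H h) ∂(pullbackMeasure H τ) =
      ∫⁻ ξ in Set.range (orbitMap H), ENNReal.ofReal (|ξ 0| ^ (-τ)) * f ξ := by
  rw [← hp.measurableEmbedding.lintegral_map, pullbackMeasure, hp.measurableEmbedding.map_comap,
    orbitMeasure, restrict_withDensity hp.isOpen_range.measurableSet,
    lintegral_withDensity_eq_lintegral_mul _ (measurable_orbitDensity τ) hf]
  rfl

/-- A transformation of `H` that is linear in the coordinates of the orbit scales the pull-back of
`|ξ₀|^{-τ} dξ`. -/
theorem map_pullbackMeasure (hp : IsOpenEmbedding (orbitMap H))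
    (hr : Set.range (orbitMap H) = {ξ : Eucl d | ξ 0 ≠ 0}) {g : GL (Fin d) ℝ} {c : ℝ} (hc : c ≠ 0)
    (hg : ∀ ξ : Eucl d, act (g : Matrix (Fin d) (Fin d) ℝ) ξ 0 = c * ξ 0) (τ : ℝ)
    {T : H → H} (hT : Measurable T)
    (hTg : ∀ h, orbitMap H (T h) = act (g : Matrix (Fin d) (Fin d) ℝ) (orbitMap H h)) :
    Measure.map T (pullbackMeasure H τ) =
      ENNReal.ofReal (|c| ^ τ * |(g : Matrix (Fin d) (Fin d) ℝ).det|⁻¹) • pullbackMeasure H τ := by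
  have he : MeasurableEmbedding (act (g : Matrix (Fin d) (Fin d) ℝ)) :=
    (actEquiv g).toHomeomorph.measurableEmbedding
  have hpre : act (g : Matrix (Fin d) (Fin d) ℝ) ⁻¹' Set.range (orbitMap H) =
      Set.range (orbitMap H) := by
    rw [hr]
    ext ξ
    simp [hg, hc]
  have hpm := hp.measurableEmbedding
  -- Pushing forward along the injective orbit map moves the identity to `ℝ^d`, where `T` becomes
  -- the linear map `g`.
  rw [← hpm.comap_map (Measure.map T (pullbackMeasure H τ)), Measure.map_map hpm.measurable hT]
  have h1 : orbitMap H ∘ T = act (g : Matrix (Fin d) (Fin d) ℝ) ∘ orbitMap H := funext hTg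
  rw [h1, ← Measure.map_map he.measurable hpm.measurable]
  nth_rewrite 1 [pullbackMeasure]
  rw [hpm.map_comap]
  nth_rewrite 1 [← hpre]
  rw [← he.restrict_map, map_orbitMeasure hc hg, ← hpm.map_comap, hpm.comap_map]
  ext E hE
  rw [pullbackMeasure, hpm.comap_apply, Measure.smul_apply, Measure.smul_apply, hpm.comap_apply]

theorem IsGeneralizedShearlet.abs_det_mat (hH : IsGeneralizedShearlet H S D Y) (hY : Y 0 0 = 1)
    (h : H) : |(mat h).det| = |orbitMap H h 0| ^ Y.trace := by
  obtain ⟨ε, hε, r, s, hs, heq⟩ := hH.exists_factor h.2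
  change mat h = _ at heq
  have hεa : |ε| = 1 := by rcases hε with h | h <;> simp [h]
  rw [hH.orbitMap_zero_of_factor hY hs heq, heq, Matrix.det_smul, Matrix.det_mul, det_dil,
    (hH.shear_unipotent s hs).det_eq_one, abs_mul, abs_mul, abs_pow, hεa, one_pow, one_mul,
    abs_one, mul_one, abs_mul, hεa, one_mul, abs_of_pos (Real.exp_pos _), abs_of_pos (Real.exp_pos _), ← Real.exp_mul]

/-- Right translation by `g` is the linear map `g^T` on the orbit. Its Jacobian has absolute value
`|(g^T e₀)₀| ^ trace Y`, which is exactly what the density `|ξ₀|^{-trace Y}` compensates. -/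
theorem IsShearSection.isMulRightInvariant (hΛ : IsShearSection S Λ)
    (hH : IsGeneralizedShearlet H S D Y) (hY : Y 0 0 = 1) :
    (pullbackMeasure H Y.trace).IsMulRightInvariant := by
  refine ⟨fun g => ?_⟩
  have hc := hH.orbitMap_zero_ne_zero hY g
  rw [map_pullbackMeasure (hΛ.isOpenEmbedding_orbitMap hH hY) (hΛ.range_orbitMap hH hY)
    (g := transposeGL g) hc (hH.act_transpose_zero hY g) Y.trace
    (continuous_mul_const g).measurable (fun h => orbitMap_mul h g)]
  have h1 : |((transposeGL (g : GL (Fin d) ℝ) : GL (Fin d) ℝ) : Matrix (Fin d) (Fin d) ℝ).det| =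
      |orbitMap H g 0| ^ Y.trace := by
    rw [← hH.abs_det_mat hY, ← Matrix.det_transpose (mat g)]
    rfl
  have h2 : 0 < |orbitMap H g 0| := abs_pos.mpr hc
  rw [h1, mul_inv_cancel₀ (by positivity), ENNReal.ofReal_one, one_smul]

theorem pullbackMeasure_le (hp : IsOpenEmbedding (orbitMap H)) (τ : ℝ) {E : Set H} {M R : ℝ}
    (hM : ∀ h ∈ E, |orbitMap H h 0| ^ (-τ) ≤ M) (hR : ∀ h ∈ E, ‖orbitMap H h‖ ≤ R) :
    pullbackMeasure H τ E ≤ ENNReal.ofReal M * volume (Metric.closedBall (0 : Eucl d) R) := by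
  rw [pullbackMeasure_apply hp]
  calc ∫⁻ ξ in orbitMap H '' E, ENNReal.ofReal (|ξ 0| ^ (-τ))
      ≤ ∫⁻ _ in orbitMap H '' E, ENNReal.ofReal M := by
        refine setLIntegral_mono measurable_const ?_
        rintro _ ⟨h, hh, rfl⟩
        exact ENNReal.ofReal_le_ofReal (hM h hh)
    _ ≤ ENNReal.ofReal M * volume (Metric.closedBall (0 : Eucl d) R) := by
        rw [setLIntegral_const]
        gcongr
        rintro _ ⟨h, hh, rfl⟩
        simpa using hR h hh

theorem exists_orbitMap_bounds (h0 : ∀ h : H, orbitMap H h 0 ≠ 0) (τ : ℝ) {K : Set H}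
    (hK : IsCompact K) : ∃ M R : ℝ, (∀ h ∈ K, |orbitMap H h 0| ^ (-τ) ≤ M) ∧
      (∀ h ∈ K, opNorm (mat h) ≤ R) := by
  have h1 : Continuous fun h : H => |orbitMap H h 0| ^ (-τ) :=
    ((continuous_coord 0).comp continuous_orbitMap).abs.rpow_const
      fun h => Or.inl (abs_ne_zero.mpr (h0 h))
  have h2 : Continuous fun h : H => opNorm (mat h) := continuous_opNorm.comp continuous_mat
  obtain ⟨M, hM⟩ := hK.bddAbove_image h1.continuousOn
  obtain ⟨R, hR⟩ := hK.bddAbove_image h2.continuousOn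
  exact ⟨M, R, fun h hh => hM ⟨h, hh, rfl⟩, fun h hh => hR ⟨h, hh, rfl⟩⟩

theorem norm_orbitMap_le (h : H) : ‖orbitMap H h‖ ≤ opNorm (mat h) := by
  have := norm_act_le (mat h)ᵀ e₀
  rwa [norm_e₀, mul_one, opNorm_transpose] at this

theorem IsShearSection.pullbackMeasure_ne_top (hΛ : IsShearSection S Λ)
    (hH : IsGeneralizedShearlet H S D Y) (hY : Y 0 0 = 1) (τ : ℝ) {K : Set H} (hK : IsCompact K) :
    pullbackMeasure H τ K ≠ ∞ := by
  obtain ⟨M, R, hM, hR⟩ := exists_orbitMap_bounds (hH.orbitMap_zero_ne_zero hY) τ hK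
  refine ((pullbackMeasure_le (hΛ.isOpenEmbedding_orbitMap hH hY) τ hM
    (fun h hh => (norm_orbitMap_le h).trans (hR h hh))).trans_lt ?_).ne
  exact ENNReal.mul_lt_top ENNReal.ofReal_lt_top measure_closedBall_lt_top

theorem IsShearSection.pullbackMeasure_ne_zero (hΛ : IsShearSection S Λ)
    (hH : IsGeneralizedShearlet H S D Y) (hY : Y 0 0 = 1) (τ : ℝ) {K : Set H}
    (hK : (interior K).Nonempty) : pullbackMeasure H τ K ≠ 0 := by
  have hp := hΛ.isOpenEmbedding_orbitMap hH hY
  intro h0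
  have h1 : pullbackMeasure H τ (interior K) = 0 := measure_mono_null interior_subset h0
  rw [pullbackMeasure, hp.measurableEmbedding.comap_apply, orbitMeasure,
    withDensity_apply_eq_zero (measurable_orbitDensity τ)] at h1
  have h2 : orbitMap H '' interior K ⊆
      {ξ : Eucl d | ENNReal.ofReal (|ξ 0| ^ (-τ)) ≠ 0} ∩ orbitMap H '' interior K := by
    refine Set.subset_inter ?_ le_rfl
    rintro _ ⟨h, -, rfl⟩
    have := abs_pos.mpr (hH.orbitMap_zero_ne_zero hY h)
    rw [Set.mem_ofPred_eq, ENNReal.ofReal_ne_zero_iff]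
    positivity
  exact ((hp.isOpenMap _ isOpen_interior).measure_pos volume (hK.image _)).ne'
    (measure_mono_null h2 h1)

theorem IsShearSection.isHaarMeasure_inv (hΛ : IsShearSection S Λ)
    (hH : IsGeneralizedShearlet H S D Y) (hY : Y 0 0 = 1) :
    (pullbackMeasure H Y.trace).inv.IsHaarMeasure := by
  have := hΛ.isMulRightInvariant hH hY
  obtain ⟨K, hK, hK1⟩ := exists_compact_mem_nhds (1 : H)
  have hint : (interior K⁻¹).Nonempty :=
    ⟨1, mem_interior_iff_mem_nhds.mpr (inv_mem_nhds_one H hK1)⟩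
  refine Measure.isHaarMeasure_of_isCompact_nonempty_interior _ K hK
    ⟨1, mem_interior_iff_mem_nhds.mpr hK1⟩ ?_ ?_
  · rw [Measure.inv_apply]
    exact hΛ.pullbackMeasure_ne_zero hH hY _ hint
  · rw [Measure.inv_apply]
    exact hΛ.pullbackMeasure_ne_top hH hY _ hK.inv

theorem IsShearSection.exists_haarH_eq (hΛ : IsShearSection S Λ)
    (hH : IsGeneralizedShearlet H S D Y) (hY : Y 0 0 = 1) :
    ∃ c : ℝ≥0, haarH H = c • (pullbackMeasure H Y.trace).inv := by
  have := hΛ.isHaarMeasure_inv hH hY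
  exact ⟨_, Measure.isMulLeftInvariant_eq_smul _ _⟩

/-- Left translations scale the right Haar measure by the modular character. -/
theorem IsShearSection.map_mul_left_pullbackMeasure (hΛ : IsShearSection S Λ)
    (hH : IsGeneralizedShearlet H S D Y) (hY : Y 0 0 = 1) (g : H) :
    Measure.map (g⁻¹ * ·) (pullbackMeasure H Y.trace) =
      Measure.modularCharacter g • pullbackMeasure H Y.trace := by
  have := hΛ.isHaarMeasure_inv hH hY
  have h1 : Measure.map (· * g) (pullbackMeasure H Y.trace).inv =
      Measure.modularCharacter g • (pullbackMeasure H Y.trace).inv := by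
    have : Measure.modularCharacter g = Measure.modularCharacterFun g := rfl
    rw [this, Measure.modularCharacterFun_eq_haarScalarFactor (pullbackMeasure H Y.trace).inv g]
    exact Measure.isMulLeftInvariant_eq_smul _ _
  have h2 := congrArg Measure.inv h1
  have hmi : Measurable (Inv.inv : H → H) := continuous_inv.measurable
  have hmr : Measurable (· * g) := (continuous_mul_const g).measurable
  rw [Measure.inv, Measure.inv, Measure.map_map hmr hmi, Measure.map_map hmi (hmr.comp hmi),
    Measure.inv, Measure.map_smul, Measure.map_map hmi hmi] at h2
  have h3 : (Inv.inv ∘ (· * g) ∘ Inv.inv : H → H) = (g⁻¹ * ·) := by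
    ext1 h; simp
  have h4 : (Inv.inv ∘ Inv.inv : H → H) = id := by ext1 h; simp
  rwa [h3, h4, Measure.map_id] at h2

theorem IsShearSection.pullbackMeasure_preimage (hΛ : IsShearSection S Λ)
    (hH : IsGeneralizedShearlet H S D Y) (hY : Y 0 0 = 1) (g : H) {K : Set H} (hK : IsClosed K) :
    pullbackMeasure H Y.trace ((g⁻¹ * ·) ⁻¹' K) =
      Measure.modularCharacter g * pullbackMeasure H Y.trace K := by
  rw [← Measure.map_apply (continuous_const_mul _).measurable hK.measurableSet,
    hΛ.map_mul_left_pullbackMeasure hH hY, Measure.smul_apply]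
  rfl

/-- Left translation by `exp(-rY)` is the scalar `exp(-r)` on the orbit, because `e₀` is an
eigenvector of `Y`; so its effect on the right Haar measure can be read off. -/
theorem IsShearSection.modularCharacter_dil (hΛ : IsShearSection S Λ)
    (hH : IsGeneralizedShearlet H S D Y) (hY : Y 0 0 = 1) (r : ℝ) :
    (Measure.modularCharacter (⟨dilGL Y r, hH.dilGL_mem r⟩ : H) : ℝ) =
      Real.exp (r * (d - Y.trace)) := by
  obtain ⟨K, hK, hK1⟩ := exists_compact_mem_nhds (1 : H)
  have hKne := hΛ.pullbackMeasure_ne_zero hH hY Y.trace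
    (K := K) ⟨1, mem_interior_iff_mem_nhds.mpr hK1⟩
  have hKtop := hΛ.pullbackMeasure_ne_top hH hY Y.trace hK
  set g : H := ⟨dilGL Y r, hH.dilGL_mem r⟩ with hg
  let c : ℝˣ := Units.mk0 (Real.exp (-r)) (Real.exp_pos _).ne'
  let G : GL (Fin d) ℝ := Units.map (algebraMap ℝ (Matrix (Fin d) (Fin d) ℝ)).toMonoidHom c
  have hG : (G : Matrix (Fin d) (Fin d) ℝ) = Real.exp (-r) • 1 := Algebra.algebraMap_eq_smul_one _
  have hact : ∀ ξ : Eucl d, act (G : Matrix (Fin d) (Fin d) ℝ) ξ = Real.exp (-r) • ξ := by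
    intro ξ
    rw [hG, smul_act, act_one]
  have h1 := map_pullbackMeasure (hΛ.isOpenEmbedding_orbitMap hH hY) (hΛ.range_orbitMap hH hY)
    (g := G) (c := Real.exp (-r)) (Real.exp_pos _).ne' (fun ξ => by rw [hact]; simp) Y.trace
    (T := (g⁻¹ * ·)) (continuous_const_mul _).measurable (fun h => by
      have h2 : orbitMap H g⁻¹ = Real.exp (-r) • e₀ := by
        rw [orbitMap]
        change act (dil Y (-r))ᵀ e₀ = _
        rw [transpose_dil, act_dil_e₀ hY]
      rw [orbitMap_mul, h2, act_smul, hact]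
      rfl)
  rw [hΛ.map_mul_left_pullbackMeasure hH hY] at h1
  have h2 := congrArg (fun μ : Measure H => μ K) h1
  simp only [Measure.smul_apply] at h2
  change (Measure.modularCharacter g : ℝ≥0∞) * _ = _ * _ at h2
  have h3 := (ENNReal.mul_left_inj hKne hKtop).mp h2
  have h4 := congrArg ENNReal.toReal h3
  have hdet : (G : Matrix (Fin d) (Fin d) ℝ).det = Real.exp (-r) ^ d := by
    rw [hG, Matrix.det_smul, Matrix.det_one, mul_one, Fintype.card_fin]
  rw [ENNReal.coe_toReal, ENNReal.toReal_ofReal (by positivity), hdet,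
    abs_of_pos (Real.exp_pos _), abs_of_pos (by positivity), ← Real.exp_nat_mul, ← Real.exp_neg,
    ← Real.exp_mul, ← Real.exp_add] at h4
  rw [h4]
  congr 1
  ring

/-- The translate `s ^ k K'` has right Haar measure `χ(s)^k` times that of `K'`, where `χ` is the
modular character. Its image in the orbit lies in a ball of radius polynomial in `k`, on which the
density is bounded since shears fix `ξ₀`. So `χ(s)^k` grows at most polynomially. -/
theorem IsShearSection.modularCharacter_shear_le (hΛ : IsShearSection S Λ)
    (hH : IsGeneralizedShearlet H S D Y) (hY : Y 0 0 = 1) {s : H} (hs : (s : GL (Fin d) ℝ) ∈ S) :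
    (Measure.modularCharacter s : ℝ) ≤ 1 := by
  obtain ⟨K, hK, hK1⟩ := exists_compact_mem_nhds (1 : H)
  obtain ⟨K', hK', hK'1, hK'c⟩ : ∃ K' : Set H, IsCompact K' ∧ K' ∈ 𝓝 (1 : H) ∧ IsClosed K' :=
    ⟨closure K, hK.closure, Filter.mem_of_superset hK1 subset_closure, isClosed_closure⟩
  have hKne := hΛ.pullbackMeasure_ne_zero hH hY Y.trace
    (K := K') ⟨1, mem_interior_iff_mem_nhds.mpr hK'1⟩
  have hKtop := hΛ.pullbackMeasure_ne_top hH hY Y.trace hK'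
  have hpos : 0 < (pullbackMeasure H Y.trace K').toReal := ENNReal.toReal_pos hKne hKtop
  obtain ⟨M, R, hM, hR⟩ := exists_orbitMap_bounds (hH.orbitMap_zero_ne_zero hY) Y.trace hK'
  have hM0 : 0 ≤ M := le_trans (by positivity) (hM 1 (mem_of_mem_nhds hK'1))
  have hR0 : 0 ≤ R := le_trans (opNorm_nonneg _) (hR 1 (mem_of_mem_nhds hK'1))
  obtain ⟨C, hC, hCk⟩ := exists_opNorm_pow_le (X := mat s - 1) (n := d) (by
    have := pow_le_strictUpper (hH.shearSpan_le) d
      (Submodule.pow_mem_pow _ (sub_one_mem_shearSpan hs) d)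
    rwa [strictUpper_eq_bot, Submodule.mem_bot] at this)
  rw [add_sub_cancel] at hCk
  set V : ℝ := (volume (Metric.ball (0 : Eucl d) 1)).toReal with hV
  have hs0 : ∀ k : ℕ, |orbitMap H (s ^ k) 0| = 1 := by
    intro k
    have h1 : (((s ^ k : H) : GL (Fin d) ℝ)) ∈ S := by
      rw [Subgroup.coe_pow]; exact S.pow_mem hs k
    have h2 := (hH.shear_unipotent _ h1).act_transpose_zero e₀
    rw [orbitMap]
    change |act (((s ^ k : H) : GL (Fin d) ℝ) : Matrix (Fin d) (Fin d) ℝ)ᵀ e₀ 0| = 1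
    rw [h2, e₀_apply_zero, abs_one]
  have hmul0 : ∀ g h : H, orbitMap H (g * h) 0 = orbitMap H h 0 * orbitMap H g 0 := by
    intro g h
    rw [orbitMap_mul, hH.act_transpose_zero hY]
  -- The radius is `R C (k + 1) ^ (d + 1)`, and a ball in `ℝ^d` has volume proportional to the
  -- `d`-th power of its radius.
  refine le_one_of_pow_le_polynomial
    (C := M * (R * C) ^ d * V / (pullbackMeasure H Y.trace K').toReal) (N := (d + 1) * d) fun k => ?_
  have hE := hΛ.pullbackMeasure_preimage hH hY (s ^ k) hK'c
  have hle := pullbackMeasure_le (hΛ.isOpenEmbedding_orbitMap hH hY) Y.trace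
    (E := ((s ^ k)⁻¹ * ·) ⁻¹' K') (M := M) (R := R * (C * ((k : ℝ) + 1) ^ (d + 1))) (by
      intro h hh
      have h1 := hM _ hh
      have h2 : orbitMap H h 0 = orbitMap H ((s ^ k)⁻¹ * h) 0 * orbitMap H (s ^ k) 0 := by
        rw [← hmul0, mul_inv_cancel_left]
      rwa [h2, abs_mul, hs0, mul_one]) (by
      intro h hh
      have h1 := hR _ hh
      have h2 : orbitMap H h = act (mat ((s ^ k)⁻¹ * h))ᵀ (orbitMap H (s ^ k)) := by
        rw [← orbitMap_mul, mul_inv_cancel_left]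
      rw [h2]
      refine (norm_act_le _ _).trans ?_
      rw [opNorm_transpose]
      refine mul_le_mul h1 ((norm_orbitMap_le _).trans ?_) (norm_nonneg _) hR0
      have h3 : mat (s ^ k) = mat s ^ k := by
        rw [mat, mat, Subgroup.coe_pow, Units.val_pow_eq_pow_val]
      rw [h3]
      exact hCk k)
  rw [hE, map_pow, Measure.addHaar_closedBall _ _ (by positivity), finrank_euclideanSpace_fin] at hle
  have hle' := ENNReal.toReal_mono (by
    exact (ENNReal.mul_lt_top ENNReal.ofReal_lt_top
      (ENNReal.mul_lt_top ENNReal.ofReal_lt_top measure_ball_lt_top)).ne) hle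
  rw [ENNReal.toReal_mul, ENNReal.toReal_mul, ENNReal.toReal_mul, ENNReal.coe_toReal,
    ENNReal.toReal_ofReal hM0, ENNReal.toReal_ofReal (by positivity), NNReal.coe_pow] at hle'
  rw [div_mul_eq_mul_div, le_div_iff₀ hpos]
  refine hle'.trans (le_of_eq ?_)
  rw [← hV, pow_mul, ← mul_assoc R, mul_pow]
  generalize (((k : ℝ) + 1) ^ (d + 1)) ^ d = q
  ring

theorem IsShearSection.modularCharacter_shear (hΛ : IsShearSection S Λ)
    (hH : IsGeneralizedShearlet H S D Y) (hY : Y 0 0 = 1) {s : H} (hs : (s : GL (Fin d) ℝ) ∈ S) :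
    Measure.modularCharacter s = 1 := by
  have h1 := hΛ.modularCharacter_shear_le hH hY hs
  have h2 := hΛ.modularCharacter_shear_le hH hY (s := s⁻¹) (S.inv_mem hs)
  have h3 : (Measure.modularCharacter s : ℝ) * (Measure.modularCharacter s⁻¹ : ℝ) = 1 := by
    rw [← NNReal.coe_mul, ← map_mul, mul_inv_cancel, map_one, NNReal.coe_one]
  have h4 : (0 : ℝ) ≤ Measure.modularCharacter s := NNReal.coe_nonneg _
  rw [← NNReal.coe_inj, NNReal.coe_one]
  nlinarith

theorem IsShearSection.modular_eq (hΛ : IsShearSection S Λ)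
    (hH : IsGeneralizedShearlet H S D Y) (hY : Y 0 0 = 1) (h : H) :
    modular H h = |orbitMap H h 0| ^ (Y.trace - d) := by
  obtain ⟨ε, hε, r, s, hs, heq⟩ := hH.exists_factor h.2
  change mat h = _ at heq
  have hεa : |ε| = 1 := by rcases hε with h | h <;> simp [h]
  let z : H := ⟨-1, hH.neg_one_mem⟩
  let δ : H := ⟨dilGL Y r, hH.dilGL_mem r⟩
  let s' : H := ⟨s, hH.shear_le hs⟩
  -- `-1` has order dividing two and the character is nonnegative.
  have hz : Measure.modularCharacter z = 1 := by
    have h1 : z * z = 1 := Subtype.ext (by simp [z])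
    have h2 : Measure.modularCharacter z * Measure.modularCharacter z = 1 := by
      rw [← map_mul, h1, map_one]
    rw [← sq] at h2
    exact (pow_eq_one_iff_of_nonneg zero_le two_ne_zero).mp h2
  have hχ : Measure.modularCharacter h = Measure.modularCharacter δ := by
    have hs1 := hΛ.modularCharacter_shear hH hY (s := s') hs
    rcases hε with rfl | rfl
    · have : h = δ * s' := Subtype.ext (Units.ext (by
        change mat h = dil Y r * (s : Matrix (Fin d) (Fin d) ℝ)
        rw [heq, one_smul]))
      rw [this, map_mul, hs1, mul_one]
    · have : h = z * (δ * s') := Subtype.ext (Units.ext (by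
        change mat h = -1 * (dil Y r * (s : Matrix (Fin d) (Fin d) ℝ))
        rw [heq]; simp))
      rw [this, map_mul, map_mul, hs1, hz, mul_one, one_mul]
  have h1 : modular H h = (Measure.modularCharacter h : ℝ)⁻¹ := rfl
  rw [h1, hχ, hΛ.modularCharacter_dil hH hY, hH.orbitMap_zero_of_factor hY hs heq, abs_mul, hεa,
    one_mul, abs_of_pos (Real.exp_pos r), ← Real.exp_mul, ← Real.exp_neg]
  congr 1
  ring

end Haar

end Shearlet

end
noncomputable section

namespace Shearlet

/-! ### The comparison function `size` and the integrability of its negative powers. -/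

section Size

variable {d : ℕ} {H S D : DilationGroup d} {Y : Matrix (Fin d) (Fin d) ℝ}
  {Λ : Eucl d →ₗ[ℝ] Matrix (Fin d) (Fin d) ℝ}

/-- The weight `(1 + ‖h‖) (1 + ‖h⁻¹‖)`. -/
def size (h : H) : ℝ := (1 + opNorm (mat h)) * (1 + opNorm (mat h⁻¹))

theorem one_le_size (h : H) : 1 ≤ size h := by
  have h1 := opNorm_nonneg (mat h)
  have h2 := opNorm_nonneg (mat h⁻¹)
  rw [size]
  nlinarith [mul_nonneg h1 h2]

theorem size_pos (h : H) : 0 < size h := one_pos.trans_le (one_le_size h)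

theorem continuous_size : Continuous (size : H → ℝ) :=
  (continuous_const.add (continuous_opNorm.comp continuous_mat)).mul
    (continuous_const.add (continuous_opNorm.comp continuous_mat_inv))

theorem size_inv (h : H) : size h⁻¹ = size h := by
  rw [size, size, inv_inv, mul_comm]

theorem one_add_opNorm_le_size (h : H) : 1 + opNorm (mat h) ≤ size h :=
  le_mul_of_one_le_right (by linarith [opNorm_nonneg (mat h)]) (by linarith [opNorm_nonneg (mat h⁻¹)])

theorem size_mul_le (g h : H) : size (g * h) ≤ size g * size h := by
  have key : ∀ g h : H, 1 + opNorm (mat (g * h)) ≤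
      (1 + opNorm (mat g)) * (1 + opNorm (mat h)) := by
    intro g h
    have h1 : opNorm (mat (g * h)) ≤ opNorm (mat g) * opNorm (mat h) := opNorm_mul_le _ _
    nlinarith [opNorm_nonneg (mat g), opNorm_nonneg (mat h)]
  have h1 := key g h
  have h2 := key h⁻¹ g⁻¹
  rw [← mul_inv_rev] at h2
  calc size (g * h) ≤ ((1 + opNorm (mat g)) * (1 + opNorm (mat h))) *
        ((1 + opNorm (mat h⁻¹)) * (1 + opNorm (mat g⁻¹))) := by
        refine mul_le_mul h1 h2 ?_ ?_
        · linarith [opNorm_nonneg (mat (g * h)⁻¹)]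
        · have := opNorm_nonneg (mat g)
          have := opNorm_nonneg (mat h)
          positivity
    _ = size g * size h := by rw [size, size]; ring

theorem size_le_mul_left (g h : H) : size h ≤ size g * size (g * h) := by
  have := size_mul_le g⁻¹ (g * h)
  rwa [inv_mul_cancel_left, size_inv] at this

theorem size_le_mul_right (g h : H) : size g ≤ size (g * h) * size h := by
  have := size_mul_le (g * h) h⁻¹
  rwa [mul_inv_cancel_right, size_inv] at this

/-- `f` is bounded by a power of `size`. -/
def HasPolynomialGrowth (f : H → ℝ) : Prop :=
  ∃ N : ℕ, ∃ C : ℝ, 0 < C ∧ ∀ h, f h ≤ C * size h ^ N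

theorem HasPolynomialGrowth.mul {f g : H → ℝ} (hf : HasPolynomialGrowth f)
    (hg : HasPolynomialGrowth g) (hg0 : ∀ h, 0 ≤ g h) :
    HasPolynomialGrowth fun h => f h * g h := by
  obtain ⟨N, C, hC, hfN⟩ := hf
  obtain ⟨M, B, hB, hgM⟩ := hg
  refine ⟨N + M, C * B, by positivity, fun h => ?_⟩
  have := size_pos h
  calc f h * g h ≤ (C * size h ^ N) * (B * size h ^ M) :=
        mul_le_mul (hfN h) (hgM h) (hg0 h) (by positivity)
    _ = C * B * size h ^ (N + M) := by rw [pow_add]; ring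

theorem rpow_le_pow_ceil {x : ℝ} (hx : 1 ≤ x) (b : ℝ) : x ^ b ≤ x ^ ⌈b⌉₊ := by
  rw [← Real.rpow_natCast]
  exact Real.rpow_le_rpow_of_exponent_le hx (Nat.le_ceil b)

theorem hasPolynomialGrowth_one_add_opNorm_rpow {b : ℝ} (hb : 0 ≤ b) :
    HasPolynomialGrowth fun h : H => (1 + opNorm (mat h)) ^ b := by
  refine ⟨⌈b⌉₊, 1, one_pos, fun h => ?_⟩
  rw [one_mul]
  refine le_trans ?_ (rpow_le_pow_ceil (one_le_size h) b)
  exact Real.rpow_le_rpow (by linarith [opNorm_nonneg (mat h)]) (one_add_opNorm_le_size h) hb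

theorem PolynomiallyBounded.hasPolynomialGrowth {w : H → ℝ} (hw : PolynomiallyBounded H w) :
    HasPolynomialGrowth w := by
  obtain ⟨k, C, hC, h⟩ := hw
  exact ⟨k, C, hC, fun x => by rw [size, mul_pow]; exact h x⟩

theorem auxA_pow_le (ξ : Eucl d) :
    auxA H ξ ^ (d + 1) ≤ (1 + ‖ξ‖) ^ (-((d : ℝ) + 1)) := by
  have h1 : auxA H ξ ≤ (1 + ‖ξ‖)⁻¹ := by
    rw [← one_div, le_div_iff₀ (by positivity)]
    exact auxA_mul_one_add_norm_le ξ
  have h2 : (1 + ‖ξ‖) ^ (-((d : ℝ) + 1)) = (1 + ‖ξ‖)⁻¹ ^ (d + 1) := by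
    rw [Real.rpow_neg (by positivity), ← Real.inv_rpow (by positivity), ← Real.rpow_natCast]
    push_cast
    rfl
  rw [h2]
  exact pow_le_pow_left₀ (auxA_nonneg ξ) h1 _

theorem lintegral_one_add_norm_lt_top :
    ∫⁻ ξ : Eucl d, ENNReal.ofReal ((1 + ‖ξ‖) ^ (-((d : ℝ) + 1))) < ∞ :=
  finite_integral_one_add_norm (by rw [finrank_euclideanSpace_fin]; linarith)

variable [NeZero d]

theorem IsGeneralizedShearlet.orbitMap_mul_zero (hH : IsGeneralizedShearlet H S D Y)
    (hY : Y 0 0 = 1) (g h : H) : orbitMap H (g * h) 0 = orbitMap H h 0 * orbitMap H g 0 := by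
  rw [orbitMap_mul, hH.act_transpose_zero hY]

theorem IsGeneralizedShearlet.orbitMap_inv_zero (hH : IsGeneralizedShearlet H S D Y)
    (hY : Y 0 0 = 1) (h : H) : orbitMap H h⁻¹ 0 = (orbitMap H h 0)⁻¹ := by
  have h1 : orbitMap H (1 : H) 0 = 1 := by
    rw [orbitMap]
    change act (1 : Matrix (Fin d) (Fin d) ℝ)ᵀ e₀ 0 = 1
    simp
  rw [← mul_inv_cancel h, hH.orbitMap_mul_zero hY] at h1
  exact eq_inv_of_mul_eq_one_left h1

/-- `‖h‖` bounds `h^T e₀` from above, and `‖h⁻¹‖` bounds its first coordinate away from zero, since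
that coordinate is multiplicative in `h`. -/
theorem IsShearSection.one_le_size_mul_auxA (hΛ : IsShearSection S Λ)
    (hH : IsGeneralizedShearlet H S D Y) (hY : Y 0 0 = 1) (h : H) :
    1 ≤ 2 * size h ^ 2 * auxA H (orbitMap H h) := by
  refine le_auxA (hΛ.openDualOrbit_eq hH hY) (one_le_size h) ?_ ?_
  · have h0 := abs_pos.mpr (hH.orbitMap_zero_ne_zero hY h)
    have h1 : |orbitMap H h⁻¹ 0| ≤ size h := by
      rw [← size_inv]
      refine (abs_coord_le _ 0).trans ((norm_orbitMap_le _).trans ?_)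
      linarith [one_add_opNorm_le_size h⁻¹]
    rw [hH.orbitMap_inv_zero hY, abs_inv] at h1
    rwa [← inv_le_iff_one_le_mul₀' h0]
  · refine (norm_orbitMap_le _).trans ?_
    linarith [one_add_opNorm_le_size h]

theorem IsShearSection.exists_size_mul_auxA_pow_le (hΛ : IsShearSection S Λ)
    (hH : IsGeneralizedShearlet H S D Y) (hY : Y 0 0 = 1) :
    ∃ K : ℕ, ∃ C : ℝ, 0 < C ∧ ∀ h : H, size h * auxA H (orbitMap H h) ^ K ≤ C := by
  obtain ⟨C, hC, hb⟩ := hH.exists_norm_bound hY hΛ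
  set e : ℝ := (nilpotencyClass (lieAlg S) : ℝ) - 1 + 2 * opNorm Y with he
  -- One power `⌈e⌉₊` for each of the two factors of `size`.
  refine ⟨⌈e⌉₊ + ⌈e⌉₊, (1 + C) * (1 + C), by positivity, fun h => ?_⟩
  obtain ⟨h1, h2⟩ := hb h
  set a := auxA H (orbitMap H h) with ha
  have ha0 : 0 < a := auxA_pos (hΛ.openDualOrbit_eq hH hY) (hH.orbitMap_zero_ne_zero hY h)
  have ha1 : a ≤ 1 := auxA_le_one _
  have hae : a ^ ⌈e⌉₊ ≤ a ^ e := by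
    rw [← Real.rpow_natCast]
    exact Real.rpow_le_rpow_of_exponent_ge ha0 ha1 (Nat.le_ceil e)
  have key : ∀ x : ℝ, 0 ≤ x → x * a ^ e ≤ C → (1 + x) * a ^ ⌈e⌉₊ ≤ 1 + C := by
    intro x hx hxC
    have h3 : x * a ^ ⌈e⌉₊ ≤ x * a ^ e := by gcongr
    have h4 : a ^ ⌈e⌉₊ ≤ 1 := pow_le_one₀ ha0.le ha1
    linarith
  have h3 := key _ (opNorm_nonneg _) h1
  have h4 := key _ (opNorm_nonneg _) h2
  rw [pow_add, size]
  calc (1 + opNorm (mat h)) * (1 + opNorm (mat h⁻¹)) * (a ^ ⌈e⌉₊ * a ^ ⌈e⌉₊)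
      = ((1 + opNorm (mat h)) * a ^ ⌈e⌉₊) * ((1 + opNorm (mat h⁻¹)) * a ^ ⌈e⌉₊) := by ring
    _ ≤ (1 + C) * (1 + C) := by
      refine mul_le_mul h3 h4 ?_ (by positivity)
      have := opNorm_nonneg (mat h⁻¹)
      positivity

theorem IsShearSection.hasPolynomialGrowth_det_rpow (hΛ : IsShearSection S Λ)
    (hH : IsGeneralizedShearlet H S D Y) (hY : Y 0 0 = 1) (b : ℝ) :
    HasPolynomialGrowth fun h : H => |(mat h).det| ^ b := by
  have hO := hΛ.openDualOrbit_eq hH hY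
  set k := ⌈|Y.trace * b|⌉₊ with hk
  refine ⟨2 * k, 2 ^ k, by positivity, fun h => ?_⟩
  have h0 := hH.orbitMap_zero_ne_zero hY h
  have ha0 := auxA_pos hO h0
  have h1 := abs_rpow_mul_auxA_rpow_le hO h0 (Y.trace * b)
  have hs := hΛ.one_le_size_mul_auxA hH hY h
  have hx : 1 ≤ 2 * size h ^ 2 := by nlinarith [one_le_size h]
  have h2 : 1 ≤ (2 * size h ^ 2) ^ |Y.trace * b| * auxA H (orbitMap H h) ^ |Y.trace * b| := by
    rw [← Real.mul_rpow (by positivity) ha0.le]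
    exact Real.one_le_rpow hs (abs_nonneg _)
  have h3 : |orbitMap H h 0| ^ (Y.trace * b) ≤ (2 * size h ^ 2) ^ |Y.trace * b| :=
    le_of_mul_le_mul_right (h1.trans h2) (Real.rpow_pos_of_pos ha0 _)
  change |(mat h).det| ^ b ≤ _
  rw [hH.abs_det_mat hY, ← Real.rpow_mul (abs_nonneg _)]
  refine h3.trans ((rpow_le_pow_ceil hx _).trans (le_of_eq ?_))
  rw [mul_pow, ← pow_mul]

/-- Large negative powers of `size` are integrable. -/
theorem IsShearSection.exists_lintegral_size_lt_top (hΛ : IsShearSection S Λ)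
    (hH : IsGeneralizedShearlet H S D Y) (hY : Y 0 0 = 1) :
    ∃ N : ℕ, ∫⁻ h : H, ENNReal.ofReal ((size h)⁻¹ ^ N) ∂(haarH H) < ∞ := by
  have hO := hΛ.openDualOrbit_eq hH hY
  have hp := hΛ.isOpenEmbedding_orbitMap hH hY
  -- Of the power `n` of `A`, the part `k` cancels the density `|ξ₀|^{-trace Y}` and the part `d +
  -- 1` gives integrability at infinity.
  set k := ⌈|Y.trace|⌉₊ with hk
  set n := k + (d + 1) with hn
  obtain ⟨c, hc⟩ := hΛ.exists_haarH_eq hH hY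
  -- The factor two comes from `1/A ≤ 2 size²`.
  refine ⟨2 * n, ?_⟩
  have hm : Measurable fun h : H => ENNReal.ofReal ((size h)⁻¹ ^ (2 * n)) :=
    ((continuous_size.inv₀ fun h => (size_pos h).ne').pow _).measurable.ennreal_ofReal
  rw [hc, lintegral_smul_measure, Measure.inv, lintegral_map hm continuous_inv.measurable]
  refine ENNReal.mul_lt_top ENNReal.coe_lt_top ?_
  have hle : ∀ h : H, ENNReal.ofReal ((size h⁻¹)⁻¹ ^ (2 * n)) ≤
      ENNReal.ofReal (2 ^ n * auxA H (orbitMap H h) ^ n) := by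
    intro h
    refine ENNReal.ofReal_le_ofReal ?_
    have hs := hΛ.one_le_size_mul_auxA hH hY h
    have hpos := size_pos h
    rw [size_inv, ← mul_pow, pow_mul]
    refine pow_le_pow_left₀ (by positivity) ?_ n
    rw [inv_pow, inv_le_iff_one_le_mul₀ (by positivity)]
    linarith
  have hmA : Measurable fun ξ : Eucl d => ENNReal.ofReal (2 ^ n * auxA H ξ ^ n) :=
    ((continuous_auxA.pow n).const_mul _).measurable.ennreal_ofReal
  refine (lintegral_mono hle).trans_lt ?_
  rw [lintegral_pullbackMeasure hp _ hmA]
  have hle2 : ∀ ξ ∈ Set.range (orbitMap H),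
      ENNReal.ofReal (|ξ 0| ^ (-Y.trace)) * ENNReal.ofReal (2 ^ n * auxA H ξ ^ n) ≤
        ENNReal.ofReal (2 ^ n) * ENNReal.ofReal ((1 + ‖ξ‖) ^ (-((d : ℝ) + 1))) := by
    rintro _ ⟨h, rfl⟩
    have h0 := hH.orbitMap_zero_ne_zero hY h
    have ha0 := auxA_pos hO h0
    have h1 := abs_rpow_mul_auxA_rpow_le hO h0 (-Y.trace)
    rw [abs_neg] at h1
    have h2 : auxA H (orbitMap H h) ^ k ≤ auxA H (orbitMap H h) ^ |Y.trace| := by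
      rw [← Real.rpow_natCast]
      exact Real.rpow_le_rpow_of_exponent_ge ha0 (auxA_le_one _) (Nat.le_ceil _)
    rw [← ENNReal.ofReal_mul (by positivity), ← ENNReal.ofReal_mul (by positivity)]
    refine ENNReal.ofReal_le_ofReal ?_
    calc |orbitMap H h 0| ^ (-Y.trace) * (2 ^ n * auxA H (orbitMap H h) ^ n)
        = 2 ^ n * ((|orbitMap H h 0| ^ (-Y.trace) * auxA H (orbitMap H h) ^ k) *
            auxA H (orbitMap H h) ^ (d + 1)) := by rw [hn, pow_add]; ring
      _ ≤ 2 ^ n * (1 * (1 + ‖orbitMap H h‖) ^ (-((d : ℝ) + 1))) := by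
          gcongr
          · exact (mul_le_mul_of_nonneg_left h2 (by positivity)).trans h1
          · exact auxA_pow_le _
      _ = 2 ^ n * (1 + ‖orbitMap H h‖) ^ (-((d : ℝ) + 1)) := by rw [one_mul]
  refine (setLIntegral_mono' hp.isOpen_range.measurableSet hle2).trans_lt ?_
  refine (setLIntegral_le_lintegral _ _).trans_lt ?_
  rw [lintegral_const_mul' _ _ ENNReal.ofReal_ne_top]
  exact ENNReal.mul_lt_top ENNReal.ofReal_lt_top lintegral_one_add_norm_lt_top

end Size

/-! ### The two kinds of temperate embeddedness. -/

section Embedding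

variable {d : ℕ} {H S D : DilationGroup d} {Y : Matrix (Fin d) (Fin d) ℝ}
  {Λ : Eucl d →ₗ[ℝ] Matrix (Fin d) (Fin d) ℝ}

theorem memLp_of_abs_le_size {N : ℕ}
    (hN : ∫⁻ h : H, ENNReal.ofReal ((size h)⁻¹ ^ N) ∂(haarH H) < ∞) {f : H → ℝ}
    (hf : Continuous f) {C : ℝ} (hC : 0 ≤ C) (hle : ∀ h, |f h| ≤ C * (size h)⁻¹ ^ N) {q : ℝ}
    (hq : 1 ≤ q) : MemLp f (ENNReal.ofReal q) (haarH H) := by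
  refine ⟨hf.aestronglyMeasurable, ?_⟩
  have hq0 : 0 < q := by linarith
  rw [eLpNorm_lt_top_iff_lintegral_rpow_enorm_lt_top (by simpa using hq0) ENNReal.ofReal_ne_top,
    ENNReal.toReal_ofReal hq0.le]
  have key : ∀ h : H, ‖f h‖ₑ ^ q ≤
      ENNReal.ofReal (C ^ q) * ENNReal.ofReal ((size h)⁻¹ ^ N) := by
    intro h
    have hs : (size h)⁻¹ ^ N ≤ 1 :=
      pow_le_one₀ (inv_nonneg.mpr (size_pos h).le) (inv_le_one_of_one_le₀ (one_le_size h))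
    have hs0 : 0 ≤ (size h)⁻¹ ^ N := pow_nonneg (inv_nonneg.mpr (size_pos h).le) _
    rw [← ENNReal.ofReal_mul (by positivity), Real.enorm_eq_ofReal_abs,
      ENNReal.ofReal_rpow_of_nonneg (abs_nonneg _) hq0.le]
    refine ENNReal.ofReal_le_ofReal ?_
    calc |f h| ^ q ≤ (C * (size h)⁻¹ ^ N) ^ q := Real.rpow_le_rpow (abs_nonneg _) (hle h) hq0.le
      _ = C ^ q * ((size h)⁻¹ ^ N) ^ q := Real.mul_rpow hC hs0
      _ ≤ C ^ q * (size h)⁻¹ ^ N := by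
        gcongr
        -- As `q ≥ 1` and the base is at most one, a single integrable power of `size⁻¹` serves
        -- every `q`.
        exact Real.rpow_le_self_of_le_one hs0 hs hq
  refine (lintegral_mono key).trans_lt ?_
  rw [lintegral_const_mul' _ _ ENNReal.ofReal_ne_top]
  exact ENNReal.mul_lt_top ENNReal.ofReal_lt_top hN

theorem continuous_det_rpow (b : ℝ) : Continuous fun h : H => |(mat h).det| ^ b :=
  continuous_mat.matrix_det.abs.rpow_const fun _ => Or.inl (abs_ne_zero.mpr (det_ne_zero _))

theorem continuous_one_add_opNorm_rpow (b : ℝ) :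
    Continuous fun h : H => (1 + opNorm (mat h)) ^ b :=
  (continuous_const.add (continuous_opNorm.comp continuous_mat)).rpow_const
    fun h => Or.inl (by linarith [opNorm_nonneg (mat h)] : 0 < 1 + opNorm (mat h)).ne'

/-- A function of polynomial growth times a function with `size h * a(h) ^ K ≤ B` raised to a
large power decays fast. -/
theorem mul_pow_le_inv_size {f a : H → ℝ} {K N M : ℕ} {B C : ℝ} (hf : ∀ h, f h ≤ C * size h ^ N)
    (hC : 0 ≤ C) (ha : ∀ h, 0 ≤ a h) (hB : ∀ h, size h * a h ^ K ≤ B) (h : H) :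
    f h * a h ^ (K * (N + M)) ≤ C * B ^ (N + M) * (size h)⁻¹ ^ M := by
  have hs := size_pos h
  have h1 : a h ^ K ≤ B * (size h)⁻¹ := by
    rw [← div_eq_mul_inv, le_div_iff₀ hs, mul_comm]
    exact hB h
  have h2 : (a h ^ K) ^ (N + M) ≤ (B * (size h)⁻¹) ^ (N + M) :=
    pow_le_pow_left₀ (pow_nonneg (ha h) _) h1 _
  calc f h * a h ^ (K * (N + M)) ≤ (C * size h ^ N) * (B * (size h)⁻¹) ^ (N + M) := by
        rw [pow_mul]
        exact mul_le_mul (hf h) h2 (by have := ha h; positivity) (by positivity)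
    _ = C * B ^ (N + M) * (size h)⁻¹ ^ M * (size h * (size h)⁻¹) ^ N := by
        rw [mul_pow, mul_pow, pow_add (size h)⁻¹]; ring
    _ = C * B ^ (N + M) * (size h)⁻¹ ^ M := by
        rw [mul_inv_cancel₀ hs.ne', one_pow, mul_one]

/-- Dominated convergence: the factor `A(ξ)` alone, through `d + 1` of its powers, supplies an
integrable majorant that does not depend on `h`. -/
theorem continuous_auxPhi (n : ℕ) : Continuous (auxPhi H (n + (d + 1))) := by
  refine continuous_iff_continuousAt.mpr fun h => ?_
  refine tendsto_lintegral_filter_of_dominated_convergence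
    (fun ξ : Eucl d => ENNReal.ofReal ((1 + ‖ξ‖) ^ (-((d : ℝ) + 1)))) ?_ ?_ ?_ ?_
  · refine Filter.Eventually.of_forall fun h => Continuous.measurable ?_
    exact ENNReal.continuous_ofReal.comp ((continuous_auxA.pow _).mul
      ((continuous_auxA.comp (continuous_act _)).pow _))
  · refine Filter.Eventually.of_forall fun h => Filter.Eventually.of_forall fun ξ => ?_
    refine ENNReal.ofReal_le_ofReal ?_
    have h1 : auxA H (act (mat h)ᵀ ξ) ^ (n + (d + 1)) ≤ 1 :=
      pow_le_one₀ (auxA_nonneg _) (auxA_le_one _)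
    have h2 : auxA H ξ ^ (n + (d + 1)) ≤ auxA H ξ ^ (d + 1) :=
      pow_le_pow_of_le_one (auxA_nonneg _) (auxA_le_one _) (by omega)
    calc auxA H ξ ^ (n + (d + 1)) * auxA H (act (mat h)ᵀ ξ) ^ (n + (d + 1))
        ≤ auxA H ξ ^ (n + (d + 1)) * 1 :=
          mul_le_mul_of_nonneg_left h1 (pow_nonneg (auxA_nonneg _) _)
      _ ≤ (1 + ‖ξ‖) ^ (-((d : ℝ) + 1)) := by
          rw [mul_one]
          exact h2.trans (auxA_pow_le ξ)
  · exact ((setLIntegral_le_lintegral _ _).trans_lt lintegral_one_add_norm_lt_top).ne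
  · refine Filter.Eventually.of_forall fun ξ => ?_
    have : Continuous fun h : H => ENNReal.ofReal (auxA H ξ ^ (n + (d + 1)) *
        auxA H (act (mat h)ᵀ ξ) ^ (n + (d + 1))) :=
      ENNReal.continuous_ofReal.comp (continuous_const.mul
        ((continuous_auxA.comp (continuous_act_mat ξ)).pow _))
    exact this.tendsto h

variable [NeZero d]

theorem IsShearSection.exists_isTemperatelyEmbedded (hΛ : IsShearSection S Λ)
    (hH : IsGeneralizedShearlet H S D Y) (hY : Y 0 0 = 1) {w : H → ℝ} (hw : IsWeight H w)
    (hwp : PolynomiallyBounded H w) {q : ℝ} (hq : 1 ≤ q) {s : ℝ} (hs : 0 ≤ s) :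
    ∃ ℓ : ℕ, IsTemperatelyEmbedded H s q w ℓ := by
  have hO := hΛ.openDualOrbit_eq hH hY
  have hgrowth : ∀ b : ℝ, HasPolynomialGrowth fun h : H =>
      |(mat h).det| ^ b * (1 + opNorm (mat h)) ^ (s + d + 1) * w h := fun b =>
    ((hΛ.hasPolynomialGrowth_det_rpow hH hY b).mul
      (hasPolynomialGrowth_one_add_opNorm_rpow (by positivity))
      fun h => Real.rpow_nonneg (by linarith [opNorm_nonneg (mat h)]) _).mul
      hwp.hasPolynomialGrowth fun h => (hw.pos h).le
  have hcont : ∀ b : ℝ, Continuous fun h : H =>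
      |(mat h).det| ^ b * (1 + opNorm (mat h)) ^ (s + d + 1) * w h := fun b =>
    ((continuous_det_rpow b).mul (continuous_one_add_opNorm_rpow _)).mul hw.continuous
  have hnonneg : ∀ (b : ℝ) (h : H),
      0 ≤ |(mat h).det| ^ b * (1 + opNorm (mat h)) ^ (s + d + 1) * w h := by
    intro b h
    have h1 := opNorm_nonneg (mat h)
    have h2 := hw.pos h
    positivity
  obtain ⟨N₁, C₁, hC₁, hN₁⟩ := hgrowth (1 / 2 - 1 / q)
  obtain ⟨N₂, C₂, hC₂, hN₂⟩ := hgrowth (-(1 / 2) - 1 / q)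
  obtain ⟨M, hM⟩ := hΛ.exists_lintegral_size_lt_top hH hY
  obtain ⟨K, B, hB, hK⟩ := hΛ.exists_size_mul_auxA_pow_le hH hY
  have hmono : ∀ {C : ℝ} {n m : ℕ} (h : H), 0 ≤ C → n ≤ m → C * size h ^ n ≤ C * size h ^ m :=
    fun h hC hnm => mul_le_mul_of_nonneg_left (pow_le_pow_right₀ (one_le_size h) hnm) hC
  -- The sum `N₁ + N₂` covers the growth of both functions at once, and `M` leaves an integrable
  -- power of `size⁻¹`.
  refine ⟨K * ((N₁ + N₂) + M), fun ξ₀ hξ₀ => ?_⟩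
  rw [hO] at hξ₀
  obtain ⟨g, rfl⟩ := hΛ.exists_orbitMap_eq hH hY hξ₀
  -- Passing from `e₀` to the base point `g^T e₀` replaces `h` by `g * h`, at the cost of the
  -- constant `size g`.
  have hbase : ∀ h : H, size h * auxA H (act (mat h)ᵀ (orbitMap H g)) ^ K ≤ size g * B := by
    intro h
    rw [← orbitMap_mul]
    have h1 := size_le_mul_left g h
    have h2 := hK (g * h)
    have h3 := auxA_nonneg (H := H) (orbitMap H (g * h))
    calc size h * auxA H (orbitMap H (g * h)) ^ K
        ≤ size g * size (g * h) * auxA H (orbitMap H (g * h)) ^ K := by gcongr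
      _ = size g * (size (g * h) * auxA H (orbitMap H (g * h)) ^ K) := by ring
      _ ≤ size g * B := mul_le_mul_of_nonneg_left h2 (size_pos g).le
  have hgB : 0 ≤ size g * B := mul_nonneg (size_pos g).le hB.le
  constructor
  · refine memLp_of_abs_le_size hM ((hcont _).mul
      ((continuous_auxA.comp (continuous_act_mat _)).pow _))
      (C := C₁ * (size g * B) ^ ((N₁ + N₂) + M)) (by positivity) (fun h => ?_) hq
    refine (abs_of_nonneg (mul_nonneg (hnonneg _ h) (pow_nonneg (auxA_nonneg _) _))).trans_le ?_
    exact mul_pow_le_inv_size (fun h => (hN₁ h).trans (hmono h hC₁.le (by omega))) hC₁.le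
      (fun h => auxA_nonneg _) hbase h
  · rw [← ENNReal.ofReal_one]
    refine memLp_of_abs_le_size hM ((hcont _).mul
      ((continuous_auxA.comp ((continuous_act_mat _).comp continuous_inv)).pow _))
      (C := C₂ * (size g * B) ^ ((N₁ + N₂) + M)) (by positivity) (fun h => ?_) le_rfl
    refine (abs_of_nonneg (mul_nonneg (hnonneg _ h) (pow_nonneg (auxA_nonneg _) _))).trans_le ?_
    exact mul_pow_le_inv_size (fun h => (hN₂ h).trans (hmono h hC₂.le (by omega))) hC₂.le
      (fun h => auxA_nonneg _) (fun h => by rw [← size_inv]; exact hbase h⁻¹) h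

/-- With `ξ = g^T e₀` the two factors are controlled by `1/size g` and `1/size (g * h)`, and
submultiplicativity gives `size h ≤ size g * size (g * h)`: decay in `h` uniform in `ξ`. The extra
`d + 1` powers of `A(ξ)` pay for the integral over `ξ`. -/
theorem IsShearSection.auxPhi_integrand_le (hΛ : IsShearSection S Λ)
    (hH : IsGeneralizedShearlet H S D Y) (hY : Y 0 0 = 1) {K : ℕ} {B : ℝ}
    (hK : ∀ h : H, size h * auxA H (orbitMap H h) ^ K ≤ B) (n : ℕ) (h : H) {ξ : Eucl d}
    (hξ : ξ ∈ openDualOrbit H) :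
    auxA H ξ ^ (K * n + (d + 1)) * auxA H (act (mat h)ᵀ ξ) ^ (K * n + (d + 1)) ≤
      (B * B * (size h)⁻¹) ^ n * (1 + ‖ξ‖) ^ (-((d : ℝ) + 1)) := by
  rw [hΛ.openDualOrbit_eq hH hY] at hξ
  obtain ⟨g, rfl⟩ := hΛ.exists_orbitMap_eq hH hY hξ
  rw [← orbitMap_mul]
  set a := auxA H (orbitMap H g) with ha
  set b := auxA H (orbitMap H (g * h)) with hb
  have ha0 : 0 ≤ a := auxA_nonneg _
  have hb0 : 0 ≤ b := auxA_nonneg _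
  have hs := size_pos h
  have h1 : (a * b) ^ K ≤ B * B * (size h)⁻¹ := by
    rw [← div_eq_mul_inv, le_div_iff₀ hs, mul_pow]
    calc a ^ K * b ^ K * size h ≤ a ^ K * b ^ K * (size g * size (g * h)) := by
          gcongr
          exact size_le_mul_left g h
      _ = (size g * a ^ K) * (size (g * h) * b ^ K) := by ring
      _ ≤ B * B := by
          refine mul_le_mul (hK g) (hK (g * h)) ?_ ?_
          · have := size_pos (g * h); positivity
          · have := size_pos g; exact le_trans (by positivity) (hK g)
  have h2 : b ^ (d + 1) ≤ 1 := pow_le_one₀ hb0 (auxA_le_one _)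
  calc a ^ (K * n + (d + 1)) * b ^ (K * n + (d + 1))
      = ((a * b) ^ K) ^ n * (a ^ (d + 1) * b ^ (d + 1)) := by
        rw [pow_add a, pow_add b, pow_mul a, pow_mul b, mul_pow a b, mul_pow]; ring
    _ ≤ (B * B * (size h)⁻¹) ^ n * ((1 + ‖orbitMap H g‖) ^ (-((d : ℝ) + 1)) * 1) := by
        have h3 : 0 ≤ (B * B * (size h)⁻¹) ^ n :=
          pow_nonneg ((pow_nonneg (mul_nonneg ha0 hb0) K).trans h1) n
        exact mul_le_mul (pow_le_pow_left₀ (pow_nonneg (mul_nonneg ha0 hb0) K) h1 n)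
          (mul_le_mul (auxA_pow_le _) h2 (pow_nonneg hb0 _) (by positivity))
          (mul_nonneg (pow_nonneg ha0 _) (pow_nonneg hb0 _)) h3
    _ = _ := by rw [mul_one]

theorem IsShearSection.auxPhi_le (hΛ : IsShearSection S Λ)
    (hH : IsGeneralizedShearlet H S D Y) (hY : Y 0 0 = 1) {K : ℕ} {B : ℝ} (hB : 0 ≤ B)
    (hK : ∀ h : H, size h * auxA H (orbitMap H h) ^ K ≤ B) (n : ℕ) (h : H) :
    auxPhi H (K * n + (d + 1)) h ≤ ENNReal.ofReal ((B * B * (size h)⁻¹) ^ n) *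
      ∫⁻ ξ : Eucl d, ENNReal.ofReal ((1 + ‖ξ‖) ^ (-((d : ℝ) + 1))) := by
  have hm : MeasurableSet (openDualOrbit H) := by
    rw [hΛ.openDualOrbit_eq hH hY]
    exact isOpen_coord_ne_zero.measurableSet
  have hs := size_pos h
  rw [auxPhi, ← lintegral_const_mul' _ _ ENNReal.ofReal_ne_top]
  refine le_trans (setLIntegral_mono' hm fun ξ hξ => ?_) (setLIntegral_le_lintegral _ _)
  rw [← ENNReal.ofReal_mul (by positivity)]
  exact ENNReal.ofReal_le_ofReal (hΛ.auxPhi_integrand_le hH hY hK n h hξ)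

theorem IsShearSection.exists_isStronglyTemperatelyEmbedded (hΛ : IsShearSection S Λ)
    (hH : IsGeneralizedShearlet H S D Y) (hY : Y 0 0 = 1) {w : H → ℝ}
    (hwp : PolynomiallyBounded H w) {s : ℝ} (hs : 0 ≤ s) :
    ∃ ℓ : ℕ, IsStronglyTemperatelyEmbedded H s w ℓ := by
  have hgrowth : HasPolynomialGrowth fun h : H =>
      w h * |(mat h).det| ^ (-(1 / 2) : ℝ) * (1 + opNorm (mat h)) ^ (2 * (s + d + 1)) :=
    (hwp.hasPolynomialGrowth.mul (hΛ.hasPolynomialGrowth_det_rpow hH hY _)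
      fun h => Real.rpow_nonneg (abs_nonneg _) _).mul
      (hasPolynomialGrowth_one_add_opNorm_rpow (by positivity))
      fun h => Real.rpow_nonneg (by linarith [opNorm_nonneg (mat h)]) _
  obtain ⟨N, C, hC, hN⟩ := hgrowth
  obtain ⟨M, hM⟩ := hΛ.exists_lintegral_size_lt_top hH hY
  obtain ⟨K, B, hB, hK⟩ := hΛ.exists_size_mul_auxA_pow_le hH hY
  set I : ℝ≥0∞ := ∫⁻ ξ : Eucl d, ENNReal.ofReal ((1 + ‖ξ‖) ^ (-((d : ℝ) + 1))) with hI
  have hItop : I < ∞ := lintegral_one_add_norm_lt_top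
  have hΦ := hΛ.auxPhi_le hH hY hB.le hK (N + M)
  refine ⟨K * (N + M) + (d + 1), fun h => ?_, continuous_auxPhi _, fun U hU hU1 => ?_⟩
  · exact ((hΦ h).trans_lt (ENNReal.mul_lt_top ENNReal.ofReal_lt_top hItop)).ne
  obtain ⟨R, hR⟩ := hU.bddAbove_image continuous_size.continuousOn
  have hR' : ∀ y ∈ U, size y ≤ R := fun y hy => hR ⟨y, hy, rfl⟩
  have hR0 : 0 < R := (size_pos 1).trans_le (hR' 1 (mem_of_mem_nhds hU1))
  -- Over the compact set `U` the functions `size (x * y)` and `size x` differ by at most the factor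
  -- `R`, so the local supremum costs only a constant.
  have hsup : ∀ x : H, ⨆ y ∈ U, auxPhi H (K * (N + M) + (d + 1)) (x * y) ≤
      ENNReal.ofReal ((B * B * R * (size x)⁻¹) ^ (N + M)) * I := by
    intro x
    refine iSup₂_le fun y hy => (hΦ (x * y)).trans ?_
    have hx := size_pos x
    have hxy := size_pos (x * y)
    gcongr ENNReal.ofReal (?_ ^ _) * I
    rw [mul_assoc (B * B)]
    gcongr
    rw [← div_eq_mul_inv, le_div_iff₀ hx, inv_mul_le_iff₀ hxy]
    exact (size_le_mul_right x y).trans (mul_le_mul_of_nonneg_left (hR' y hy) hxy.le)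
  have hpt : ∀ x : H, (⨆ y ∈ U, auxPhi H (K * (N + M) + (d + 1)) (x * y)) *
      ENNReal.ofReal (w x * |(mat x).det| ^ (-(1 / 2) : ℝ) *
        (1 + opNorm (mat x)) ^ (2 * (s + d + 1))) ≤
      (ENNReal.ofReal (C * (B * B * R) ^ (N + M)) * I) * ENNReal.ofReal ((size x)⁻¹ ^ M) := by
    intro x
    have hx := size_pos x
    refine (mul_le_mul' (hsup x) (ENNReal.ofReal_le_ofReal (hN x))).trans (le_of_eq ?_)
    rw [mul_right_comm, mul_right_comm _ I, ← ENNReal.ofReal_mul (by positivity),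
      ← ENNReal.ofReal_mul (by positivity)]
    congr 2
    calc (B * B * R * (size x)⁻¹) ^ (N + M) * (C * size x ^ N)
        = C * (B * B * R) ^ (N + M) * (size x)⁻¹ ^ M * ((size x)⁻¹ * size x) ^ N := by
          rw [mul_pow _ (size x)⁻¹, pow_add (size x)⁻¹, mul_pow (size x)⁻¹]; ring
      _ = C * (B * B * R) ^ (N + M) * (size x)⁻¹ ^ M := by
          rw [inv_mul_cancel₀ hx.ne', one_pow, mul_one]
  refine (lintegral_mono hpt).trans_lt ?_
  have hconst : ENNReal.ofReal (C * (B * B * R) ^ (N + M)) * I < ∞ :=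
    ENNReal.mul_lt_top ENNReal.ofReal_lt_top hItop
  rw [lintegral_const_mul' _ _ hconst.ne]
  exact ENNReal.mul_lt_top hconst hM

end Embedding

/-! ### The decay estimates at an arbitrary base point of the orbit. -/

section BasePoint

variable {d : ℕ} [NeZero d] {H S D : DilationGroup d} {Y : Matrix (Fin d) (Fin d) ℝ}
  {Λ : Eucl d →ₗ[ℝ] Matrix (Fin d) (Fin d) ℝ}

/-- The estimate at `e₀` is applied to `g * h`; the norms of `h` and `g * h`, and those of their
inverses, differ by at most the norms of `g` and `g⁻¹`. -/
theorem IsShearSection.normEstimate (hΛ : IsShearSection S Λ)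
    (hH : IsGeneralizedShearlet H S D Y) (hY : Y 0 0 = 1) (g : H) :
    NormEstimate H (orbitMap H g)
      ((nilpotencyClass (lieAlg S) : ℝ) - 1 + 2 * opNorm Y) := by
  obtain ⟨C, hC, hb⟩ := hH.exists_norm_bound hY hΛ
  set e : ℝ := (nilpotencyClass (lieAlg S) : ℝ) - 1 + 2 * opNorm Y with he
  have hg := size_pos g
  have h1 : opNorm (mat g⁻¹) ≤ size g := by
    rw [← size_inv]; linarith [one_add_opNorm_le_size g⁻¹]
  have h2 : opNorm (mat g) ≤ size g := by linarith [one_add_opNorm_le_size g]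
  refine ⟨⟨size g * C, by positivity, fun h => ?_⟩, ⟨size g * C, by positivity, fun h => ?_⟩⟩ <;>
    simp only [auxAH, ← orbitMap_mul] <;>
    have ha : 0 ≤ auxA H (orbitMap H (g * h)) ^ e := Real.rpow_nonneg (auxA_nonneg _) _
  · have h3 : opNorm (mat h) ≤ opNorm (mat g⁻¹) * opNorm (mat (g * h)) := by
      have : mat h = mat g⁻¹ * mat (g * h) := by
        conv_lhs => rw [← inv_mul_cancel_left g h]
        rfl
      rw [this]
      exact opNorm_mul_le _ _
    calc opNorm (mat h) * auxA H (orbitMap H (g * h)) ^ e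
        ≤ opNorm (mat g⁻¹) * opNorm (mat (g * h)) * auxA H (orbitMap H (g * h)) ^ e := by gcongr
      _ = opNorm (mat g⁻¹) * (opNorm (mat (g * h)) * auxA H (orbitMap H (g * h)) ^ e) := by ring
      _ ≤ size g * C := mul_le_mul h1 (hb (g * h)).1 (mul_nonneg (opNorm_nonneg _) ha) hg.le
  · have h3 : opNorm (mat h⁻¹) ≤ opNorm (mat (g * h)⁻¹) * opNorm (mat g) := by
      have : mat h⁻¹ = mat (g * h)⁻¹ * mat g := by
        conv_lhs => rw [← inv_mul_cancel_right h⁻¹ g, ← mul_inv_rev]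
        rfl
      rw [this]
      exact opNorm_mul_le _ _
    calc opNorm (mat h⁻¹) * auxA H (orbitMap H (g * h)) ^ e
        ≤ opNorm (mat (g * h)⁻¹) * opNorm (mat g) * auxA H (orbitMap H (g * h)) ^ e := by gcongr
      _ = opNorm (mat g) * (opNorm (mat (g * h)⁻¹) * auxA H (orbitMap H (g * h)) ^ e) := by ring
      _ ≤ size g * C := mul_le_mul h2 (hb (g * h)).2 (mul_nonneg (opNorm_nonneg _) ha) hg.le

theorem IsShearSection.boundedByConst_abs_rpow (hΛ : IsShearSection S Λ)
    (hH : IsGeneralizedShearlet H S D Y) (hY : Y 0 0 = 1) (g : H) (b : ℝ) :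
    BoundedByConst H fun h => |orbitMap H h 0| ^ b * auxAH H (orbitMap H g) h ^ |b| := by
  have hO := hΛ.openDualOrbit_eq hH hY
  have hg := abs_pos.mpr (hH.orbitMap_zero_ne_zero hY g)
  refine ⟨|orbitMap H g 0| ^ (-b), by positivity, fun h => ?_⟩
  have h1 := abs_rpow_mul_auxA_rpow_le hO (hH.orbitMap_zero_ne_zero hY (g * h)) b
  simp only [auxAH, ← orbitMap_mul]
  rw [hH.orbitMap_mul_zero hY, abs_mul, Real.mul_rpow (abs_nonneg _) (abs_nonneg _)] at h1
  rw [Real.rpow_neg hg.le, ← one_div, le_div_iff₀ (by positivity)]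
  linarith

theorem IsShearSection.boundedByConst_abs_inv_rpow (hΛ : IsShearSection S Λ)
    (hH : IsGeneralizedShearlet H S D Y) (hY : Y 0 0 = 1) (g : H) (b : ℝ) :
    BoundedByConst H fun h => |orbitMap H h⁻¹ 0| ^ b * auxAH H (orbitMap H g) h ^ |b| := by
  have h1 := hΛ.boundedByConst_abs_rpow hH hY g (-b)
  rw [abs_neg] at h1
  have h2 : ∀ h : H, |orbitMap H h⁻¹ 0| ^ b = |orbitMap H h 0| ^ (-b) := by
    intro h
    rw [hH.orbitMap_inv_zero hY, abs_inv, Real.inv_rpow (abs_nonneg _),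
      Real.rpow_neg (abs_nonneg _)]
  simpa only [h2] using h1

theorem IsShearSection.detEstimate (hΛ : IsShearSection S Λ)
    (hH : IsGeneralizedShearlet H S D Y) (hY : Y 0 0 = 1) (g : H) :
    DetEstimate H (orbitMap H g) |Y.trace| := by
  constructor
  · simpa only [hH.abs_det_mat hY] using hΛ.boundedByConst_abs_rpow hH hY g Y.trace
  · simpa only [hH.abs_det_mat hY] using hΛ.boundedByConst_abs_inv_rpow hH hY g Y.trace

theorem IsShearSection.modularEstimate (hΛ : IsShearSection S Λ)
    (hH : IsGeneralizedShearlet H S D Y) (hY : Y 0 0 = 1) (g : H) :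
    ModularEstimate H (orbitMap H g) |(d : ℝ) - Y.trace| := by
  rw [abs_sub_comm]
  constructor
  · simpa only [hΛ.modular_eq hH hY] using hΛ.boundedByConst_abs_rpow hH hY g (Y.trace - d)
  · simpa only [hΛ.modular_eq hH hY] using hΛ.boundedByConst_abs_inv_rpow hH hY g (Y.trace - d)

end BasePoint

end Shearlet

end

theorem mainTheorem4 {d : ℕ} [NeZero d] (H S D : Shearlet.DilationGroup d)
    (Y : Matrix (Fin d) (Fin d) ℝ) (hH : Shearlet.IsGeneralizedShearlet H S D Y)
    (hY : Y 0 0 = 1) :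
    -- the dual action has exactly one open orbit
    (∃ ξ₀ : Shearlet.Eucl d, Shearlet.openDualOrbit H = Shearlet.dualOrbit H ξ₀) ∧
    -- the decay estimates, for every choice of the base point
    (∀ ξ₀ ∈ Shearlet.openDualOrbit H,
      Shearlet.NormEstimate H ξ₀
        ((Shearlet.nilpotencyClass (Shearlet.lieAlg S) : ℝ) - 1 + 2 * Shearlet.opNorm Y) ∧
      Shearlet.DetEstimate H ξ₀ |Y.trace| ∧
      Shearlet.ModularEstimate H ξ₀ |(d : ℝ) - Y.trace|) ∧
    -- both kinds of temperate embeddedness, for all polynomially bounded weights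
    (∀ w : H → ℝ, Shearlet.IsWeight H w → Shearlet.PolynomiallyBounded H w →
      ∀ q : ℝ, 1 ≤ q → ∀ s : ℝ, 0 ≤ s →
        (∃ ℓ : ℕ, Shearlet.IsTemperatelyEmbedded H s q w ℓ) ∧
        (∃ ℓ : ℕ, Shearlet.IsStronglyTemperatelyEmbedded H s w ℓ)) := by
  obtain ⟨Λ, hΛ⟩ := hH.exists_isShearSection hY
  have hO := hΛ.openDualOrbit_eq hH hY
  refine ⟨⟨Shearlet.e₀, ?_⟩, fun ξ₀ hξ₀ => ?_, fun w hw hwp q hq s hs =>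
    ⟨hΛ.exists_isTemperatelyEmbedded hH hY hw hwp hq hs,
      hΛ.exists_isStronglyTemperatelyEmbedded hH hY hwp hs⟩⟩
  · rw [hO, hΛ.dualOrbit_eq hH hY (by simp)]
  · rw [hO] at hξ₀
    obtain ⟨g, rfl⟩ := hΛ.exists_orbitMap_eq hH hY hξ₀
    exact ⟨hΛ.normEstimate hH hY g, hΛ.detEstimate hH hY g, hΛ.modularEstimate hH hY g⟩
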